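/- For $d\in\{2,3,\dots\}$ let $\mathbb{R}^d$ carry the Euclidean inner product, and let $\mathbb{R}^\infty:=\ell^2$ be the Hilbert space of real square summable sequences. Let $O(d)$ be the group of linear isometries of $\mathbb{R}^d$ onto itself ($2\le d\le\infty$). A function $K\colon X\times X\to\mathbb{C}$ is called a positive definite kernel on $X$ if $\sum_{i,j=1}^m c_i\overline{c_j}K(x_i,x_j)\ge 0$ (in particular, is real) for all $m\in\mathbb{N}$, $x_1,\dots,x_m\in X$ and $c_1,\dots,c_m\in\mathbb{C}$. For $d<\infty$ put $\lambda=\frac{d-2}{2}$ and let $\bar P_n(t)=P_n(t)/P_n(1)$, where $P_n$ is the Gegenbauer polynomial of index $\lambda$ and degree $n$ (the Chebyshev polynomial of the first kind if $\lambda=0$); for $d=\infty$ put $\bar P_n(t)=t^n$. Let $d\in\{2,3,\dots,\infty\}$ and let $K\colon\mathbb{R}^d\times\mathbb{R}^d\to\mathbb{C}$ be continuous. Then the following are equivalent: (i) $K$ is a positive definite kernel and $K(Ux,Uy)=K(x,y)$ for all $x,y\in\mathbb{R}^d$ and all $U\in O(d)$. (ii) $K$ is a positive definite kernel and $K(x,y)=\kappa(\|x\|,\|y\|,\langle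 x,y\rangle)$ for all $x,y\in\mathbb{R}^d$, for some continuous $\kappa\colon M\to\mathbb{C}$, where $M=\{(r,s,\gamma)\in[0,\infty)^2\times\mathbb{R}:|\gamma|\le rs\}$. (iii) For all $x,y\in\mathbb{R}^d$, $$K(x,y)=\sum_{n=0}^\infty\alpha_n(\|x\|,\|y\|)\,\bar P_n\Bigl(\Bigl\langle\tfrac{x}{\|x\|},\tfrac{y}{\|y\|}\Bigr\rangle\Bigr),$$ where the $\alpha_n\colon[0,\infty)^2\to\mathbb{C}$ are continuous positive definite kernels on $[0,\infty)$ with $\sum_{n=0}^\infty\alpha_n(r,r)<\infty$ for all $r\ge 0$ and $\alpha_n(r,0)=\alpha_n(0,r)=0$ for all $r\ge 0$ and $n\ge 1$. (When $x=0$ or $y=0$, only the term $n=0$ contributes, with $\bar P_0\equiv 1$.) The sequence $(\alpha_n)_{n\ge0}$ in (iii) is uniquely determined by $K$. All $\alpha_n$ are real-valued if and only if $K$ is real-valued. Moreover, if $d<\infty$, then for all $n\ge0$ and $r,s\ge0$ $$\alpha_n(r,s)=\frac{\int_{-1}^1\kappa(r,s,rs\rho)\,\bar P_n(\rho)\,w(\rho)\,d\rho}{\int_{-1}^1\bar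 P_n(\rho)^2\,w(\rho)\,d\rho},\qquad w(\rho)=(1-\rho^2)^{\lambda-\frac12},$$ with $\kappa$ as in (ii). -/

import Mathlib

open scoped NNReal ComplexOrder

/-- A positive definite kernel: all the sums `∑ c i * conj (c j) * K (x i) (x j)` are real and
nonnegative (this is what `0 ≤ z` means for a complex number `z`). -/
def IsPosDefKernel {X : Type*} (K : X → X → ℂ) : Prop :=
  ∀ (m : ℕ) (x : Fin m → X) (c : Fin m → ℂ),
    0 ≤ ∑ i, ∑ j, c i * (starRingEnd ℂ) (c j) * K (x i) (x j)

/-- Invariance of `K` under the orthogonal group, the group of all (bijective) linear isometries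
of `E`. -/
def IsOrthogonallyInvariant {E : Type*} [NormedAddCommGroup E] [InnerProductSpace ℝ E]
    (K : E → E → ℂ) : Prop :=
  ∀ (U : E ≃ₗᵢ[ℝ] E) (x y : E), K (U x) (U y) = K x y

/-- The set of all `(r, s, γ)` with `r, s ≥ 0` and `|γ| ≤ r s`. -/
def invariantDomain : Set (ℝ≥0 × ℝ≥0 × ℝ) :=
  {p | |p.2.2| ≤ (p.1 : ℝ) * (p.2.1 : ℝ)}

/-- `K(x, y) = κ(‖x‖, ‖y‖, ⟨x, y⟩)` with `κ` continuous on `invariantDomain`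
(the values of `κ` off this set are irrelevant). -/
def IsInvariantRepresentation {E : Type*} [NormedAddCommGroup E] [InnerProductSpace ℝ E]
    (K : E → E → ℂ) (κ : ℝ≥0 → ℝ≥0 → ℝ → ℂ) : Prop :=
  ContinuousOn (fun p : ℝ≥0 × ℝ≥0 × ℝ => κ p.1 p.2.1 p.2.2) invariantDomain ∧
    ∀ x y : E, K x y = κ ‖x‖₊ ‖y‖₊ (inner ℝ x y)

/-- The three-term recurrence of the Gegenbauer (ultraspherical) polynomials of index `lam`,
`n C_n = 2 (n + lam - 1) t C_{n-1} - (n + 2 lam - 2) C_{n-2}`, `C_0 = 1`, `C_1 = 2 lam t`. -/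
noncomputable def gegenbauerRec (lam : ℝ) : ℕ → Polynomial ℝ
  | 0 => 1
  | 1 => Polynomial.C (2 * lam) * Polynomial.X
  | n + 2 => Polynomial.C (1 / ((n : ℝ) + 2)) *
      (Polynomial.C (2 * ((n : ℝ) + 1 + lam)) * Polynomial.X * gegenbauerRec lam (n + 1) -
        Polynomial.C ((n : ℝ) + 2 * lam) * gegenbauerRec lam n)

open Classical in
/-- The Gegenbauer polynomial of index `lam` and degree `n`. For `lam = 0` the recurrence
degenerates, and, as usual, one takes the Chebyshev polynomials of the first kind (which are, up to
positive constant factors, the limits of `C_n / lam` as `lam → 0`, for `n ≥ 1`). -/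
noncomputable def gegenbauer (lam : ℝ) (n : ℕ) : Polynomial ℝ :=
  if lam = 0 then Polynomial.Chebyshev.T ℝ (n : ℤ) else gegenbauerRec lam n

/-- The Gegenbauer polynomials normalized to take the value `1` at `1`. -/
noncomputable def normalizedGegenbauer (lam : ℝ) (n : ℕ) (t : ℝ) : ℝ :=
  (gegenbauer lam n).eval t / (gegenbauer lam n).eval 1

/-- The Gegenbauer weight `w(ρ) = (1 - ρ²)^(lam - 1/2)`. -/
noncomputable def gegenbauerWeight (lam ρ : ℝ) : ℝ :=
  (1 - ρ ^ 2) ^ (lam - 1 / 2)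

/-- `K(x, y) = ∑ₙ αₙ(‖x‖, ‖y‖) Pₙ(⟨x/‖x‖, y/‖y‖⟩)` with continuous positive definite kernels `αₙ`
on `[0, ∞)` that are summable on the diagonal and, for `n ≥ 1`, vanish at the origin. -/
structure IsSphericalExpansion {E : Type*} [NormedAddCommGroup E] [InnerProductSpace ℝ E]
    (P : ℕ → ℝ → ℝ) (K : E → E → ℂ) (α : ℕ → ℝ≥0 → ℝ≥0 → ℂ) : Prop where
  continuous : ∀ n, Continuous (fun p : ℝ≥0 × ℝ≥0 => α n p.1 p.2)
  posDef : ∀ n, IsPosDefKernel (α n)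
  summable : ∀ r, Summable (fun n => α n r r)
  zero_at_origin : ∀ n, 1 ≤ n → ∀ r, α n r 0 = 0 ∧ α n 0 r = 0
  hasSum : ∀ x y : E, HasSum
    (fun n => α n ‖x‖₊ ‖y‖₊ * ((P n (inner ℝ (‖x‖⁻¹ • x) (‖y‖⁻¹ • y)) : ℝ) : ℂ)) (K x y)

/-! An orthogonally invariant kernel depends only on the Gram data of `(x, y)`: two reflections
carry any pair of vectors to any other pair with the same Gram matrix. Evaluating `K` on the rows of
the positive square root of the 2×2 Gram matrix gives a `κ` that is continuous on all of the domain,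
degenerate configurations included. For fixed radii it remains to expand `t ↦ κ(r, s, rst)` on `[-1,
1]`. An expansion is positive definite by Schur's product theorem, because each `P n` is positive
definite on the sphere. Uniqueness of coefficients gives both their vanishing at the origin and, by
conjugation, the criterion for real values.

In finite dimension, the first coordinate of a random point of the sphere has the Gegenbauer law.
This is derived without polar coordinates: rotation invariance and the weight give the same
integration-by-parts identity, and that identity fixes all moments. Convolving `Q n` with itself
over the sphere gives a positive multiple of `Q n` (`integral_zonalPoly_mul`), so `Q n` is a Gram
kernel and `|Q n| ≤ 1`. The Gegenbauer coefficient of `κ(r, s, rs·)` is then positive definite in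
`(r, s)`, being a double average over the sphere of a product of two positive definite kernels.
Diagonal coefficients are nonnegative, and testing against `(1 + t) ^ m`, which concentrates at `t =
1` and has nonnegative Gegenbauer coefficients, bounds their sum by `sup |κ|` (`summable_coeff`).
The series therefore converges absolutely, and its sum is `κ`.

In `ℓ²` there is no invariant measure; inscribed cubes of every dimension `N` replace it. On
`{±1}^N` the kernel depends only on the product `στ`, so its Walsh–Fourier coefficients are positive
definite in the radii. Grouped by the size of the character, they are exactly the coefficients of
the `N`-th Bernstein polynomial of `κ(r, s, rs·)`. Bernstein's theorem and a compactness argument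
for coefficient sequences bounded in `ℓ¹` give the power series in the limit. -/

/-! ### Positive definite kernels -/

section Kernels

open ComplexConjugate Filter Topology

namespace IsPosDefKernel

variable {X Y : Type*} {K L : X → X → ℂ}

theorem sum_nonneg (hK : IsPosDefKernel K) {ι : Type*} (s : Finset ι) (x : ι → X) (c : ι → ℂ) :
    0 ≤ ∑ i ∈ s, ∑ j ∈ s, c i * conj (c j) * K (x i) (x j) := by
  have h := hK s.card (fun i => x (s.equivFin.symm i)) (fun i => c (s.equivFin.symm i))
  have key : ∀ f : ι → ℂ, ∑ i, f (s.equivFin.symm i) = ∑ i ∈ s, f i := fun f => by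
    rw [Equiv.sum_comp s.equivFin.symm (fun i : s => f i), Finset.sum_coe_sort]
  rw [← key]
  simp_rw [← key (fun j => c _ * conj (c j) * K (x _) (x j))]
  exact h

theorem sum_univ_nonneg (hK : IsPosDefKernel K) {ι : Type*} [Fintype ι] (x : ι → X) (c : ι → ℂ) :
    0 ≤ ∑ i, ∑ j, c i * conj (c j) * K (x i) (x j) :=
  hK.sum_nonneg Finset.univ x c

theorem two_point (hK : IsPosDefKernel K) (x y : X) (a b : ℂ) :
    0 ≤ a * conj a * K x x + a * conj b * K x y + (b * conj a * K y x + b * conj b * K y y) := by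
  simpa [Fin.sum_univ_two] using hK 2 ![x, y] ![a, b]

theorem diag_nonneg (hK : IsPosDefKernel K) (x : X) : 0 ≤ K x x := by
  simpa using hK 1 ![x] ![1]

theorem diag_eq_re (hK : IsPosDefKernel K) (x : X) : K x x = ((K x x).re : ℂ) := by
  have h := Complex.nonneg_iff.1 (hK.diag_nonneg x)
  apply Complex.ext <;> simp [← h.2]

theorem diag_re_nonneg (hK : IsPosDefKernel K) (x : X) : 0 ≤ (K x x).re :=
  (Complex.nonneg_iff.1 (hK.diag_nonneg x)).1

/-- Reality of the two-point sums with coefficients `(1, 1)` and `(1, i)` determines the imaginary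
and the real parts. -/
theorem conj_symm (hK : IsPosDefKernel K) (x y : X) : conj (K x y) = K y x := by
  have hx := (Complex.nonneg_iff.1 (hK.diag_nonneg x)).2
  have hy := (Complex.nonneg_iff.1 (hK.diag_nonneg y)).2
  have h1 := (Complex.nonneg_iff.1 (hK.two_point x y 1 1)).2
  have h2 := (Complex.nonneg_iff.1 (hK.two_point x y 1 Complex.I)).2
  simp at h1 h2
  apply Complex.ext
  · simp; linarith
  · simp; linarith

/-- The two-point sum with coefficients `1` and `-z/|z|`, where `z = K x y`, equals `K x x + K y y -
2|z|`. This additive form lets summability on the diagonal control everything off it. -/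
theorem norm_le (hK : IsPosDefKernel K) (x y : X) :
    ‖K x y‖ ≤ ((K x x).re + (K y y).re) / 2 := by
  by_cases hz : K x y = 0
  · rw [hz]; have := hK.diag_re_nonneg x; have := hK.diag_re_nonneg y; simp; linarith
  set z := K x y with hzdef
  have hn : (‖z‖ : ℂ) ≠ 0 := by simpa using hz
  have hzz : z * conj z = (‖z‖ : ℂ) ^ 2 := Complex.mul_conj' z
  have h1 : conj (-(z / ‖z‖)) * z = -(‖z‖ : ℂ) := by
    simp only [map_neg, map_div₀, Complex.conj_ofReal]
    field_simp
    rw [mul_comm, hzz]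
  have h2 : -(z / ‖z‖) * conj z = -(‖z‖ : ℂ) := by
    field_simp
    rw [hzz]
  have h3 : -(z / ‖z‖) * conj (-(z / ‖z‖)) = 1 := by
    simp only [map_neg, map_div₀, Complex.conj_ofReal]
    field_simp
    rw [hzz]
  have h := (Complex.nonneg_iff.1 (hK.two_point x y 1 (-(z / ‖z‖)))).1
  rw [← hK.conj_symm x y, ← hzdef, h3] at h
  simp only [map_one, one_mul, mul_one] at h
  rw [h1, h2] at h
  simp at h
  linarith

theorem comp (hK : IsPosDefKernel K) (f : Y → X) : IsPosDefKernel fun x y => K (f x) (f y) :=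
  fun m x c => hK m (fun i => f (x i)) c

/-- Schur's product theorem, through the Hadamard product of positive semidefinite matrices. -/
theorem mul (hK : IsPosDefKernel K) (hL : IsPosDefKernel L) :
    IsPosDefKernel fun x y => K x y * L x y := by
  have key : ∀ {M : X → X → ℂ} (_ : IsPosDefKernel M) (m : ℕ) (x : Fin m → X),
      (Matrix.of fun i j => M (x i) (x j)).PosSemidef := by
    intro M hM m x
    rw [Matrix.posSemidef_iff_dotProduct_mulVec]
    refine ⟨?_, fun c => ?_⟩
    · ext i j
      simp [Matrix.conjTranspose_apply, hM.conj_symm]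
    -- The matrix form conjugates the left vector and the kernel sum the right coefficient, hence
    -- the conjugated coefficients.
    · have := hM m x (fun i => conj (c i))
      convert this using 1
      simp only [dotProduct, Matrix.mulVec, Finset.mul_sum]
      refine Finset.sum_congr rfl fun i _ => Finset.sum_congr rfl fun j _ => ?_
      simp
      ring
  intro m x c
  have h := (Matrix.posSemidef_iff_dotProduct_mulVec.1
    ((key hK m x).hadamard (key hL m x))).2 (fun i => conj (c i))
  convert h using 1
  simp only [dotProduct, Matrix.mulVec, Finset.mul_sum]
  refine Finset.sum_congr rfl fun i _ => Finset.sum_congr rfl fun j _ => ?_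
  simp
  ring

theorem of_tendsto {ι : Type*} {l : Filter ι} [l.NeBot] {F : ι → X → X → ℂ}
    (hF : ∀ᶠ i in l, IsPosDefKernel (F i)) (h : ∀ x y, Tendsto (fun i => F i x y) l (𝓝 (K x y))) :
    IsPosDefKernel K := by
  intro m x c
  refine ge_of_tendsto (b := (0 : ℂ))
    (f := fun i => ∑ a, ∑ b, c a * conj (c b) * F i (x a) (x b)) ?_
    (hF.mono fun i hi => hi m x c)
  exact tendsto_finsetSum _ fun a _ => tendsto_finsetSum _ fun b _ => (h _ _).const_mul _

theorem const_mul (hK : IsPosDefKernel K) {a : ℂ} (ha : 0 ≤ a) :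
    IsPosDefKernel fun x y => a * K x y := by
  intro m x c
  have := mul_nonneg ha (hK m x c)
  simp only [Finset.mul_sum] at this
  refine this.trans_eq (Finset.sum_congr rfl fun i _ => Finset.sum_congr rfl fun j _ => ?_)
  ring

theorem finset_sum {ι : Type*} (s : Finset ι) {F : ι → X → X → ℂ}
    (hF : ∀ i ∈ s, IsPosDefKernel (F i)) : IsPosDefKernel fun x y => ∑ i ∈ s, F i x y := by
  intro m x c
  have : 0 ≤ ∑ k ∈ s, ∑ i, ∑ j, c i * conj (c j) * F k (x i) (x j) :=
    Finset.sum_nonneg fun k hk => hF k hk m x c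
  simp only [Finset.mul_sum]
  rw [Finset.sum_comm] at this
  convert this using 2
  rw [Finset.sum_comm]

theorem hasSum {ι : Type*} {F : ι → X → X → ℂ} (hF : ∀ i, IsPosDefKernel (F i))
    (h : ∀ x y, HasSum (fun i => F i x y) (K x y)) : IsPosDefKernel K :=
  of_tendsto (l := atTop) (F := fun s x y => ∑ i ∈ s, F i x y)
    (.of_forall fun s => finset_sum s fun i _ => hF i) h

theorem conj_kernel (hK : IsPosDefKernel K) :
    IsPosDefKernel fun x y => conj (K x y) := by
  intro m x c
  have h := hK m x (fun i => starRingEnd ℂ (c i))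
  rw [Complex.nonneg_iff] at h ⊢
  have e : ∑ i, ∑ j, c i * (starRingEnd ℂ) (c j) * (starRingEnd ℂ) (K (x i) (x j)) =
      (starRingEnd ℂ) (∑ i, ∑ j, (starRingEnd ℂ) (c i) * (starRingEnd ℂ) ((starRingEnd ℂ) (c j)) *
        K (x i) (x j)) := by
    simp [map_sum]
  rw [e, Complex.conj_re, Complex.conj_im, ← h.2]
  exact ⟨h.1, by simp⟩

end IsPosDefKernel

theorem isPosDefKernel_one {X : Type*} : IsPosDefKernel fun _ _ : X => (1 : ℂ) := by
  intro m x c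
  have : ∑ i, ∑ j, c i * conj (c j) * 1 = (∑ i, c i) * conj (∑ i, c i) := by
    rw [map_sum, Finset.sum_mul_sum]; simp
  rw [this]
  exact mul_star_self_nonneg _

/-- For complex coefficients the real part is the sum of two real Gram forms, those of the real and
of the imaginary parts; the cross terms cancel by symmetry. -/
theorem isPosDefKernel_inner {E : Type*} [NormedAddCommGroup E] [InnerProductSpace ℝ E] :
    IsPosDefKernel fun x y : E => ((inner ℝ x y : ℝ) : ℂ) := by
  intro m x c
  have h : ∀ a : Fin m → ℝ, 0 ≤ ∑ i, ∑ j, a i * a j * inner ℝ (x i) (x j) := fun a => by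
    have : ∑ i, ∑ j, a i * a j * inner ℝ (x i) (x j) =
        inner ℝ (∑ i, a i • x i : E) (∑ i, a i • x i : E) := by
      simp only [sum_inner, inner_sum, real_inner_smul_left, real_inner_smul_right, mul_assoc]
      simp only [real_inner_comm]
    rw [this]
    exact real_inner_self_nonneg
  have h1 := h fun i => (c i).re
  have h2 := h fun i => (c i).im
  rw [Complex.nonneg_iff]
  constructor
  · have := add_nonneg h1 h2
    rw [← Finset.sum_add_distrib] at this
    simp only [Complex.re_sum]
    refine this.trans_eq (Finset.sum_congr rfl fun i _ => ?_)
    rw [← Finset.sum_add_distrib]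
    refine Finset.sum_congr rfl fun j _ => ?_
    simp
    ring
  · have h3 : ∑ i, ∑ j, (c i).re * (c j).im * inner ℝ (x i) (x j) =
        ∑ i, ∑ j, (c i).im * (c j).re * inner ℝ (x i) (x j) := by
      rw [Finset.sum_comm]
      refine Finset.sum_congr rfl fun i _ => Finset.sum_congr rfl fun j _ => ?_
      rw [real_inner_comm]; ring
    simp only [Complex.im_sum]
    symm
    calc _ = ∑ i, ∑ j, ((c i).im * (c j).re * inner ℝ (x i) (x j) -
        (c i).re * (c j).im * inner ℝ (x i) (x j)) := by
          refine Finset.sum_congr rfl fun i _ => Finset.sum_congr rfl fun j _ => ?_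
          simp
          ring
      _ = 0 := by simp only [Finset.sum_sub_distrib]; rw [h3, sub_self]

theorem IsPosDefKernel.pow {X : Type*} {K : X → X → ℂ} (hK : IsPosDefKernel K) (n : ℕ) :
    IsPosDefKernel fun x y => K x y ^ n := by
  induction n with
  | zero => simpa using isPosDefKernel_one
  | succ n ih => simpa [pow_succ] using ih.mul hK

end Kernels

/-! ### Orthogonal invariance and the continuous Gram representation -/

section Invariant

open Filter Topology

variable {E : Type*} [NormedAddCommGroup E] [InnerProductSpace ℝ E]

/-- A reflection `R` takes `x` to `x'`; a second one takes `R y` to `y'` and fixes `x'`, since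
equality of inner products makes `x'` orthogonal to `R y - y'`. This needs neither a basis, nor
completeness, nor linear independence. -/
theorem exists_linearIsometryEquiv_pair {x y x' y' : E} (hx : ‖x‖ = ‖x'‖) (hy : ‖y‖ = ‖y'‖)
    (hxy : inner ℝ x y = inner ℝ x' y') : ∃ U : E ≃ₗᵢ[ℝ] E, U x = x' ∧ U y = y' := by
  set R := (Submodule.span ℝ {x - x'})ᗮ.reflection
  have hR : R x = x' := Submodule.reflection_sub hx
  set z := R y
  have hz : ‖z‖ = ‖y'‖ := by rw [← hy]; exact R.norm_map y
  refine ⟨R.trans (Submodule.span ℝ {z - y'})ᗮ.reflection, ?_, Submodule.reflection_sub hz⟩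
  rw [LinearIsometryEquiv.trans_apply, hR]
  apply Submodule.reflection_mem_subspace_eq_self
  rw [Submodule.mem_orthogonal_singleton_iff_inner_right, inner_sub_left]
  have : inner ℝ z x' = inner ℝ y x := by rw [← hR]; exact R.inner_map_map y x
  rw [this, real_inner_comm, hxy, real_inner_comm, sub_self]

theorem IsInvariantRepresentation.isOrthogonallyInvariant {K : E → E → ℂ} {κ : ℝ≥0 → ℝ≥0 → ℝ → ℂ}
    (h : IsInvariantRepresentation K κ) : IsOrthogonallyInvariant K := by
  intro U x y
  rw [h.2, h.2, U.inner_map_map, U.nnnorm_map, U.nnnorm_map]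

theorem IsOrthogonallyInvariant.eq_of_gram {K : E → E → ℂ} (h : IsOrthogonallyInvariant K)
    {x y x' y' : E} (hx : ‖x‖ = ‖x'‖) (hy : ‖y‖ = ‖y'‖)
    (hxy : inner ℝ x y = inner ℝ x' y') : K x y = K x' y' := by
  obtain ⟨U, rfl, rfl⟩ := exists_linearIsometryEquiv_pair hx hy hxy
  exact (h U x y).symm

/-- The common denominator of the entries of the positive square root of the Gram matrix with
entries `a ^ 2, γ, γ, b ^ 2`; it is the square root of the trace plus twice the root of the
determinant. -/
noncomputable def gramDenom (a b γ : ℝ) : ℝ :=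
  √(a ^ 2 + b ^ 2 + 2 * √(a ^ 2 * b ^ 2 - γ ^ 2))

/-- The first diagonal entry of the square root of the Gram matrix. -/
noncomputable def gramDiag (a b γ : ℝ) : ℝ :=
  (a ^ 2 + √(a ^ 2 * b ^ 2 - γ ^ 2)) / gramDenom a b γ

/-- The off-diagonal entry of the square root of the Gram matrix. -/
noncomputable def gramOff (a b γ : ℝ) : ℝ := γ / gramDenom a b γ

/-- By Cayley–Hamilton the root of a positive 2×2 matrix `G` with `δ = √(det G)` is `(G + δ I) /
√(tr G + 2δ)`. The identities say that the rows of this root have Gram matrix `G`. -/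
theorem gram_identities {a b γ : ℝ} (h : |γ| ≤ a * b) :
    gramDiag a b γ ^ 2 + gramOff a b γ ^ 2 = a ^ 2 ∧
    gramOff a b γ * (gramDiag a b γ + gramDiag b a γ) = γ := by
  have hγ : γ ^ 2 ≤ a ^ 2 * b ^ 2 := by
    rw [← mul_pow]; exact sq_le_sq' (by linarith [neg_abs_le γ]) ((le_abs_self γ).trans h)
  unfold gramOff gramDiag
  have hsym : gramDenom b a γ = gramDenom a b γ := by
    unfold gramDenom; rw [mul_comm (b ^ 2), add_comm (b ^ 2)]
  rw [hsym, mul_comm (b ^ 2)]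
  have hτ : gramDenom a b γ ^ 2 = a ^ 2 + b ^ 2 + 2 * √(a ^ 2 * b ^ 2 - γ ^ 2) :=
    Real.sq_sqrt (by positivity)
  have hδ : √(a ^ 2 * b ^ 2 - γ ^ 2) ^ 2 = a ^ 2 * b ^ 2 - γ ^ 2 := Real.sq_sqrt (by linarith)
  have hδ0 := Real.sqrt_nonneg (a ^ 2 * b ^ 2 - γ ^ 2)
  generalize √(a ^ 2 * b ^ 2 - γ ^ 2) = δ at *
  -- If the denominator vanishes, division by zero makes the entries `0`, which is right because
  -- then `a = γ = 0`.
  by_cases h0 : gramDenom a b γ = 0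
  · rw [h0] at hτ ⊢
    have ha0 : a ^ 2 = 0 := by nlinarith [sq_nonneg a, sq_nonneg b]
    have : γ = 0 := by
      rw [ha0] at hγ
      exact pow_eq_zero_iff two_ne_zero |>.1 (le_antisymm (by linarith) (sq_nonneg γ))
    simp [ha0, this]
  · generalize gramDenom a b γ = τ at *
    constructor
    · field_simp
      rw [hτ]
      linear_combination hδ
    · field_simp
      rw [hτ]
      ring

/-- The denominator vanishes only where both radii do, and there the bound by the sum of the radii
forces the limit `0`. -/
theorem continuousOn_gram_aux {f : ℝ≥0 × ℝ≥0 × ℝ → ℝ}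
    (hf : ∀ p ∈ invariantDomain, |f p| ≤ p.1 + p.2.1) {g : ℝ≥0 × ℝ≥0 × ℝ → ℝ}
    (hg : Continuous g) (hfg : ∀ p, f p = g p / gramDenom p.1 p.2.1 p.2.2) :
    ContinuousOn f invariantDomain := by
  intro p hp
  have hden : Continuous fun p : ℝ≥0 × ℝ≥0 × ℝ => gramDenom p.1 p.2.1 p.2.2 := by
    unfold gramDenom; fun_prop
  by_cases h0 : gramDenom p.1 p.2.1 p.2.2 = 0
  · unfold gramDenom at h0
    rw [Real.sqrt_eq_zero (by positivity)] at h0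
    have hδ0 := Real.sqrt_nonneg ((p.1 : ℝ) ^ 2 * (p.2.1 : ℝ) ^ 2 - p.2.2 ^ 2)
    have h1 : (p.1 : ℝ) = 0 := pow_eq_zero_iff two_ne_zero |>.1
      (by nlinarith [sq_nonneg (p.1 : ℝ), sq_nonneg (p.2.1 : ℝ)])
    have h2 : (p.2.1 : ℝ) = 0 := pow_eq_zero_iff two_ne_zero |>.1
      (by nlinarith [sq_nonneg (p.1 : ℝ), sq_nonneg (p.2.1 : ℝ)])
    have hfp : f p = 0 := by
      have := hf p hp
      rw [h1, h2, add_zero] at this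
      exact abs_nonpos_iff.1 this
    have hc : Continuous fun q : ℝ≥0 × ℝ≥0 × ℝ => (q.1 : ℝ) + q.2.1 := by fun_prop
    have hlim : Tendsto (fun q : ℝ≥0 × ℝ≥0 × ℝ => (q.1 : ℝ) + q.2.1)
        (𝓝[invariantDomain] p) (𝓝 0) := by
      have := hc.tendsto p
      rw [h1, h2, add_zero] at this
      exact this.mono_left nhdsWithin_le_nhds
    rw [ContinuousWithinAt, hfp]
    refine squeeze_zero_norm' ?_ hlim
    filter_upwards [self_mem_nhdsWithin] with q hq using hf q hq
  · have : ContinuousAt (fun p => g p / gramDenom p.1 p.2.1 p.2.2) p :=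
      hg.continuousAt.div hden.continuousAt h0
    rw [funext hfg]
    exact this.continuousWithinAt

theorem continuousOn_gramDiag : ContinuousOn
    (fun p : ℝ≥0 × ℝ≥0 × ℝ => gramDiag p.1 p.2.1 p.2.2) invariantDomain := by
  refine continuousOn_gram_aux (fun p hp => ?_)
    (g := fun p => (p.1 : ℝ) ^ 2 + √((p.1 : ℝ) ^ 2 * (p.2.1 : ℝ) ^ 2 - p.2.2 ^ 2))
    (by fun_prop) (fun p => rfl)
  have h := (gram_identities hp).1
  refine abs_le_of_sq_le_sq ?_ (add_nonneg p.1.coe_nonneg p.2.1.coe_nonneg)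
  nlinarith [sq_nonneg (gramOff p.1 p.2.1 p.2.2), sq_nonneg (p.2.1 : ℝ),
    mul_nonneg p.1.coe_nonneg p.2.1.coe_nonneg]

theorem continuousOn_gramOff : ContinuousOn
    (fun p : ℝ≥0 × ℝ≥0 × ℝ => gramOff p.1 p.2.1 p.2.2) invariantDomain := by
  refine continuousOn_gram_aux (fun p hp => ?_) (g := fun p => p.2.2) (by fun_prop) (fun p => rfl)
  have h := (gram_identities hp).1
  refine abs_le_of_sq_le_sq ?_ (add_nonneg p.1.coe_nonneg p.2.1.coe_nonneg)
  nlinarith [sq_nonneg (gramDiag p.1 p.2.1 p.2.2), sq_nonneg (p.2.1 : ℝ),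
    mul_nonneg p.1.coe_nonneg p.2.1.coe_nonneg]

theorem norm_smul_add_smul_orthonormal {e₁ e₂ : E} (h₁ : ‖e₁‖ = 1) (h₂ : ‖e₂‖ = 1)
    (h₁₂ : inner ℝ e₁ e₂ = 0) (a b : ℝ) : ‖a • e₁ + b • e₂‖ ^ 2 = a ^ 2 + b ^ 2 := by
  rw [norm_add_sq_real, norm_smul, norm_smul, h₁, h₂, real_inner_smul_left, real_inner_smul_right,
    h₁₂]
  simp

theorem inner_smul_add_smul_orthonormal {e₁ e₂ : E} (h₁ : ‖e₁‖ = 1) (h₂ : ‖e₂‖ = 1)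
    (h₁₂ : inner ℝ e₁ e₂ = 0) (a b c d : ℝ) :
    inner ℝ (a • e₁ + b • e₂) (c • e₁ + d • e₂) = a * c + b * d := by
  have h₂₁ : inner ℝ e₂ e₁ = 0 := by rw [real_inner_comm, h₁₂]
  simp only [inner_add_left, inner_add_right, real_inner_smul_left, real_inner_smul_right, h₁₂,
    h₂₁, real_inner_self_eq_norm_sq, h₁, h₂]
  ring

/-- The rows of the square root of the Gram matrix, placed in the plane of `e₁, e₂`, are a pair
congruent to `(x, y)` and depending continuously on the data. A Gram–Schmidt choice of the pair
would be discontinuous where the first radius is `0`. -/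
theorem IsOrthogonallyInvariant.exists_representation {K : E → E → ℂ}
    (hK : Continuous fun p : E × E => K p.1 p.2) (h : IsOrthogonallyInvariant K) {e₁ e₂ : E}
    (h₁ : ‖e₁‖ = 1) (h₂ : ‖e₂‖ = 1) (h₁₂ : inner ℝ e₁ e₂ = 0) :
    ∃ κ, IsInvariantRepresentation K κ := by
  refine ⟨fun r s γ => K (gramDiag r s γ • e₁ + gramOff r s γ • e₂)
    (gramOff r s γ • e₁ + gramDiag s r γ • e₂), ?_, fun x y => ?_⟩
  · have hsw : ContinuousOn (fun p : ℝ≥0 × ℝ≥0 × ℝ => gramDiag p.2.1 p.1 p.2.2)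
        invariantDomain := by
      refine continuousOn_gramDiag.comp (f := fun p : ℝ≥0 × ℝ≥0 × ℝ => (p.2.1, p.1, p.2.2))
        (by fun_prop) fun p hp => ?_
      simpa [invariantDomain, mul_comm] using hp
    have hA := continuousOn_gramDiag
    have hB := continuousOn_gramOff
    refine hK.comp_continuousOn (f := fun p : ℝ≥0 × ℝ≥0 × ℝ =>
      (gramDiag p.1 p.2.1 p.2.2 • e₁ + gramOff p.1 p.2.1 p.2.2 • e₂,
      gramOff p.1 p.2.1 p.2.2 • e₁ + gramDiag p.2.1 p.1 p.2.2 • e₂)) ?_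
    exact ((hA.smul continuousOn_const).add (hB.smul continuousOn_const)).prodMk
      ((hB.smul continuousOn_const).add (hsw.smul continuousOn_const))
  · have hc : |inner ℝ x y| ≤ ‖x‖ * ‖y‖ := abs_real_inner_le_norm x y
    have hid := gram_identities hc
    have hid' := gram_identities (hc.trans_eq (mul_comm _ _))
    have hsym : gramOff ‖y‖ ‖x‖ (inner ℝ x y) = gramOff ‖x‖ ‖y‖ (inner ℝ x y) := by
      unfold gramOff gramDenom
      rw [mul_comm (‖y‖ ^ 2), add_comm (‖y‖ ^ 2)]
    apply h.eq_of_gram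
    · refine (sq_eq_sq₀ (norm_nonneg _) (norm_nonneg _)).1 ?_
      rw [norm_smul_add_smul_orthonormal h₁ h₂ h₁₂]
      exact hid.1.symm
    · refine (sq_eq_sq₀ (norm_nonneg _) (norm_nonneg _)).1 ?_
      rw [norm_smul_add_smul_orthonormal h₁ h₂ h₁₂, ← hid'.1, hsym, add_comm]
      rfl
    · rw [inner_smul_add_smul_orthonormal h₁ h₂ h₁₂]
      simp only [coe_nnnorm]
      linarith [hid.2]

end Invariant

/-! ### Expansions in abstract zonal functions -/

section Expansions

open Filter Topology ComplexConjugate Set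

/-- A sequence of zonal functions on the unit sphere of `E`: positive definite,
starting with the constant `1`, and such that the coefficients of absolutely convergent series are
unique. -/
structure IsZonalSystem (E : Type*) [NormedAddCommGroup E] [InnerProductSpace ℝ E]
    (P : ℕ → ℝ → ℝ) : Prop where
  zero : ∀ t, P 0 t = 1
  posDef : ∀ n, IsPosDefKernel fun ξ η : {x : E // ‖x‖ = 1} => ((P n (inner ℝ ξ.1 η.1) : ℝ) : ℂ)
  unique : ∀ c : ℕ → ℂ, Summable (fun n => ‖c n‖) →
    (∀ t ∈ Icc (-1 : ℝ) 1, HasSum (fun n => c n * (P n t : ℂ)) 0) → c = 0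

variable {E : Type*} [NormedAddCommGroup E] [InnerProductSpace ℝ E] {P : ℕ → ℝ → ℝ}
  {K : E → E → ℂ} {α β : ℕ → ℝ≥0 → ℝ≥0 → ℂ}

theorem inner_unit_mem_Icc {ξ η : E} (hξ : ‖ξ‖ = 1) (hη : ‖η‖ = 1) :
    inner ℝ ξ η ∈ Icc (-1 : ℝ) 1 := by
  have := abs_real_inner_le_norm ξ η
  rw [hξ, hη, one_mul] at this
  exact abs_le.1 this

theorem norm_inv_norm_smul {x : E} (hx : x ≠ 0) : ‖‖x‖⁻¹ • x‖ = 1 := by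
  rw [norm_smul, norm_inv, norm_norm, inv_mul_cancel₀ (norm_ne_zero_iff.2 hx)]

/-- A point of the unit circle in the plane spanned by an orthonormal pair. -/
noncomputable def circlePoint (e₁ e₂ : E) (t : ℝ) : E := t • e₁ + √(1 - t ^ 2) • e₂

theorem norm_circlePoint {e₁ e₂ : E} (h₁ : ‖e₁‖ = 1) (h₂ : ‖e₂‖ = 1) (h₁₂ : inner ℝ e₁ e₂ = 0)
    {t : ℝ} (ht : t ∈ Icc (-1 : ℝ) 1) : ‖circlePoint e₁ e₂ t‖ = 1 := by
  have h := norm_smul_add_smul_orthonormal h₁ h₂ h₁₂ t (√(1 - t ^ 2))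
  rw [Real.sq_sqrt (by nlinarith [ht.1, ht.2])] at h
  have : ‖circlePoint e₁ e₂ t‖ ^ 2 = 1 ^ 2 := by rw [circlePoint, h]; ring
  exact (sq_eq_sq₀ (norm_nonneg _) zero_le_one).1 this

theorem inner_circlePoint {e₁ e₂ : E} (h₁ : ‖e₁‖ = 1) (h₁₂ : inner ℝ e₁ e₂ = 0)
    (t : ℝ) : inner ℝ e₁ (circlePoint e₁ e₂ t) = t := by
  simp [circlePoint, inner_add_right, real_inner_smul_right, h₁₂, h₁]

theorem nnnorm_smul_unit {e : E} (h : ‖e‖ = 1) (r : ℝ≥0) : ‖(r : ℝ) • e‖₊ = r := by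
  ext; simp [norm_smul, h]

theorem IsInvariantRepresentation.apply_smul_unit {κ : ℝ≥0 → ℝ≥0 → ℝ → ℂ}
    (hκ : IsInvariantRepresentation K κ) {ξ η : E}
    (hξ : ‖ξ‖ = 1) (hη : ‖η‖ = 1) (r s : ℝ≥0) :
    K ((r : ℝ) • ξ) ((s : ℝ) • η) = κ r s (r * s * inner ℝ ξ η) := by
  rw [hκ.2, nnnorm_smul_unit hξ, nnnorm_smul_unit hη, real_inner_smul_left, real_inner_smul_right,
    mul_assoc]

theorem IsInvariantRepresentation.continuousOn_section {κ : ℝ≥0 → ℝ≥0 → ℝ → ℂ}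
    (hκ : IsInvariantRepresentation K κ) (r s : ℝ≥0) :
    ContinuousOn (fun ρ : ℝ => κ r s (r * s * ρ)) (Icc (-1) 1) := by
  refine hκ.1.comp (f := fun ρ : ℝ => ((r, s, r * s * ρ) : ℝ≥0 × ℝ≥0 × ℝ)) (by fun_prop)
    fun ρ hρ => ?_
  simp only [invariantDomain, mem_ofPred_eq, abs_mul, NNReal.abs_eq]
  exact mul_le_of_le_one_right (by positivity) (abs_le.2 hρ)

namespace IsSphericalExpansion

theorem summable_norm (h : IsSphericalExpansion P K α) (r s : ℝ≥0) :
    Summable fun n => ‖α n r s‖ := by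
  have h1 := Complex.reCLM.summable (h.summable r)
  have h2 := Complex.reCLM.summable (h.summable s)
  exact Summable.of_nonneg_of_le (fun n => norm_nonneg _) (fun n => (h.posDef n).norm_le r s)
    ((h1.add h2).div_const 2)

/-- The expansion in polar coordinates, with any unit directions allowed even at radius `0`: there
the terms `n ≥ 1` vanish and `P 0 = 1` ignores its argument. -/
theorem hasSum_smul (h : IsSphericalExpansion P K α) (hP : ∀ t, P 0 t = 1) {ξ η : E}
    (hξ : ‖ξ‖ = 1) (hη : ‖η‖ = 1) (r s : ℝ≥0) :
    HasSum (fun n => α n r s * (P n (inner ℝ ξ η) : ℂ)) (K ((r : ℝ) • ξ) ((s : ℝ) • η)) := by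
  refine (h.hasSum _ _).congr_fun fun n => ?_
  rw [nnnorm_smul_unit hξ, nnnorm_smul_unit hη]
  rcases eq_or_ne n 0 with rfl | hn
  · simp [hP]
  have hn1 := h.zero_at_origin n (Nat.one_le_iff_ne_zero.2 hn)
  rcases eq_or_ne r 0 with rfl | hr
  · simp [(hn1 _).2]
  rcases eq_or_ne s 0 with rfl | hs
  · simp [(hn1 _).1]
  have key : ∀ {r : ℝ≥0} {e : E}, r ≠ 0 → ‖e‖ = 1 → ‖(r : ℝ) • e‖⁻¹ • (r : ℝ) • e = e := by
    intro r e hr he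
    have : (r : ℝ) ≠ 0 := by exact_mod_cast hr
    rw [norm_smul, he, mul_one, NNReal.norm_eq, smul_smul, inv_mul_cancel₀ this, one_smul]
  rw [key hr hξ, key hs hη]

theorem isOrthogonallyInvariant (h : IsSphericalExpansion P K α) : IsOrthogonallyInvariant K := by
  intro U x y
  refine (h.hasSum (U x) (U y)).unique ?_
  simpa only [← map_smul, U.inner_map_map, U.nnnorm_map, U.norm_map] using h.hasSum x y

theorem isPosDefKernel (h : IsSphericalExpansion P K α) (hP : IsZonalSystem E P) {e : E}
    (he : ‖e‖ = 1) : IsPosDefKernel K := by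
  classical
  -- The origin gets the arbitrary direction `e`, so that each term is a product of two pulled-back
  -- positive definite kernels on all of `E`.
  let dir : E → {x : E // ‖x‖ = 1} := fun x =>
    if hx : x = 0 then ⟨e, he⟩ else ⟨‖x‖⁻¹ • x, norm_inv_norm_smul hx⟩
  have hdir : ∀ x, (‖x‖₊ : ℝ) • (dir x).1 = x := fun x => by
    by_cases hx : x = 0
    · simp [hx]
    · simp only [dir, hx, dite_false, coe_nnnorm]
      rw [smul_smul, mul_inv_cancel₀ (norm_ne_zero_iff.2 hx), one_smul]
  refine IsPosDefKernel.hasSum (F := fun n x y =>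
    α n ‖x‖₊ ‖y‖₊ * (P n (inner ℝ (dir x).1 (dir y).1) : ℂ)) (fun n => ?_) fun x y => ?_
  · exact ((h.posDef n).comp fun x : E => ‖x‖₊).mul ((hP.posDef n).comp dir)
  · have := h.hasSum_smul hP.zero (dir x).2 (dir y).2 ‖x‖₊ ‖y‖₊
    rwa [hdir, hdir] at this

/-- Points of a unit circle realise every `t ∈ [-1, 1]` as an inner product, so the difference of
the two series is a vanishing zonal series. -/
theorem eq_of_expansion (hα : IsSphericalExpansion P K α) (hβ : IsSphericalExpansion P K β)
    (hP : IsZonalSystem E P) {e₁ e₂ : E} (h₁ : ‖e₁‖ = 1) (h₂ : ‖e₂‖ = 1)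
    (h₁₂ : inner ℝ e₁ e₂ = 0) : α = β := by
  funext n r s
  have := hP.unique (fun n => α n r s - β n r s)
    (((hα.summable_norm r s).add (hβ.summable_norm r s)).of_nonneg_of_le (fun _ => norm_nonneg _)
      fun n => norm_sub_le _ _) fun t ht => ?_
  · exact sub_eq_zero.1 (congrFun this n)
  · have hη := norm_circlePoint h₁ h₂ h₁₂ ht
    have h := (hα.hasSum_smul hP.zero h₁ hη r s).sub (hβ.hasSum_smul hP.zero h₁ hη r s)
    simpa only [inner_circlePoint h₁ h₁₂, sub_mul, sub_self] using h

theorem conj_expansion (h : IsSphericalExpansion P K α) :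
    IsSphericalExpansion P (fun x y => conj (K x y)) fun n r s => conj (α n r s) where
  continuous n := Complex.continuous_conj.comp (h.continuous n)
  posDef n := (h.posDef n).conj_kernel
  summable r := Complex.conjCLE.summable.2 (h.summable r)
  zero_at_origin n hn r := by simp [(h.zero_at_origin n hn r).1, (h.zero_at_origin n hn r).2]
  hasSum x y := by
    have := Complex.conjCLE.toContinuousLinearMap.hasSum (h.hasSum x y)
    simpa using this

/-- If `K` is real, the conjugated coefficients also expand `K`, and uniqueness makes them equal to
the original ones. -/
theorem real_iff (h : IsSphericalExpansion P K α)
    (hP : IsZonalSystem E P) {e₁ e₂ : E} (h₁ : ‖e₁‖ = 1) (h₂ : ‖e₂‖ = 1)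
    (h₁₂ : inner ℝ e₁ e₂ = 0) :
    (∀ n r s, (α n r s).im = 0) ↔ ∀ x y, (K x y).im = 0 := by
  constructor
  · intro hα x y
    have := Complex.imCLM.hasSum (h.hasSum x y)
    simp only [Complex.imCLM_apply, Complex.mul_im, Complex.ofReal_im, mul_zero, hα,
      zero_mul, add_zero] at this
    exact (this.unique hasSum_zero)
  · intro hK n r s
    have hc : IsSphericalExpansion P K fun n r s => (starRingEnd ℂ) (α n r s) := by
      have := h.conj_expansion
      have e : (fun x y => (starRingEnd ℂ) (K x y)) = K := by
        funext x y; exact Complex.conj_eq_iff_im.2 (hK x y)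
      rwa [e] at this
    have := h.eq_of_expansion hc hP h₁ h₂ h₁₂
    exact Complex.conj_eq_iff_im.1 (congrFun (congrFun (congrFun this n) r) s).symm

end IsSphericalExpansion

/-- Reduces the expansion of `K` to one of `κ` at fixed radii; vanishing of the coefficients at the
origin need not be assumed. -/
theorem IsInvariantRepresentation.isSphericalExpansion {κ : ℝ≥0 → ℝ≥0 → ℝ → ℂ}
    (hκ : IsInvariantRepresentation K κ) (hP : IsZonalSystem E P)
    (hcont : ∀ n, Continuous fun p : ℝ≥0 × ℝ≥0 => α n p.1 p.2) (hpd : ∀ n, IsPosDefKernel (α n))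
    (hs : ∀ r, Summable fun n => α n r r)
    (hsum : ∀ r s, ∀ t ∈ Icc (-1 : ℝ) 1,
      HasSum (fun n => α n r s * (P n t : ℂ)) (κ r s (r * s * t))) :
    IsSphericalExpansion P K α := by
  have hnorm : ∀ r s, Summable fun n => ‖α n r s‖ := fun r s =>
    Summable.of_nonneg_of_le (fun n => norm_nonneg _) (fun n => (hpd n).norm_le r s)
      (((Complex.reCLM.summable (hs r)).add (Complex.reCLM.summable (hs s))).div_const 2)
  -- For `rs = 0` the expanded function is constant in `t`, so by uniqueness only the coefficient of
  -- `P 0` survives.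
  have hzero : ∀ r s : ℝ≥0, r = 0 ∨ s = 0 →
      (fun n => α n r s) = fun n => if n = 0 then κ r s 0 else 0 := by
    intro r s hrs
    have hrs' : (r : ℝ) * s = 0 := by rcases hrs with rfl | rfl <;> simp
    have h0 : ∀ t, HasSum (fun n => (if n = 0 then κ r s 0 else 0) * (P n t : ℂ)) (κ r s 0) := by
      intro t
      convert hasSum_ite_eq 0 (κ r s 0) using 2 with n
      split_ifs with hn
      · simp [hn, hP.zero]
      · simp
    have hsm : Summable fun n : ℕ => ‖(if n = 0 then κ r s 0 else 0 : ℂ)‖ :=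
      (hasSum_ite_eq 0 (κ r s 0)).summable.norm
    have := hP.unique (fun n => α n r s - if n = 0 then κ r s 0 else 0)
      (((hnorm r s).add hsm).of_nonneg_of_le (fun _ => norm_nonneg _) fun n => norm_sub_le _ _)
      fun t ht => ?_
    · funext n
      exact sub_eq_zero.1 (congrFun this n)
    · have h := (hsum r s t ht).sub (h0 t)
      rw [hrs', zero_mul, sub_self] at h
      simpa only [sub_mul] using h
  refine ⟨hcont, hpd, hs, fun n hn r => ⟨?_, ?_⟩, fun x y => ?_⟩
  · have := congrFun (hzero r 0 (Or.inr rfl)) n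
    simpa [Nat.one_le_iff_ne_zero.1 hn] using this
  · have := congrFun (hzero 0 r (Or.inl rfl)) n
    simpa [Nat.one_le_iff_ne_zero.1 hn] using this
  · rw [hκ.2]
    by_cases hxy : x = 0 ∨ y = 0
    · have hxy' : ‖x‖₊ = 0 ∨ ‖y‖₊ = 0 := by simpa using hxy
      have hin : inner ℝ x y = 0 := by rcases hxy with rfl | rfl <;> simp
      rw [hin]
      convert hasSum_ite_eq 0 (κ ‖x‖₊ ‖y‖₊ 0) using 2 with n
      rw [congrFun (hzero _ _ hxy') n]
      split_ifs with hn
      · simp [hn, hP.zero]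
      · simp
    · push Not at hxy
      have h := hsum ‖x‖₊ ‖y‖₊ _
        (inner_unit_mem_Icc (norm_inv_norm_smul hxy.1) (norm_inv_norm_smul hxy.2))
      have hx := norm_ne_zero_iff.2 hxy.1
      have hy := norm_ne_zero_iff.2 hxy.2
      convert h using 2
      rw [real_inner_smul_left, real_inner_smul_right, coe_nnnorm, coe_nnnorm]
      field_simp

end Expansions

/-! ### Algebra of Gegenbauer polynomials -/

section Gegenbauer

open Polynomial

/-- The Gegenbauer polynomials normalized to take the value `1` at `1`, by their recurrence. -/
noncomputable def zonalPoly (lam : ℝ) : ℕ → ℝ[X]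
  | 0 => 1
  | 1 => X
  | n + 2 => C (1 / ((n : ℝ) + 1 + 2 * lam)) *
      (C (2 * ((n : ℝ) + 1 + lam)) * X * zonalPoly lam (n + 1) - C ((n : ℝ) + 1) * zonalPoly lam n)

variable {lam : ℝ}

theorem zonalPoly_zero : zonalPoly lam 0 = 1 := by rw [zonalPoly]

theorem zonalPoly_one : zonalPoly lam 1 = X := by rw [zonalPoly]

theorem zonalPoly_rec (hl : 0 ≤ lam) (n : ℕ) :
    ((n : ℝ[X]) + 1 + 2 * C lam) * zonalPoly lam (n + 2) =
      2 * ((n : ℝ[X]) + 1 + C lam) * X * zonalPoly lam (n + 1) -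
        ((n : ℝ[X]) + 1) * zonalPoly lam n := by
  have hn : (n : ℝ) + 1 + 2 * lam ≠ 0 := by positivity
  have h1 : ((n : ℝ[X]) + 1 + 2 * C lam) = C ((n : ℝ) + 1 + 2 * lam) := by
    simp only [map_add, map_mul, map_natCast, map_one, map_ofNat]
  have h2 : 2 * ((n : ℝ[X]) + 1 + C lam) = C (2 * ((n : ℝ) + 1 + lam)) := by
    simp only [map_add, map_mul, map_natCast, map_one, map_ofNat]
  have h3 : ((n : ℝ[X]) + 1) = C ((n : ℝ) + 1) := by simp
  rw [h1, h2, h3, zonalPoly, ← mul_assoc, ← C_mul, mul_one_div_cancel hn, C_1, one_mul]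

theorem eval_one_zonalPoly (hl : 0 ≤ lam) (n : ℕ) : (zonalPoly lam n).eval 1 = 1 := by
  induction n using Nat.twoStepInduction with
  | zero => simp [zonalPoly_zero]
  | one => simp [zonalPoly_one]
  | more n h1 h2 =>
    have hn : (n : ℝ) + 1 + 2 * lam ≠ 0 := by positivity
    have := congrArg (eval 1) (zonalPoly_rec hl n)
    simp [h1, h2] at this
    refine mul_left_cancel₀ hn ?_
    linarith

theorem natDegree_zonalPoly_le (n : ℕ) : (zonalPoly lam n).natDegree ≤ n := by
  induction n using Nat.twoStepInduction with
  | zero => simp [zonalPoly_zero]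
  | one => simp [zonalPoly_one]
  | more n h1 h2 =>
    rw [zonalPoly]
    refine (natDegree_C_mul_le _ _).trans
      ((natDegree_sub_le_of_le (m := n + 2) (n := n + 2) ?_ ?_).trans (by simp))
    · rw [mul_assoc]
      refine (natDegree_C_mul_le _ _).trans (natDegree_mul_le.trans ?_)
      have := natDegree_X_le (R := ℝ)
      omega
    · exact (natDegree_C_mul_le _ _).trans (by omega)

/-- The two ladder relations are proved in one induction. The second at `n + 1` comes from
differentiating the recurrence and inserting both relations at `n`. -/
theorem zonalPoly_derivative (hl : 0 ≤ lam) (n : ℕ) :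
    (1 - X ^ 2) * derivative (zonalPoly lam n) =
      ((n : ℝ[X]) + 2 * C lam) * (X * zonalPoly lam n - zonalPoly lam (n + 1)) ∧
    (1 - X ^ 2) * derivative (zonalPoly lam (n + 1)) =
      ((n : ℝ[X]) + 1) * (zonalPoly lam n - X * zonalPoly lam (n + 1)) := by
  induction n with
  | zero => simp [zonalPoly_zero, zonalPoly_one]; ring
  | succ n ih =>
    obtain ⟨hF, hE⟩ := ih
    have hr := zonalPoly_rec hl n
    have hn : ((n : ℝ[X]) + 1 + 2 * C lam) ≠ 0 := by
      have : (n : ℝ) + 1 + 2 * lam ≠ 0 := by positivity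
      have h1 : ((n : ℝ[X]) + 1 + 2 * C lam) = C ((n : ℝ) + 1 + 2 * lam) := by
        simp only [map_add, map_mul, map_natCast, map_one, map_ofNat]
      rw [h1]; exact C_ne_zero.2 this
    have hd := congrArg derivative hr
    simp only [derivative_mul, derivative_sub, derivative_add, derivative_natCast, derivative_one,
      derivative_C, derivative_X, derivative_ofNat] at hd
    push_cast
    constructor
    · linear_combination hE + hr
    · refine mul_left_cancel₀ hn ?_
      linear_combination (1 - X ^ 2) * hd + 2 * ((n : ℝ[X]) + 1 + C lam) * X * hE -
        ((n : ℝ[X]) + 1) * hF + ((n : ℝ[X]) + 2) * X * hr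

/-- Differentiate the lowering relation, eliminate the neighbouring polynomial by the raising one,
and cancel `1 - X ^ 2`. -/
theorem zonalPoly_ode (hl : 0 ≤ lam) (n : ℕ) :
    (1 - X ^ 2) * derivative (derivative (zonalPoly lam n)) -
      (2 * C lam + 1) * X * derivative (zonalPoly lam n) =
      -((n : ℝ[X]) * ((n : ℝ[X]) + 2 * C lam)) * zonalPoly lam n := by
  cases n with
  | zero => simp [zonalPoly_zero]
  | succ n =>
    obtain ⟨hF, hE⟩ := zonalPoly_derivative hl n
    have hne : (1 - X ^ 2 : ℝ[X]) ≠ 0 := by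
      intro h
      have := congrArg (eval 0) h
      simp at this
    have hd := congrArg derivative hE
    simp only [derivative_mul, derivative_sub, derivative_add, derivative_natCast, derivative_one,
      derivative_X, derivative_X_pow] at hd
    simp only [Nat.cast_ofNat, Nat.add_one_sub_one, pow_one, map_ofNat] at hd
    refine mul_left_cancel₀ hne ?_
    push_cast
    linear_combination (1 - X ^ 2) * hd + ((n : ℝ[X]) + 1) * hF -
      ((n : ℝ[X]) + 2 * C lam) * X * hE

theorem X_mul_zonalPoly (hl : 0 ≤ lam) (n : ℕ) : X * zonalPoly lam (n + 1) =
    (((n : ℝ) + 1 + 2 * lam) / (2 * (n + 1 + lam))) • zonalPoly lam (n + 2) +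
      (((n : ℝ) + 1) / (2 * (n + 1 + lam))) • zonalPoly lam n := by
  have h0 : 2 * ((n : ℝ) + 1 + lam) ≠ 0 := by positivity
  have hr := zonalPoly_rec hl n
  have h1 : ((n : ℝ[X]) + 1 + 2 * C lam) = C ((n : ℝ) + 1 + 2 * lam) := by
    simp only [map_add, map_mul, map_natCast, map_one, map_ofNat]
  have h2 : 2 * ((n : ℝ[X]) + 1 + C lam) = C (2 * ((n : ℝ) + 1 + lam)) := by
    simp only [map_add, map_mul, map_natCast, map_one, map_ofNat]
  have h3 : ((n : ℝ[X]) + 1) = C ((n : ℝ) + 1) := by simp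
  rw [h1, h2, h3] at hr
  have hne : C (2 * ((n : ℝ) + 1 + lam)) ≠ 0 := C_ne_zero.2 h0
  refine mul_left_cancel₀ hne ?_
  have ha := congrArg C (mul_div_cancel₀ ((n : ℝ) + 1 + 2 * lam) h0)
  have hb := congrArg C (mul_div_cancel₀ ((n : ℝ) + 1) h0)
  rw [C_mul] at ha hb
  rw [smul_eq_C_mul, smul_eq_C_mul]
  linear_combination -hr - zonalPoly lam (n + 2) * ha - zonalPoly lam n * hb

theorem mem_span_zonalPoly (hl : 0 ≤ lam) (n : ℕ) {p : ℝ[X]} (hp : p.natDegree ≤ n) :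
    p ∈ Submodule.span ℝ (zonalPoly lam '' ↑(Finset.range (n + 1))) := by
  have hmem : ∀ {m k : ℕ}, m ≤ k →
      zonalPoly lam m ∈ Submodule.span ℝ (zonalPoly lam '' ↑(Finset.range (k + 1))) := by
    intro m k h
    exact Submodule.subset_span ⟨m, by simpa using Nat.lt_succ_of_le h, rfl⟩
  have hX : ∀ k : ℕ,
      (X ^ k : ℝ[X]) ∈ Submodule.span ℝ (zonalPoly lam '' ↑(Finset.range (k + 1))) := by
    intro k
    induction k with
    | zero => rw [pow_zero, ← zonalPoly_zero (lam := lam)]; exact hmem le_rfl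
    | succ k ih =>
      rw [pow_succ']
      refine Submodule.span_induction (p := fun q _ => X * q ∈
        Submodule.span ℝ (zonalPoly lam '' ↑(Finset.range (k + 1 + 1)))) ?_ ?_ ?_ ?_ ih
      · rintro _ ⟨m, hm, rfl⟩
        have hm : m ≤ k := by simpa [Nat.lt_succ_iff] using hm
        cases m with
        | zero =>
          rw [zonalPoly_zero, mul_one, ← zonalPoly_one (lam := lam)]
          exact hmem (by omega)
        | succ m =>
          rw [X_mul_zonalPoly hl]
          exact Submodule.add_mem _ (Submodule.smul_mem _ _ (hmem (by omega)))
            (Submodule.smul_mem _ _ (hmem (by omega)))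
      · simp
      · intro x y _ _ hx hy
        rw [mul_add]; exact Submodule.add_mem _ hx hy
      · intro a x _ hx
        rw [mul_smul_comm]; exact Submodule.smul_mem _ _ hx
  rw [p.as_sum_range_C_mul_X_pow]
  refine Submodule.sum_mem _ fun i hi => ?_
  rw [← smul_eq_C_mul]
  refine Submodule.smul_mem _ _ (Submodule.span_mono (Set.image_mono ?_) (hX i))
  intro j hj
  simp at hj hi ⊢
  omega

/-- Linear functionals on polynomials that have the same moments, up to normalization, as the
Gegenbauer weight. -/
structure IsGegenbauerFunctional (lam : ℝ) (L : ℝ[X] →ₗ[ℝ] ℝ) : Prop where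
  one : L 1 = 1
  adjoint : ∀ p, L ((1 - X ^ 2) * derivative p - (2 * C lam + 1) * X * p) = 0

namespace IsGegenbauerFunctional

variable {L L' : ℝ[X] →ₗ[ℝ] ℝ}

/-- By the differential equation `Q n` is a nonzero multiple, for `n ≠ 0`, of an expression of the
form killed by `adjoint`. -/
theorem zonalPoly_eq_zero (hL : IsGegenbauerFunctional lam L) (hl : 0 ≤ lam) {n : ℕ} (hn : n ≠ 0) :
    L (zonalPoly lam n) = 0 := by
  have h := hL.adjoint (derivative (zonalPoly lam n))
  rw [zonalPoly_ode hl] at h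
  have e : -((n : ℝ[X]) * ((n : ℝ[X]) + 2 * C lam)) * zonalPoly lam n =
      (-((n : ℝ) * (n + 2 * lam))) • zonalPoly lam n := by
    rw [smul_eq_C_mul]; simp [C_ofNat]
  rw [e, map_smul, smul_eq_mul] at h
  refine (mul_eq_zero.1 h).resolve_left ?_
  have : 0 < (n : ℝ) := by exact_mod_cast Nat.pos_of_ne_zero hn
  exact neg_ne_zero.2 (by positivity)

theorem X_pow_mul_eq_zero (hL : IsGegenbauerFunctional lam L) (hl : 0 ≤ lam) {k n : ℕ}
    (hk : k < n) : L (X ^ k * zonalPoly lam n) = 0 := by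
  induction k generalizing n with
  | zero => simpa using hL.zonalPoly_eq_zero hl (by omega : n ≠ 0)
  | succ k ih =>
    obtain ⟨m, rfl⟩ : ∃ m, n = m + 1 := ⟨n - 1, by omega⟩
    rw [pow_succ, mul_assoc, X_mul_zonalPoly hl, mul_add, mul_smul_comm, mul_smul_comm, map_add,
      map_smul, map_smul, ih (by omega), ih (by omega)]
    simp

theorem mul_eq_zero_of_natDegree_lt (hL : IsGegenbauerFunctional lam L) (hl : 0 ≤ lam) {n : ℕ}
    {p : ℝ[X]} (hp : p.natDegree < n) : L (p * zonalPoly lam n) = 0 := by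
  rw [p.as_sum_range_C_mul_X_pow, Finset.sum_mul, map_sum]
  refine Finset.sum_eq_zero fun i hi => ?_
  rw [← smul_eq_C_mul, smul_mul_assoc, map_smul,
    hL.X_pow_mul_eq_zero hl (by rw [Finset.mem_range] at hi; omega), smul_zero]

theorem orthogonal (hL : IsGegenbauerFunctional lam L) (hl : 0 ≤ lam) {m n : ℕ} (hmn : m ≠ n) :
    L (zonalPoly lam m * zonalPoly lam n) = 0 := by
  rcases lt_or_gt_of_ne hmn with h | h
  · exact hL.mul_eq_zero_of_natDegree_lt hl ((natDegree_zonalPoly_le m).trans_lt h)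
  · rw [mul_comm]
    exact hL.mul_eq_zero_of_natDegree_lt hl ((natDegree_zonalPoly_le n).trans_lt h)

theorem X_mul_zonalPoly_mul (hL : IsGegenbauerFunctional lam L) (hl : 0 ≤ lam) (n : ℕ) :
    L (X * zonalPoly lam (n + 1) * zonalPoly lam n) =
      ((n : ℝ) + 1) / (2 * (n + 1 + lam)) * L (zonalPoly lam n * zonalPoly lam n) := by
  rw [X_mul_zonalPoly hl, add_mul, smul_mul_assoc, smul_mul_assoc, map_add, map_smul, map_smul,
    hL.orthogonal hl (by omega), smul_zero, zero_add, smul_eq_mul]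

/-- Expand `L (X Q_{n+1} Q_n)` by the recurrence in either factor: it is a positive multiple of both
`L (Q_n ^ 2)` and `L (Q_{n+1} ^ 2)`, so positivity propagates. No positivity of `L` is assumed. -/
theorem normSq_pos (hL : IsGegenbauerFunctional lam L) (hl : 0 ≤ lam) (n : ℕ) :
    0 < L (zonalPoly lam n * zonalPoly lam n) := by
  induction n with
  | zero => simp [zonalPoly_zero, hL.one]
  | succ n ih =>
    have h1 := hL.X_mul_zonalPoly_mul hl n
    have hpos : 0 < L (X * zonalPoly lam (n + 1) * zonalPoly lam n) := by
      rw [h1]; positivity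
    cases n with
    | zero =>
      have e : X * zonalPoly lam (0 + 1) * zonalPoly lam 0 = zonalPoly lam 1 * zonalPoly lam 1 := by
        simp [zonalPoly_zero, zonalPoly_one]
      rwa [e] at hpos
    | succ n =>
      have e : X * zonalPoly lam (n + 1 + 1) * zonalPoly lam (n + 1) =
          (X * zonalPoly lam (n + 1)) * zonalPoly lam (n + 2) := by ring
      rw [e, X_mul_zonalPoly hl, add_mul, smul_mul_assoc, smul_mul_assoc, map_add, map_smul,
        map_smul, hL.orthogonal hl (by omega : n ≠ n + 2), smul_zero, add_zero, smul_eq_mul] at hpos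
      exact pos_of_mul_pos_right hpos (by positivity)

/-- Multiplication by `X` has nonnegative coefficients in the basis `Q n`, hence so has
multiplication by `1 + X`. -/
theorem one_add_X_pow_mul_nonneg (hL : IsGegenbauerFunctional lam L) (hl : 0 ≤ lam) (m n : ℕ) :
    0 ≤ L ((1 + X) ^ m * zonalPoly lam n) := by
  induction m generalizing n with
  | zero =>
    rcases eq_or_ne n 0 with rfl | hn
    · simp [zonalPoly_zero, hL.one]
    · simp [hL.zonalPoly_eq_zero hl hn]
  | succ m ih =>
    rw [pow_succ, mul_assoc, add_mul, one_mul, mul_add, map_add]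
    refine add_nonneg (ih n) ?_
    cases n with
    | zero => simpa [zonalPoly_zero, zonalPoly_one] using ih 1
    | succ n =>
      rw [X_mul_zonalPoly hl, mul_add, mul_smul_comm, mul_smul_comm, map_add, map_smul, map_smul,
        smul_eq_mul, smul_eq_mul]
      exact add_nonneg (mul_nonneg (by positivity) (ih _)) (mul_nonneg (by positivity) (ih _))

/-- Apply `adjoint` to `(1 + X) ^ (m + 1)`. The factor `m + 1` shows that this power, viewed as a
density, concentrates at `1` as `m` grows. -/
theorem peak (hL : IsGegenbauerFunctional lam L) (m : ℕ) :
    ((m : ℝ) + 1) * L ((1 - X) * (1 + X) ^ (m + 1)) =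
      (2 * lam + 1) * L (X * (1 + X) ^ (m + 1)) := by
  have h := hL.adjoint ((1 + X) ^ (m + 1))
  have e : (1 - X ^ 2) * derivative ((1 + X) ^ (m + 1)) - (2 * C lam + 1) * X * (1 + X) ^ (m + 1) =
      ((m : ℝ) + 1) • ((1 - X) * (1 + X) ^ (m + 1)) -
        (2 * lam + 1) • (X * (1 + X) ^ (m + 1) : ℝ[X]) := by
    rw [smul_eq_C_mul, smul_eq_C_mul, derivative_pow]
    simp [C_ofNat]
    ring
  rw [e, map_sub, map_smul, map_smul, smul_eq_mul, smul_eq_mul] at h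
  linarith

theorem eq_sum (hL : IsGegenbauerFunctional lam L) (hl : 0 ≤ lam) {n : ℕ} {p : ℝ[X]}
    (hp : p.natDegree ≤ n) : p = ∑ m ∈ Finset.range (n + 1),
      (L (p * zonalPoly lam m) / L (zonalPoly lam m * zonalPoly lam m)) • zonalPoly lam m := by
  refine Submodule.span_induction (p := fun p _ => p = ∑ m ∈ Finset.range (n + 1),
      (L (p * zonalPoly lam m) / L (zonalPoly lam m * zonalPoly lam m)) • zonalPoly lam m)
      ?_ ?_ ?_ ?_ (mem_span_zonalPoly hl n hp)
  · rintro _ ⟨k, hk, rfl⟩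
    rw [Finset.sum_eq_single_of_mem k (by simpa using hk), div_self (hL.normSq_pos hl k).ne',
      one_smul]
    intro m _ hmk
    rw [hL.orthogonal hl hmk.symm, zero_div, zero_smul]
  · simp
  · intro x y _ _ hx hy
    simp only [add_mul, map_add, add_div, add_smul, Finset.sum_add_distrib]
    rw [← hx, ← hy]
  · intro a x _ hx
    simp only [smul_mul_assoc, map_smul, smul_eq_mul, mul_div_assoc, mul_smul]
    rw [← Finset.smul_sum, ← hx]

/-- Both functionals are `1` at `Q 0` and vanish on all other `Q n`, and the `Q n` span the
polynomials. -/
theorem unique (hL : IsGegenbauerFunctional lam L) (hL' : IsGegenbauerFunctional lam L')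
    (hl : 0 ≤ lam) : L = L' := by
  refine LinearMap.ext fun p => ?_
  have h := mem_span_zonalPoly hl p.natDegree le_rfl
  refine Submodule.span_induction (p := fun q _ => L q = L' q) ?_ ?_ ?_ ?_ h
  · rintro _ ⟨m, -, rfl⟩
    rcases eq_or_ne m 0 with rfl | hm
    · rw [zonalPoly_zero, hL.one, hL'.one]
    · rw [hL.zonalPoly_eq_zero hl hm, hL'.zonalPoly_eq_zero hl hm]
  · simp
  · intro x y _ _ hx hy
    rw [map_add, map_add, hx, hy]
  · intro a x _ hx
    rw [map_smul, map_smul, hx]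

end IsGegenbauerFunctional

/-- The product is the value at `1`; it is positive for `lam > 0`, which makes the normalization
legitimate. -/
theorem gegenbauerRec_eq (hl : 0 < lam) (n : ℕ) : gegenbauerRec lam n =
    C (∏ i ∈ Finset.range n, ((i : ℝ) + 2 * lam) / (i + 1)) * zonalPoly lam n := by
  induction n using Nat.twoStepInduction with
  | zero => simp [gegenbauerRec, zonalPoly_zero]
  | one => simp [gegenbauerRec, zonalPoly_one]
  | more n h1 h2 =>
    rw [gegenbauerRec, h1, h2, zonalPoly]
    simp only [Finset.prod_range_succ, Nat.cast_add, Nat.cast_one]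
    generalize ∏ i ∈ Finset.range n, ((i : ℝ) + 2 * lam) / (i + 1) = c
    have ha : (n : ℝ) + 1 + 2 * lam ≠ 0 := by positivity
    have hb : (n : ℝ) + 1 ≠ 0 := by positivity
    have hb2 : (n : ℝ) + 2 ≠ 0 := by positivity
    apply Polynomial.funext
    intro t
    simp only [eval_mul, eval_sub, eval_C, eval_X]
    generalize eval t (zonalPoly lam n) = u
    generalize eval t (zonalPoly lam (n + 1)) = v
    have hb3 : (n : ℝ) + 1 + 1 ≠ 0 := by positivity
    field_simp
    ring

theorem zonalPoly_zero_eq_T (n : ℕ) : zonalPoly 0 n = Chebyshev.T ℝ (n : ℤ) := by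
  induction n using Nat.twoStepInduction with
  | zero => simp [zonalPoly_zero]
  | one => simp [zonalPoly_one]
  | more n h1 h2 =>
    have hn : ((n : ℝ[X]) + 1) ≠ 0 := by exact_mod_cast Nat.succ_ne_zero n
    refine mul_left_cancel₀ hn ?_
    have hr := zonalPoly_rec (le_refl (0 : ℝ)) n
    rw [h1, h2] at hr
    push_cast at hr ⊢
    rw [Chebyshev.T_add_two]
    simp only [C_0] at hr
    linear_combination hr

theorem normalizedGegenbauer_eq (hl : 0 ≤ lam) (n : ℕ) (t : ℝ) :
    normalizedGegenbauer lam n t = (zonalPoly lam n).eval t := by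
  unfold normalizedGegenbauer gegenbauer
  split_ifs with h
  · subst h
    rw [← zonalPoly_zero_eq_T, eval_one_zonalPoly le_rfl, div_one]
  · have hl' : 0 < lam := lt_of_le_of_ne hl (Ne.symm h)
    rw [gegenbauerRec_eq hl', eval_mul, eval_mul, eval_one_zonalPoly hl, eval_C, eval_C, mul_one,
      mul_div_cancel_left₀]
    exact (Finset.prod_pos fun i _ => by positivity).ne'

end Gegenbauer

/-! ### Fourier analysis for a Gegenbauer measure -/

section GegenbauerMeasure

open Polynomial MeasureTheory Set Filter Topology

theorem integrable_of_continuousOn_of_ae_mem {X F : Type*} [TopologicalSpace X] [T2Space X]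
    [MeasurableSpace X] [OpensMeasurableSpace X] [NormedAddCommGroup F] {μ : Measure X}
    [IsFiniteMeasure μ] {s : Set X} (hs : IsCompact s) (hμ : ∀ᵐ x ∂μ, x ∈ s) {f : X → F}
    (hf : ContinuousOn f s) : Integrable f μ := by
  have := hf.integrableOn_compact (μ := μ) hs
  rwa [IntegrableOn, Measure.restrict_eq_self_of_ae_mem hμ] at this

/-- Probability measures on `[-1, 1]` with the moments of the Gegenbauer weight of index `lam`. -/
structure IsGegenbauerMeasure (lam : ℝ) (ν : Measure ℝ) : Prop where
  prob : IsProbabilityMeasure ν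
  ae_mem : ∀ᵐ t ∂ν, t ∈ Icc (-1 : ℝ) 1
  adjoint : ∀ p : ℝ[X],
    ∫ t, ((1 - X ^ 2) * derivative p - (2 * C lam + 1) * X * p).eval t ∂ν = 0

namespace IsGegenbauerMeasure

variable {lam : ℝ} {ν ν' : Measure ℝ}

theorem integrable {F : Type*} [NormedAddCommGroup F] (hν : IsGegenbauerMeasure lam ν) {f : ℝ → F}
    (hf : ContinuousOn f (Icc (-1) 1)) : Integrable f ν :=
  have := hν.prob
  integrable_of_continuousOn_of_ae_mem isCompact_Icc hν.ae_mem hf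

/-- Integration of polynomials. -/
noncomputable def functional (hν : IsGegenbauerMeasure lam ν) : ℝ[X] →ₗ[ℝ] ℝ where
  toFun p := ∫ t, p.eval t ∂ν
  map_add' p q := by
    simp only [eval_add]
    exact integral_add (hν.integrable p.continuousOn) (hν.integrable q.continuousOn)
  map_smul' a p := by
    simp only [eval_smul, RingHom.id_apply]
    exact integral_smul a _

theorem functional_apply (hν : IsGegenbauerMeasure lam ν) (p : ℝ[X]) :
    hν.functional p = ∫ t, p.eval t ∂ν := rfl

theorem isGegenbauerFunctional (hν : IsGegenbauerMeasure lam ν) :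
    IsGegenbauerFunctional lam hν.functional where
  one := by
    have := hν.prob
    simp [functional_apply]
  adjoint := hν.adjoint

/-- The moments agree, and by Weierstrass they determine a measure on `[-1, 1]`. -/
theorem unique (hν : IsGegenbauerMeasure lam ν) (hν' : IsGegenbauerMeasure lam ν')
    (hl : 0 ≤ lam) : ν = ν' := by
  have := hν.prob
  have := hν'.prob
  have hL := hν.isGegenbauerFunctional.unique hν'.isGegenbauerFunctional hl
  refine ext_of_forall_integral_eq_of_IsFiniteMeasure fun f => ?_
  have key : ∀ {μ : Measure ℝ} (hμ : IsGegenbauerMeasure lam μ) (p : ℝ[X]) (ε : ℝ),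
      (∀ x ∈ Icc (-1 : ℝ) 1, |p.eval x - f x| < ε) → |hμ.functional p - ∫ x, f x ∂μ| ≤ ε := by
    intro μ hμ p ε h
    have := hμ.prob
    rw [functional_apply, ← integral_sub (hμ.integrable p.continuousOn)
      (hμ.integrable f.continuous.continuousOn)]
    have := norm_integral_le_of_norm_le_const (μ := μ) (C := ε)
      (f := fun x => p.eval x - f x) (hμ.ae_mem.mono fun x hx => (h x hx).le)
    simpa using this
  refine eq_of_forall_dist_le fun ε hε => ?_
  obtain ⟨p, hp⟩ := exists_polynomial_near_of_continuousOn (-1) 1 f f.continuous.continuousOn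
    (ε / 2) (half_pos hε)
  have h1 := key hν p _ hp
  have h2 := key hν' p _ hp
  rw [← hL] at h2
  rw [Real.dist_eq, abs_le]
  rw [abs_le] at h1 h2
  constructor <;> linarith

theorem functional_mono (hν : IsGegenbauerMeasure lam ν) {p q : ℝ[X]}
    (h : ∀ t ∈ Icc (-1 : ℝ) 1, p.eval t ≤ q.eval t) : hν.functional p ≤ hν.functional q :=
  integral_mono_ae (hν.integrable p.continuousOn) (hν.integrable q.continuousOn)
    (hν.ae_mem.mono h)

/-- The increment from `m` to `m + 1` is the pairing of `(1 + X) ^ m` with `X = Q 1`, which is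
nonnegative. -/
theorem one_le_functional (hν : IsGegenbauerMeasure lam ν) (hl : 0 ≤ lam) (m : ℕ) :
    1 ≤ hν.functional ((1 + X) ^ m) := by
  have hL := hν.isGegenbauerFunctional
  induction m with
  | zero => rw [pow_zero, hL.one]
  | succ m ih =>
    rw [pow_succ, mul_add, map_add, mul_one]
    have := hL.one_add_X_pow_mul_nonneg hl m 1
    rw [zonalPoly_one] at this
    linarith

/-- Write `p - 1 = (X - 1) g` with `g` bounded on `[-1, 1]`; by `peak` the error is at most `sup |g|
(2 lam + 1) / (m + 1)`. -/
theorem tendsto_peak (hν : IsGegenbauerMeasure lam ν) (hl : 0 ≤ lam) {p : ℝ[X]}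
    (hp : p.eval 1 = 1) : Tendsto (fun m : ℕ => hν.functional ((1 + X) ^ (m + 1) * p) /
      hν.functional ((1 + X) ^ (m + 1))) atTop (𝓝 1) := by
  have hL := hν.isGegenbauerFunctional
  obtain ⟨g, hg⟩ : X - C (1 : ℝ) ∣ p - 1 := dvd_iff_isRoot.2 (by simp [hp])
  obtain ⟨G, hG⟩ := isCompact_Icc.exists_bound_of_continuousOn (s := Icc (-1 : ℝ) 1)
    (f := fun t => g.eval t) g.continuousOn
  have hG0 : 0 ≤ G := (norm_nonneg _).trans (hG 0 (by simp))
  rw [tendsto_iff_norm_sub_tendsto_zero]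
  have hlim : Tendsto (fun m : ℕ => G * (2 * lam + 1) * (1 / ((m : ℝ) + 1))) atTop (𝓝 0) := by
    simpa using tendsto_one_div_add_atTop_nhds_zero_nat.const_mul (G * (2 * lam + 1))
  refine squeeze_zero (fun _ => norm_nonneg _) (fun m => ?_) hlim
  have hpos : 0 < hν.functional ((1 + X) ^ (m + 1)) :=
    zero_lt_one.trans_le (hν.one_le_functional hl _)
  have hm : (0 : ℝ) < (m : ℝ) + 1 := by positivity
  have hpk : hν.functional ((1 - X) * (1 + X) ^ (m + 1)) ≤
      (2 * lam + 1) * (1 / ((m : ℝ) + 1)) * hν.functional ((1 + X) ^ (m + 1)) := by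
    have h1 := hL.peak m
    have h2 : hν.functional (X * (1 + X) ^ (m + 1)) ≤ hν.functional ((1 + X) ^ (m + 1)) := by
      refine hν.functional_mono fun t ht => ?_
      simp only [eval_mul, eval_X, eval_pow, eval_add, eval_one]
      exact mul_le_of_le_one_left (pow_nonneg (by linarith [ht.1]) _) ht.2
    have h3 := mul_le_mul_of_nonneg_left h2 (by positivity : 0 ≤ 2 * lam + 1)
    rw [← h1] at h3
    rw [mul_one_div, div_mul_eq_mul_div, le_div_iff₀ hm]
    linarith
  have e : hν.functional ((1 + X) ^ (m + 1) * p) / hν.functional ((1 + X) ^ (m + 1)) - 1 =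
      hν.functional ((X - C 1) * g * (1 + X) ^ (m + 1)) / hν.functional ((1 + X) ^ (m + 1)) := by
    rw [← hg, sub_mul, map_sub, one_mul, sub_div, div_self hpos.ne', mul_comm p]
  rw [e, norm_div, Real.norm_eq_abs, Real.norm_of_nonneg hpos.le, div_le_iff₀ hpos]
  have hb : |hν.functional ((X - C 1) * g * (1 + X) ^ (m + 1))| ≤
      G * hν.functional ((1 - X) * (1 + X) ^ (m + 1)) := by
    have hpt : ∀ t ∈ Icc (-1 : ℝ) 1, |((X - C 1) * g * (1 + X) ^ (m + 1)).eval t| ≤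
        (G • ((1 - X) * (1 + X) ^ (m + 1)) : ℝ[X]).eval t := by
      intro t ht
      simp only [eval_mul, eval_sub, eval_X, eval_C, eval_pow, eval_add, eval_one, eval_smul,
        smul_eq_mul, abs_mul]
      have h1 : |t - 1| = 1 - t := by rw [abs_sub_comm, abs_of_nonneg (by linarith [ht.2])]
      have h2 : |(1 + t) ^ (m + 1)| = (1 + t) ^ (m + 1) :=
        abs_of_nonneg (pow_nonneg (by linarith [ht.1]) _)
      rw [h1, h2]
      have h3 : 0 ≤ (1 - t) * (1 + t) ^ (m + 1) :=
        mul_nonneg (by linarith [ht.2]) (pow_nonneg (by linarith [ht.1]) _)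
      have := mul_le_mul_of_nonneg_right (hG t ht) h3
      rw [Real.norm_eq_abs] at this
      linarith
    rw [← smul_eq_mul (a := G), ← map_smul, abs_le, ← map_neg]
    constructor
    · exact hν.functional_mono fun t ht => by rw [eval_neg]; exact (abs_le.1 (hpt t ht)).1
    · exact hν.functional_mono fun t ht => (abs_le.1 (hpt t ht)).2
  refine hb.trans ((mul_le_mul_of_nonneg_left hpk hG0).trans_eq ?_)
  ring

/-- The square norm of the normalized Gegenbauer polynomials. -/
noncomputable def normSq (hν : IsGegenbauerMeasure lam ν) (n : ℕ) : ℝ :=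
  hν.functional (zonalPoly lam n * zonalPoly lam n)

theorem normSq_pos (hν : IsGegenbauerMeasure lam ν) (hl : 0 ≤ lam) (n : ℕ) : 0 < hν.normSq n :=
  hν.isGegenbauerFunctional.normSq_pos hl n

theorem integral_mul_poly (hν : IsGegenbauerMeasure lam ν) (hl : 0 ≤ lam) {f : ℝ → ℝ}
    (hf : ContinuousOn f (Icc (-1) 1)) {n : ℕ} {p : ℝ[X]} (hp : p.natDegree ≤ n) :
    ∫ t, f t * p.eval t ∂ν = ∑ m ∈ Finset.range (n + 1),
      (∫ t, f t * (zonalPoly lam m).eval t ∂ν) / hν.normSq m *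
        hν.functional (p * zonalPoly lam m) := by
  conv_lhs => rw [hν.isGegenbauerFunctional.eq_sum hl hp]
  simp only [eval_finsetSum, eval_smul, smul_eq_mul, Finset.mul_sum]
  rw [integral_finsetSum _ fun m _ => hν.integrable (f := fun t => f t * (_ * _))
    (hf.mul (continuousOn_const.mul (zonalPoly lam m).continuousOn))]
  refine Finset.sum_congr rfl fun m _ => ?_
  simp only [mul_left_comm (f _)]
  rw [integral_const_mul]
  unfold normSq
  ring

/-- A Fejér-type argument. Pair `f` with the normalized peak `(1 + X) ^ (m + 1)`: all terms of the
resulting finite sum are nonnegative and the whole is at most `sup |f|`, while each `Q n` is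
weighted by a factor tending to `Q n (1) = 1`. So every partial sum is at most `sup |f|`. -/
theorem summable_coeff (hν : IsGegenbauerMeasure lam ν) (hl : 0 ≤ lam) {f : ℝ → ℝ}
    (hf : ContinuousOn f (Icc (-1) 1))
    (h0 : ∀ n, 0 ≤ ∫ t, f t * (zonalPoly lam n).eval t ∂ν) :
    Summable fun n => (∫ t, f t * (zonalPoly lam n).eval t ∂ν) / hν.normSq n := by
  obtain ⟨B, hB⟩ := isCompact_Icc.exists_bound_of_continuousOn hf
  have hL := hν.isGegenbauerFunctional
  set a : ℕ → ℝ := fun n => (∫ t, f t * (zonalPoly lam n).eval t ∂ν) / hν.normSq n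
  have ha : ∀ n, 0 ≤ a n := fun n => div_nonneg (h0 n) (hν.normSq_pos hl n).le
  refine summable_of_sum_range_le (c := B) ha fun N => ?_
  have hlim : Tendsto (fun m : ℕ => ∑ n ∈ Finset.range N,
      a n * (hν.functional ((1 + X) ^ (m + 1) * zonalPoly lam n) /
        hν.functional ((1 + X) ^ (m + 1)))) atTop (𝓝 (∑ n ∈ Finset.range N, a n * 1)) :=
    tendsto_finsetSum _ fun n _ =>
      (hν.tendsto_peak hl (eval_one_zonalPoly hl n)).const_mul _
  simp only [mul_one] at hlim
  refine le_of_tendsto hlim ((eventually_ge_atTop N).mono fun m hm => ?_)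
  have hpos : 0 < hν.functional ((1 + X) ^ (m + 1)) :=
    zero_lt_one.trans_le (hν.one_le_functional hl _)
  simp only [← mul_div_assoc]
  rw [← Finset.sum_div, div_le_iff₀ hpos]
  have hdeg : ((1 + X : ℝ[X]) ^ (m + 1)).natDegree ≤ m + 1 := by
    have h1 : (1 + X : ℝ[X]).natDegree ≤ 1 := (natDegree_add_le _ _).trans (by simp)
    exact natDegree_pow_le.trans (mul_le_of_le_one_right (Nat.zero_le _) h1)
  calc _ ≤ ∑ n ∈ Finset.range (m + 1 + 1),
        a n * hν.functional ((1 + X) ^ (m + 1) * zonalPoly lam n) := by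
        refine Finset.sum_le_sum_of_subset_of_nonneg (Finset.range_mono (by omega))
          fun n _ _ => mul_nonneg (ha n) (hL.one_add_X_pow_mul_nonneg hl _ _)
    _ = ∫ t, f t * ((1 + X : ℝ[X]) ^ (m + 1)).eval t ∂ν := (hν.integral_mul_poly hl hf hdeg).symm
    _ ≤ ∫ t, B * ((1 + X : ℝ[X]) ^ (m + 1)).eval t ∂ν := by
        refine integral_mono_ae (hν.integrable (hf.mul (Polynomial.continuousOn _)))
          (hν.integrable (continuousOn_const.mul (Polynomial.continuousOn _))) ?_
        filter_upwards [hν.ae_mem] with t ht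
        refine mul_le_mul_of_nonneg_right ((le_abs_self _).trans (hB t ht)) ?_
        simp only [eval_pow, eval_add, eval_one, eval_X]
        exact pow_nonneg (by linarith [ht.1]) _
    _ = B * hν.functional ((1 + X) ^ (m + 1)) := by rw [integral_const_mul, functional_apply]

/-- `f` is orthogonal to all polynomials, so by Weierstrass `∫ f ^ 2` is arbitrarily small. -/
theorem ae_eq_zero (hν : IsGegenbauerMeasure lam ν) (hl : 0 ≤ lam) {f : ℝ → ℝ}
    (hf : ContinuousOn f (Icc (-1) 1))
    (h0 : ∀ n, ∫ t, f t * (zonalPoly lam n).eval t ∂ν = 0) : f =ᵐ[ν] 0 := by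
  have := hν.prob
  obtain ⟨B, hB⟩ := isCompact_Icc.exists_bound_of_continuousOn hf
  have hB0 : 0 ≤ B := (norm_nonneg _).trans (hB 0 (by simp))
  have hp : ∀ p : ℝ[X], ∫ t, f t * p.eval t ∂ν = 0 := fun p => by
    rw [hν.integral_mul_poly hl hf (le_refl p.natDegree)]
    exact Finset.sum_eq_zero fun n _ => by rw [h0 n]; simp
  have hle : ∫ t, f t * f t ∂ν ≤ 0 := by
    refine le_of_forall_pos_le_add fun ε hε => ?_
    obtain ⟨p, hpp⟩ := exists_polynomial_near_of_continuousOn (-1) 1 f hf (ε / (B + 1))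
      (by positivity)
    have e : ∫ t, f t * f t ∂ν = ∫ t, f t * (f t - p.eval t) ∂ν := by
      simp only [mul_sub]
      rw [integral_sub (hν.integrable (f := fun t => f t * f t) (hf.mul hf))
        (hν.integrable (f := fun t => f t * p.eval t) (hf.mul p.continuousOn)), hp,
        sub_zero]
    rw [e, zero_add]
    have := norm_integral_le_of_norm_le_const (μ := ν) (C := ε)
      (f := fun t => f t * (f t - p.eval t)) (hν.ae_mem.mono fun x hx => ?_)
    · simp only [probReal_univ, mul_one] at this
      exact (le_abs_self _).trans this
    · rw [norm_mul]
      have h1 := (hpp x hx).le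
      rw [abs_sub_comm] at h1
      calc ‖f x‖ * ‖f x - p.eval x‖ ≤ B * (ε / (B + 1)) :=
            mul_le_mul (hB x hx) h1 (norm_nonneg _) hB0
        _ ≤ ε := by
          rw [← mul_div_assoc, div_le_iff₀ (by positivity)]
          nlinarith
  have h2 := (integral_eq_zero_iff_of_nonneg (fun t => mul_self_nonneg (f t))
    (hν.integrable (hf.mul hf))).1 (le_antisymm hle (integral_nonneg fun t => mul_self_nonneg _))
  filter_upwards [h2] with t ht
  simpa using ht

theorem integral_zonalPoly_mul_zonalPoly (hν : IsGegenbauerMeasure lam ν) (n m : ℕ) (hl : 0 ≤ lam) :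
    ∫ t, (zonalPoly lam n).eval t * (zonalPoly lam m).eval t ∂ν =
      if n = m then hν.normSq m else 0 := by
  have : ∫ t, (zonalPoly lam n).eval t * (zonalPoly lam m).eval t ∂ν =
      hν.functional (zonalPoly lam n * zonalPoly lam m) := by
    simp [functional_apply]
  rw [this]
  split_ifs with h
  · subst h; rfl
  · exact hν.isGegenbauerFunctional.orthogonal hl h

/-- Since `|Q n| ≤ 1`, summability of `‖c n‖` permits integrating term by term, and orthogonality
keeps one term. -/
theorem integral_tsum_mul (hν : IsGegenbauerMeasure lam ν) (hl : 0 ≤ lam)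
    (hQ : ∀ n, ∀ t ∈ Icc (-1 : ℝ) 1, |(zonalPoly lam n).eval t| ≤ 1) {c : ℕ → ℂ}
    (hc : Summable fun n => ‖c n‖) {f : ℝ → ℂ}
    (hf : ∀ t ∈ Icc (-1 : ℝ) 1, HasSum (fun n => c n * (((zonalPoly lam n).eval t : ℝ) : ℂ)) (f t))
    (m : ℕ) : ∫ t, f t * (((zonalPoly lam m).eval t : ℝ) : ℂ) ∂ν = c m * (hν.normSq m : ℂ) := by
  have := hν.prob
  set F : ℕ → ℝ → ℂ := fun n t =>
    c n * (((zonalPoly lam n).eval t : ℝ) : ℂ) * (((zonalPoly lam m).eval t : ℝ) : ℂ)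
  have hFc : ∀ n, Continuous (F n) := fun n => by
    have h1 := (zonalPoly lam n).continuous
    have h2 := (zonalPoly lam m).continuous
    fun_prop
  have hFi : ∀ n, Integrable (F n) ν := fun n => hν.integrable (hFc n).continuousOn
  have hFb : ∀ n, ∫ t, ‖F n t‖ ∂ν ≤ ‖c n‖ := fun n => by
    have h : ∀ᵐ t ∂ν, ‖F n t‖ ≤ ‖c n‖ := by
      filter_upwards [hν.ae_mem] with t ht
      simp only [F, norm_mul, Complex.norm_real]
      rw [mul_assoc]
      exact mul_le_of_le_one_right (norm_nonneg _)
        (mul_le_one₀ (hQ n t ht) (norm_nonneg _) (hQ m t ht))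
    have := integral_mono_ae (hFi n).norm (integrable_const (μ := ν) ‖c n‖) h
    simpa using this
  have hs := hasSum_integral_of_summable_integral_norm hFi
    (Summable.of_nonneg_of_le (fun n => integral_nonneg fun _ => norm_nonneg _) hFb hc)
  have e1 : ∫ t, ∑' n, F n t ∂ν = ∫ t, f t * (((zonalPoly lam m).eval t : ℝ) : ℂ) ∂ν := by
    refine integral_congr_ae ?_
    filter_upwards [hν.ae_mem] with t ht
    exact ((hf t ht).mul_right _).tsum_eq
  have e2 : ∀ n, ∫ t, F n t ∂ν = if n = m then c m * (hν.normSq m : ℂ) else 0 := fun n => by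
    simp only [F, mul_assoc]
    rw [integral_const_mul]
    have h := hν.integral_zonalPoly_mul_zonalPoly n m hl
    simp only [← Complex.ofReal_mul]
    rw [integral_complex_ofReal, h]
    split_ifs with h
    · rw [h]
    · simp
  rw [e1] at hs
  simp only [e2] at hs
  exact hs.unique (hasSum_ite_eq m _)

/-- The series has a continuous sum with the same coefficients as `f`, so the two agree almost
everywhere; the full-support hypothesis `hfull` upgrades this to every point, the endpoints
included. -/
theorem hasSum_zonalPoly (hν : IsGegenbauerMeasure lam ν) (hl : 0 ≤ lam)
    (hfull : ∀ g : ℝ → ℝ, ContinuousOn g (Icc (-1) 1) → g =ᵐ[ν] 0 → EqOn g 0 (Icc (-1) 1))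
    (hQ : ∀ n, ∀ t ∈ Icc (-1 : ℝ) 1, |(zonalPoly lam n).eval t| ≤ 1) {f : ℝ → ℂ}
    (hf : ContinuousOn f (Icc (-1) 1)) {c : ℕ → ℂ} (hc : Summable fun n => ‖c n‖)
    (hcf : ∀ n, ∫ t, f t * (((zonalPoly lam n).eval t : ℝ) : ℂ) ∂ν = c n * (hν.normSq n : ℂ))
    {t : ℝ} (ht : t ∈ Icc (-1 : ℝ) 1) :
    HasSum (fun n => c n * (((zonalPoly lam n).eval t : ℝ) : ℂ)) (f t) := by
  have hcont : ∀ n, Continuous fun t => (((zonalPoly lam n).eval t : ℝ) : ℂ) := fun n => by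
    have h1 := (zonalPoly lam n).continuous
    fun_prop
  have hb : ∀ n, ∀ t ∈ Icc (-1 : ℝ) 1, ‖c n * (((zonalPoly lam n).eval t : ℝ) : ℂ)‖ ≤ ‖c n‖ := by
    intro n t ht
    rw [norm_mul, Complex.norm_real]
    exact mul_le_of_le_one_right (norm_nonneg _) (hQ n t ht)
  set g : ℝ → ℂ := fun t => ∑' n, c n * (((zonalPoly lam n).eval t : ℝ) : ℂ)
  have hg : ∀ t ∈ Icc (-1 : ℝ) 1,
      HasSum (fun n => c n * (((zonalPoly lam n).eval t : ℝ) : ℂ)) (g t) :=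
    fun t ht => (Summable.of_norm_bounded hc fun n => hb n t ht).hasSum
  have hgc : ContinuousOn g (Icc (-1) 1) :=
    continuousOn_tsum (fun n => continuousOn_const.mul (hcont n).continuousOn) hc hb
  have hdiff : ∀ n, ∫ t, (f t - g t) * (((zonalPoly lam n).eval t : ℝ) : ℂ) ∂ν = 0 := fun n => by
    simp only [sub_mul]
    rw [integral_sub (hν.integrable (f := fun t => f t * _) (hf.mul (hcont n).continuousOn))
      (hν.integrable (f := fun t => g t * _) (hgc.mul (hcont n).continuousOn)), hcf,
      hν.integral_tsum_mul hl hQ hc hg,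
      sub_self]
  have hint : ∀ n, Integrable (fun t => (f t - g t) * (((zonalPoly lam n).eval t : ℝ) : ℂ)) ν :=
    fun n => hν.integrable ((hf.sub hgc).mul (hcont n).continuousOn)
  have hre : EqOn (fun t => (f t - g t).re) 0 (Icc (-1) 1) := by
    have hc' : ContinuousOn (fun t => (f t - g t).re) (Icc (-1) 1) :=
      Complex.continuous_re.comp_continuousOn (hf.sub hgc)
    refine hfull _ hc' (hν.ae_eq_zero hl hc' fun n => ?_)
    have h := Complex.reCLM.integral_comp_comm (hint n)
    rw [hdiff n] at h
    simpa using h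
  have him : EqOn (fun t => (f t - g t).im) 0 (Icc (-1) 1) := by
    have hc' : ContinuousOn (fun t => (f t - g t).im) (Icc (-1) 1) :=
      Complex.continuous_im.comp_continuousOn (hf.sub hgc)
    refine hfull _ hc' (hν.ae_eq_zero hl hc' fun n => ?_)
    have h := Complex.imCLM.integral_comp_comm (hint n)
    rw [hdiff n] at h
    simpa using h
  have : f t = g t := sub_eq_zero.1 (Complex.ext (hre ht) (him ht))
  rw [this]
  exact hg t ht

end IsGegenbauerMeasure

end GegenbauerMeasure

/-! ### The Gegenbauer weight as a probability measure -/

section GegenbauerWeight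

open Polynomial MeasureTheory Set Filter Topology

variable {lam : ℝ}

theorem measurable_gegenbauerWeight : Measurable (gegenbauerWeight lam) := by
  unfold gegenbauerWeight; fun_prop

theorem one_sub_sq_pos {ρ : ℝ} (hρ : ρ ∈ Ioo (-1 : ℝ) 1) : 0 < 1 - ρ ^ 2 := by
  nlinarith [hρ.1, hρ.2]

theorem gegenbauerWeight_pos {ρ : ℝ} (hρ : ρ ∈ Ioo (-1 : ℝ) 1) : 0 < gegenbauerWeight lam ρ :=
  Real.rpow_pos_of_pos (one_sub_sq_pos hρ) _

theorem ae_restrict_mem_Ioo :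
    ∀ᵐ ρ ∂(volume.restrict (Ioc (-1 : ℝ) 1)), ρ ∈ Ioo (-1 : ℝ) 1 := by
  rw [← Measure.restrict_congr_set (Ioo_ae_eq_Ioc (a := (-1 : ℝ)) (b := 1))]
  exact ae_restrict_mem measurableSet_Ioo

/-- As `1 - ρ ^ 2 ≤ 1`, the weight is dominated by its case `lam = 0`, the Chebyshev weight. -/
theorem intervalIntegrable_gegenbauerWeight (hl : 0 ≤ lam) :
    IntervalIntegrable (gegenbauerWeight lam) volume (-1) 1 := by
  have h := Chebyshev.intervalIntegrable_sqrt_one_sub_sq_inv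
  rw [intervalIntegrable_iff_integrableOn_Ioc_of_le (by norm_num)] at h ⊢
  refine Integrable.mono h measurable_gegenbauerWeight.aestronglyMeasurable ?_
  filter_upwards [ae_restrict_mem_Ioo] with ρ hρ
  have hpos := one_sub_sq_pos hρ
  rw [Real.norm_of_nonneg (gegenbauerWeight_pos hρ).le, Real.norm_of_nonneg (by positivity),
    gegenbauerWeight, Real.sqrt_inv, Real.sqrt_eq_rpow, ← Real.rpow_neg hpos.le]
  exact Real.rpow_le_rpow_of_exponent_ge hpos (by nlinarith [sq_nonneg ρ]) (by linarith)

/-- The total mass of the Gegenbauer weight. -/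
noncomputable def gegenbauerMass (lam : ℝ) : ℝ := ∫ ρ in (-1 : ℝ)..1, gegenbauerWeight lam ρ

theorem gegenbauerMass_pos (hl : 0 ≤ lam) : 0 < gegenbauerMass lam :=
  intervalIntegral.intervalIntegral_pos_of_pos_on (intervalIntegrable_gegenbauerWeight hl)
    (fun _ hρ => gegenbauerWeight_pos hρ) (by norm_num)

/-- The probability measure with density proportional to the Gegenbauer weight. -/
noncomputable def weightMeasure (lam : ℝ) : Measure ℝ :=
  (volume.restrict (Ioc (-1) 1)).withDensity fun ρ =>
    ((gegenbauerWeight lam ρ / gegenbauerMass lam).toNNReal : ENNReal)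

theorem integral_weightMeasure {F : Type*} [NormedAddCommGroup F] [NormedSpace ℝ F] (hl : 0 ≤ lam)
    (f : ℝ → F) : ∫ ρ, f ρ ∂(weightMeasure lam) =
      (gegenbauerMass lam)⁻¹ • ∫ ρ in (-1 : ℝ)..1, gegenbauerWeight lam ρ • f ρ := by
  rw [weightMeasure, integral_withDensity_eq_integral_smul
    (measurable_gegenbauerWeight.div_const _).real_toNNReal,
    intervalIntegral.integral_of_le (by norm_num), ← integral_smul]
  refine integral_congr_ae ?_
  filter_upwards [ae_restrict_mem_Ioo] with ρ hρ
  rw [NNReal.smul_def, Real.coe_toNNReal _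
    (div_nonneg (gegenbauerWeight_pos hρ).le (gegenbauerMass_pos hl).le), smul_smul, div_eq_inv_mul]

theorem ae_weightMeasure (hl : 0 ≤ lam) {p : ℝ → Prop} :
    (∀ᵐ ρ ∂(weightMeasure lam), p ρ) ↔ ∀ᵐ ρ ∂(volume.restrict (Ioc (-1) 1)), p ρ := by
  rw [weightMeasure, ae_withDensity_iff
    (measurable_gegenbauerWeight.div_const _).real_toNNReal.coe_nnreal_ennreal]
  constructor <;> intro h
  · filter_upwards [h, ae_restrict_mem_Ioo] with ρ h1 h2
    refine h1 ?_
    have : 0 < gegenbauerWeight lam ρ / gegenbauerMass lam :=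
      div_pos (gegenbauerWeight_pos h2) (gegenbauerMass_pos hl)
    simpa using this
  · filter_upwards [h] with ρ h1 _ using h1

theorem isGegenbauerMeasure_weightMeasure (hl : 0 ≤ lam) :
    IsGegenbauerMeasure lam (weightMeasure lam) where
  prob := by
    refine ⟨?_⟩
    have hi := intervalIntegrable_gegenbauerWeight hl
    rw [intervalIntegrable_iff_integrableOn_Ioc_of_le (by norm_num)] at hi
    rw [weightMeasure, withDensity_apply _ MeasurableSet.univ, Measure.restrict_univ]
    change ∫⁻ ρ in Ioc (-1) 1, ENNReal.ofReal (gegenbauerWeight lam ρ / gegenbauerMass lam) = 1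
    rw [← ofReal_integral_eq_lintegral_ofReal (hi.div_const _), integral_div,
      ← intervalIntegral.integral_of_le (by norm_num)]
    · rw [← gegenbauerMass, div_self (gegenbauerMass_pos hl).ne', ENNReal.ofReal_one]
    · filter_upwards [ae_restrict_mem_Ioo] with ρ hρ
      exact div_nonneg (gegenbauerWeight_pos hρ).le (gegenbauerMass_pos hl).le
  ae_mem := (ae_weightMeasure hl).2
    (ae_restrict_mem_Ioo.mono fun _ h => Ioo_subset_Icc_self h)
  adjoint p := by
    rw [integral_weightMeasure hl]
    -- The integrand is the derivative of `F`, which vanishes at `±1` because `lam + 1 / 2 > 0`.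
    set F : ℝ → ℝ := fun ρ => p.eval ρ * (1 - ρ ^ 2) ^ (lam + 1 / 2)
    have hF : ∀ ρ ∈ Ioo (-1 : ℝ) 1, HasDerivAt F (gegenbauerWeight lam ρ •
        ((1 - X ^ 2) * derivative p - (2 * C lam + 1) * X * p).eval ρ) ρ := by
      intro ρ hρ
      have hpos := one_sub_sq_pos hρ
      have h1 : HasDerivAt (fun ρ : ℝ => 1 - ρ ^ 2) (-(2 * ρ)) ρ := by
        simpa using (hasDerivAt_pow 2 ρ).const_sub 1
      have h2 := (p.hasDerivAt ρ).mul (h1.rpow_const (p := lam + 1 / 2) (Or.inl hpos.ne'))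
      refine h2.congr_deriv ?_
      have e1 : (1 - ρ ^ 2) ^ (lam + 1 / 2) = (1 - ρ ^ 2) * (1 - ρ ^ 2) ^ (lam - 1 / 2) := by
        rw [← Real.rpow_one_add' hpos.le (by linarith)]
        congr 1; ring
      have e2 : lam + 1 / 2 - 1 = lam - 1 / 2 := by ring
      rw [e1, e2, gegenbauerWeight]
      simp only [eval_sub, eval_mul, eval_one, eval_pow, eval_X, eval_add, eval_C, eval_ofNat,
        smul_eq_mul]
      ring
    have hi : IntervalIntegrable (fun ρ => gegenbauerWeight lam ρ •
        ((1 - X ^ 2) * derivative p - (2 * C lam + 1) * X * p).eval ρ) volume (-1) 1 :=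
      (intervalIntegrable_gegenbauerWeight hl).mul_continuousOn (Polynomial.continuousOn _)
    have hFc : Continuous F :=
      p.continuous.mul ((by fun_prop : Continuous fun ρ : ℝ => 1 - ρ ^ 2).rpow_const
        fun _ => Or.inr (by linarith))
    rw [intervalIntegral.integral_eq_sub_of_hasDerivAt_of_le (by norm_num) hFc.continuousOn hF hi]
    have : lam + 1 / 2 ≠ 0 := by linarith
    simp only [F]
    norm_num [Real.zero_rpow this]

theorem eqOn_zero_of_ae_weightMeasure (hl : 0 ≤ lam) {g : ℝ → ℝ}
    (hg : ContinuousOn g (Icc (-1) 1)) (h : g =ᵐ[weightMeasure lam] 0) :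
    EqOn g 0 (Icc (-1) 1) := by
  have h' := (ae_weightMeasure hl).1 h
  rw [Measure.restrict_congr_set Ioc_ae_eq_Icc] at h'
  exact Measure.eqOn_Icc_of_ae_eq volume (by norm_num) h' hg continuousOn_const

end GegenbauerWeight

/-! ### The invariant measure on the sphere and its one-dimensional marginal -/

section SphereMeasure

open Polynomial MeasureTheory Set Filter Topology

variable {E : Type*} [NormedAddCommGroup E] [InnerProductSpace ℝ E] [MeasurableSpace E]
  [BorelSpace E]

/-- Rotation invariant probability measures on the unit sphere. -/
structure IsSphereMeasure (σ : Measure E) : Prop where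
  prob : IsProbabilityMeasure σ
  ae_norm : ∀ᵐ x ∂σ, ‖x‖ = 1
  map_eq : ∀ U : E ≃ₗᵢ[ℝ] E, σ.map U = σ

variable (E) in
-- Take the direction of a uniform point of the unit ball: the ball and the volume are invariant,
-- and normalization commutes with isometries.
theorem exists_isSphereMeasure [FiniteDimensional ℝ E] [Nontrivial E] :
    ∃ σ : Measure E, IsSphereMeasure σ := by
  set N : E → E := fun x => ‖x‖⁻¹ • x
  have hN : Measurable N := by fun_prop
  set μ : Measure E := ProbabilityTheory.cond volume (Metric.ball (0 : E) 1)
  have hμ : IsProbabilityMeasure μ := by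
    refine ProbabilityTheory.cond_isProbabilityMeasure_of_finite ?_ ?_
    · exact (Metric.measure_ball_pos volume 0 one_pos).ne'
    · exact measure_ball_lt_top.ne
  refine ⟨μ.map N, Measure.isProbabilityMeasure_map hN.aemeasurable, ?_, fun U => ?_⟩
  · rw [ae_map_iff hN.aemeasurable (measurableSet_eq_fun (by fun_prop) (by fun_prop))]
    have hac : μ ≪ volume := ProbabilityTheory.cond_absolutelyContinuous
    refine hac.ae_le ?_
    filter_upwards [compl_mem_ae_iff.2 (measure_singleton (μ := (volume : Measure E)) 0)] with x hx
    exact norm_inv_norm_smul hx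
  · have hU : Measurable U := U.continuous.measurable
    rw [Measure.map_map hU hN]
    have hc : (U ∘ N) = N ∘ U := by
      funext x; simp [N]
    rw [hc, ← Measure.map_map hN hU]
    congr 1
    have hpre : U ⁻¹' Metric.ball (0 : E) 1 = Metric.ball 0 1 := by
      ext x; simp
    simp only [μ, ProbabilityTheory.cond]
    rw [Measure.map_smul]
    congr 1
    conv_lhs => rw [← hpre]
    rw [← Measure.restrict_map hU measurableSet_ball, U.measurePreserving.map_eq]

namespace IsSphereMeasure

variable {σ : Measure E} {F : Type*} [NormedAddCommGroup F]

section Pair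

variable [NormedSpace ℝ F]

theorem integral_comp (hσ : IsSphereMeasure σ) (U : E ≃ₗᵢ[ℝ] E) (f : E → F) :
    ∫ x, f (U x) ∂σ = ∫ x, f x ∂σ := by
  have h : MeasurePreserving U σ σ := ⟨U.continuous.measurable, hσ.map_eq U⟩
  exact h.integral_comp U.toHomeomorph.measurableEmbedding f

theorem integral_pair (hσ : IsSphereMeasure σ) {u v u' v' : E} (hu : ‖u‖ = ‖u'‖) (hv : ‖v‖ = ‖v'‖)
    (huv : inner ℝ u v = inner ℝ u' v') (f : ℝ → ℝ → F) :
    ∫ x, f (inner ℝ u x) (inner ℝ v x) ∂σ = ∫ x, f (inner ℝ u' x) (inner ℝ v' x) ∂σ := by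
  obtain ⟨U, rfl, rfl⟩ := exists_linearIsometryEquiv_pair hu hv huv
  have h := hσ.integral_comp U fun x => f (inner ℝ (U u) x) (inner ℝ (U v) x)
  simpa only [U.inner_map_map] using h

end Pair

variable [FiniteDimensional ℝ E]

theorem integrable (hσ : IsSphereMeasure σ) {f : E → F} (hf : Continuous f) : Integrable f σ := by
  have := hσ.prob
  refine integrable_of_continuousOn_of_ae_mem (isCompact_sphere (0 : E) 1) ?_ hf.continuousOn
  filter_upwards [hσ.ae_norm] with x hx
  simpa using hx

/-- Rotating the pair `(u, v)` in its plane leaves `∫ p(⟨u, x⟩) ⟨v, x⟩` unchanged; the identity is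
the vanishing of its derivative at angle `0`. -/
theorem integral_rotation (hσ : IsSphereMeasure σ) {u v : E} (hu : ‖u‖ = 1) (hv : ‖v‖ = 1)
    (huv : inner ℝ u v = 0) (p : ℝ[X]) :
    ∫ x, (derivative p).eval (inner ℝ u x) * inner ℝ v x ^ 2 ∂σ =
      ∫ x, p.eval (inner ℝ u x) * inner ℝ u x ∂σ := by
  have := hσ.prob
  set A : ℝ → E := fun θ => Real.cos θ • u + Real.sin θ • v
  set B : ℝ → E := fun θ => (-Real.sin θ) • u + Real.cos θ • v
  have hA : ∀ θ, ‖A θ‖ = 1 := fun θ => by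
    have := norm_smul_add_smul_orthonormal hu hv huv (Real.cos θ) (Real.sin θ)
    rw [Real.cos_sq_add_sin_sq] at this
    exact (sq_eq_sq₀ (norm_nonneg _) zero_le_one).1 (by rw [one_pow]; exact this)
  have hB : ∀ θ, ‖B θ‖ = 1 := fun θ => by
    have := norm_smul_add_smul_orthonormal hu hv huv (-Real.sin θ) (Real.cos θ)
    rw [neg_sq, Real.sin_sq_add_cos_sq] at this
    exact (sq_eq_sq₀ (norm_nonneg _) zero_le_one).1 (by rw [one_pow]; exact this)
  have hAB : ∀ θ, inner ℝ (A θ) (B θ) = 0 := fun θ => by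
    have := inner_smul_add_smul_orthonormal hu hv huv (Real.cos θ) (Real.sin θ)
      (-Real.sin θ) (Real.cos θ)
    rw [this]; ring
  have hAd : ∀ (x : E) (θ : ℝ), HasDerivAt (fun θ => inner ℝ (A θ) x) (inner ℝ (B θ) x) θ := by
    intro x θ
    simp only [A, B, inner_add_left, real_inner_smul_left]
    exact ((Real.hasDerivAt_cos θ).mul_const _).add ((Real.hasDerivAt_sin θ).mul_const _)
  have hBd : ∀ (x : E) (θ : ℝ), HasDerivAt (fun θ => inner ℝ (B θ) x) (-inner ℝ (A θ) x) θ := by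
    intro x θ
    simp only [A, B, inner_add_left, real_inner_smul_left]
    refine (((Real.hasDerivAt_sin θ).neg.mul_const _).add
      ((Real.hasDerivAt_cos θ).mul_const _)).congr_deriv ?_
    ring
  obtain ⟨M, hM⟩ := isCompact_Icc.exists_bound_of_continuousOn (s := Icc (-1 : ℝ) 1)
    (f := fun t => p.eval t) p.continuousOn
  obtain ⟨M', hM'⟩ := isCompact_Icc.exists_bound_of_continuousOn (s := Icc (-1 : ℝ) 1)
    (f := fun t => (derivative p).eval t) (derivative p).continuousOn
  set G : ℝ → E → ℝ := fun θ x => p.eval (inner ℝ (A θ) x) * inner ℝ (B θ) x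
  set G' : ℝ → E → ℝ := fun θ x => (derivative p).eval (inner ℝ (A θ) x) * inner ℝ (B θ) x *
    inner ℝ (B θ) x + p.eval (inner ℝ (A θ) x) * -inner ℝ (A θ) x
  have hGc : ∀ θ, Continuous (G θ) := fun θ => by
    have := p.continuous
    fun_prop
  have hGc' : ∀ θ, Continuous (G' θ) := fun θ => by
    have := p.continuous
    have := (derivative p).continuous
    fun_prop
  have hd := (hasDerivAt_integral_of_dominated_loc_of_deriv_le (μ := σ) (F := G) (F' := G')
    (x₀ := (0 : ℝ)) (s := univ) (bound := fun _ => M' + M) univ_mem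
    (.of_forall fun θ => (hGc θ).aestronglyMeasurable) (hσ.integrable (hGc 0))
    (hGc' 0).aestronglyMeasurable ?_ (integrable_const _) ?_).2
  · have hconst : ∀ θ, ∫ x, G θ x ∂σ = ∫ x, G 0 x ∂σ := fun θ =>
      hσ.integral_pair ((hA θ).trans (hA 0).symm) ((hB θ).trans (hB 0).symm)
        ((hAB θ).trans (hAB 0).symm) fun a b => p.eval a * b
    have h0 := hd.unique (by simpa only [hconst] using hasDerivAt_const (0 : ℝ) (∫ x, G 0 x ∂σ))
    have hA0 : A 0 = u := by simp [A]
    have hB0 : B 0 = v := by simp [B]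
    simp only [G', hA0, hB0] at h0
    have hc1 := p.continuous
    have hc2 := (derivative p).continuous
    rw [integral_add (hσ.integrable (by fun_prop)) (hσ.integrable (by fun_prop))] at h0
    simp only [mul_neg, integral_neg, mul_assoc, ← sq] at h0
    linarith
  · filter_upwards [hσ.ae_norm] with x hx θ _
    have h1 := inner_unit_mem_Icc (hA θ) hx
    have h2 := inner_unit_mem_Icc (hB θ) hx
    refine (norm_add_le _ _).trans (add_le_add ?_ ?_)
    · rw [norm_mul, norm_mul, mul_assoc]
      refine (mul_le_of_le_one_right (norm_nonneg _) ?_).trans (hM' _ h1)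
      exact mul_le_one₀ (abs_le.2 h2) (norm_nonneg _) (abs_le.2 h2)
    · rw [norm_mul, norm_neg]
      exact (mul_le_of_le_one_right (norm_nonneg _) (abs_le.2 h1)).trans (hM _ h1)
  · refine .of_forall fun x θ _ => ?_
    exact ((p.hasDerivAt _).comp θ (hAd x θ)).mul (hBd x θ)

/-- Sum the rotation identity over the `d - 1` basis vectors other than `b i₀`. On the sphere their
squared coordinates add up to `1 - ⟨b i₀, x⟩ ^ 2`, and `d - 1 = 2 lam + 1`, so this is `adjoint`. -/
theorem isGegenbauerMeasure_map {ι : Type*} [Fintype ι] (hσ : IsSphereMeasure σ)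
    (b : OrthonormalBasis ι ℝ E) (i₀ : ι) :
    IsGegenbauerMeasure (((Fintype.card ι : ℝ) - 2) / 2) (σ.map fun x => inner ℝ (b i₀) x) := by
  classical
  have := hσ.prob
  have hm : Measurable fun x : E => inner ℝ (b i₀) x := by fun_prop
  refine ⟨Measure.isProbabilityMeasure_map hm.aemeasurable, ?_, fun p => ?_⟩
  · refine (ae_map_iff (p := fun t => t ∈ Icc (-1 : ℝ) 1) hm.aemeasurable measurableSet_Icc).2 ?_
    filter_upwards [hσ.ae_norm] with x hx
    exact inner_unit_mem_Icc (b.orthonormal.1 i₀) hx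
  · rw [integral_map hm.aemeasurable (Polynomial.continuous _).aestronglyMeasurable]
    have hpc := p.continuous
    have hpc' := (derivative p).continuous
    have hsum : ∫ x, (derivative p).eval (inner ℝ (b i₀) x) * (1 - inner ℝ (b i₀) x ^ 2) ∂σ =
        ∑ i ∈ Finset.univ.erase i₀,
          ∫ x, (derivative p).eval (inner ℝ (b i₀) x) * inner ℝ (b i) x ^ 2 ∂σ := by
      rw [← integral_finsetSum _ fun i _ => hσ.integrable (by fun_prop)]
      refine integral_congr_ae ?_
      filter_upwards [hσ.ae_norm] with x hx
      have h := b.sum_sq_norm_inner_right x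
      simp only [Real.norm_eq_abs, sq_abs] at h
      rw [hx, ← Finset.add_sum_erase _ _ (Finset.mem_univ i₀)] at h
      rw [← Finset.mul_sum]
      congr 1
      linarith
    have hrot : ∀ i ∈ Finset.univ.erase i₀,
        ∫ x, (derivative p).eval (inner ℝ (b i₀) x) * inner ℝ (b i) x ^ 2 ∂σ =
          ∫ x, p.eval (inner ℝ (b i₀) x) * inner ℝ (b i₀) x ∂σ := fun i hi =>
      hσ.integral_rotation (b.orthonormal.1 i₀) (b.orthonormal.1 i)
        (b.orthonormal.2 (Finset.ne_of_mem_erase hi).symm) p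
    rw [Finset.sum_congr rfl hrot, Finset.sum_const, Finset.card_erase_of_mem (Finset.mem_univ _),
      Finset.card_univ, nsmul_eq_mul,
      Nat.cast_sub (Fintype.card_pos_iff.2 ⟨i₀⟩)] at hsum
    have e : ∀ x : E, ((1 - X ^ 2) * derivative p -
        (2 * C (((Fintype.card ι : ℝ) - 2) / 2) + 1) * X * p).eval (inner ℝ (b i₀) x) =
        (derivative p).eval (inner ℝ (b i₀) x) * (1 - inner ℝ (b i₀) x ^ 2) -
          ((Fintype.card ι : ℝ) - 1) * (p.eval (inner ℝ (b i₀) x) * inner ℝ (b i₀) x) := by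
      intro x
      simp only [eval_sub, eval_mul, eval_one, eval_pow, eval_X, eval_add, eval_C, eval_ofNat]
      ring
    simp only [e]
    rw [integral_sub (hσ.integrable (by fun_prop)) (hσ.integrable (by fun_prop)),
      integral_const_mul, hsum]
    simp

end IsSphereMeasure

end SphereMeasure

/-! ### Positive definiteness of the zonal polynomials -/

section ZonalPolynomials

open Polynomial MeasureTheory Set Filter Topology ComplexConjugate

theorem integral_simpleFunc {X Y : Type*} [MeasurableSpace X] {μ : Measure X} [IsFiniteMeasure μ]
    (f : SimpleFunc X Y) (h : Y → ℂ) :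
    ∫ x, h (f x) ∂μ = ∑ a ∈ f.range, ((μ.real (f ⁻¹' {a}) : ℝ) : ℂ) * h a := by
  classical
  have e : ∀ x, h (f x) = ∑ a ∈ f.range, (f ⁻¹' {a}).indicator (fun _ => h a) x := by
    intro x
    rw [Finset.sum_eq_single_of_mem (f x) (f.mem_range_self x)]
    · simp
    · intro a _ ha
      simp [indicator, ha.symm]
  simp only [e]
  rw [integral_finsetSum _ fun a _ =>
    (integrable_const (h a)).indicator (f.measurableSet_fiber a)]
  refine Finset.sum_congr rfl fun a _ => ?_
  rw [integral_indicator_const _ (f.measurableSet_fiber a), Complex.real_smul]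

theorem integral_map_eq_weightMeasure {X : Type*} [MeasurableSpace X] {σ : Measure X} {g : X → ℝ}
    (hg : Measurable g) {lam : ℝ} (h : σ.map g = weightMeasure lam) (hl : 0 ≤ lam) {F : Type*}
    [NormedAddCommGroup F] [NormedSpace ℝ F] {f : ℝ → F} (hf : ContinuousOn f (Icc (-1) 1)) :
    ∫ x, f (g x) ∂σ = ∫ t, f t ∂(weightMeasure lam) := by
  rw [← h, integral_map hg.aemeasurable]
  rw [h]
  exact ((isGegenbauerMeasure_weightMeasure hl).integrable hf).aestronglyMeasurable

namespace IsSphereMeasure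

variable {E : Type*} [NormedAddCommGroup E] [InnerProductSpace ℝ E] [MeasurableSpace E]
  [BorelSpace E] {σ : Measure E} {lam : ℝ}

/-- Isometries act transitively on the sphere, so the inner integral does not depend on `x`. -/
theorem integral_integral_of_invariant (hσ : IsSphereMeasure σ) {e : E} (he : ‖e‖ = 1)
    {G : E → E → ℂ} (hG : IsOrthogonallyInvariant G) :
    ∫ x, ∫ y, G x y ∂σ ∂σ = ∫ y, G e y ∂σ := by
  have := hσ.prob
  have h : ∀ᵐ x ∂σ, ∫ y, G x y ∂σ = ∫ y, G e y ∂σ := by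
    filter_upwards [hσ.ae_norm] with x hx
    obtain ⟨U, hU, -⟩ := exists_linearIsometryEquiv_pair (x := x) (x' := e) (y := x) (y' := e)
      (hx.trans he.symm) (hx.trans he.symm)
      (by rw [real_inner_self_eq_norm_sq, real_inner_self_eq_norm_sq, he, hx])
    rw [← hσ.integral_comp U (G e), ← hU]
    simp only [hG U]
  rw [integral_congr_ae h]
  simp

variable [FiniteDimensional ℝ E]

theorem map_inner_eq_weightMeasure {ι : Type*} [Fintype ι] (hσ : IsSphereMeasure σ)
    (b : OrthonormalBasis ι ℝ E) (hcard : 2 ≤ Fintype.card ι) {e : E} (he : ‖e‖ = 1) :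
    σ.map (fun x => inner ℝ e x) = weightMeasure (((Fintype.card ι : ℝ) - 2) / 2) := by
  obtain ⟨i₀⟩ : Nonempty ι := Fintype.card_pos_iff.1 (by omega)
  have hl : 0 ≤ ((Fintype.card ι : ℝ) - 2) / 2 := by
    have : (2 : ℝ) ≤ Fintype.card ι := by exact_mod_cast hcard
    linarith
  rw [← (hσ.isGegenbauerMeasure_map b i₀).unique (isGegenbauerMeasure_weightMeasure hl) hl]
  obtain ⟨U, hU, -⟩ := exists_linearIsometryEquiv_pair (x := b i₀) (x' := e) (y := b i₀) (y' := e)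
    ((b.orthonormal.1 i₀).trans he.symm) ((b.orthonormal.1 i₀).trans he.symm)
    (by rw [real_inner_self_eq_norm_sq, real_inner_self_eq_norm_sq, he, b.orthonormal.1 i₀])
  conv_lhs => rw [← hσ.map_eq U]
  rw [Measure.map_map (by fun_prop) U.continuous.measurable]
  congr 1
  funext x
  rw [← hU]
  exact U.inner_map_map _ _

/-- Convolution on the sphere does not raise the degree. Put `ζ = t e₁ + √(1 - t²) e₂` and expand
binomially: odd powers of the `e₂` coordinate integrate to `0` by the symmetry `e₂ ↦ -e₂`, and even
ones contribute powers of `1 - t ^ 2`. -/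
theorem exists_poly_integral_pow (hσ : IsSphereMeasure σ) {e₁ e₂ : E} (h₁ : ‖e₁‖ = 1)
    (h₂ : ‖e₂‖ = 1) (h₁₂ : inner ℝ e₁ e₂ = 0) {q : ℝ → ℝ} (hq : Continuous q) (k : ℕ) :
    ∃ r : ℝ[X], r.natDegree ≤ k ∧ ∀ ξ ζ : E, ‖ξ‖ = 1 → ‖ζ‖ = 1 →
      ∫ x, q (inner ℝ ξ x) * inner ℝ ζ x ^ k ∂σ = r.eval (inner ℝ ξ ζ) := by
  set I : ℕ → ℝ := fun m => ∫ x, q (inner ℝ e₁ x) * inner ℝ e₁ x ^ m * inner ℝ e₂ x ^ (k - m) ∂σ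
  have hodd : ∀ m, Odd (k - m) → I m = 0 := by
    intro m hm
    have h := hσ.integral_pair (u := e₁) (v := e₂) (u' := e₁) (v' := -e₂) rfl (by simp)
      (by simp [h₁₂]) fun a b => q a * a ^ m * b ^ (k - m)
    simp only [inner_neg_left, hm.neg_pow, mul_neg, integral_neg] at h
    change I m = -I m at h
    linarith
  refine ⟨∑ m ∈ Finset.range (k + 1), C (k.choose m * I m) * (X ^ m * (1 - X ^ 2) ^ ((k - m) / 2)),
    ?_, fun ξ ζ hξ hζ => ?_⟩
  · refine natDegree_sum_le_of_forall_le _ _ fun m hm => ?_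
    refine (natDegree_C_mul_le _ _).trans (natDegree_mul_le.trans ?_)
    have hd : (1 - X ^ 2 : ℝ[X]).natDegree ≤ 2 := (natDegree_sub_le _ _).trans (by simp)
    have h1 : ((1 - X ^ 2 : ℝ[X]) ^ ((k - m) / 2)).natDegree ≤ (k - m) / 2 * 2 :=
      natDegree_pow_le.trans (Nat.mul_le_mul_left _ hd)
    rw [natDegree_X_pow]
    rw [Finset.mem_range] at hm
    omega
  · set t := inner ℝ ξ ζ
    have ht : t ∈ Icc (-1 : ℝ) 1 := inner_unit_mem_Icc hξ hζ
    have hn := norm_circlePoint h₁ h₂ h₁₂ ht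
    rw [hσ.integral_pair (u' := e₁) (v' := circlePoint e₁ e₂ t) (hξ.trans h₁.symm)
      (hζ.trans hn.symm) (inner_circlePoint h₁ h₁₂ t).symm fun a b => q a * b ^ k]
    have hexp : ∀ x : E, q (inner ℝ e₁ x) * inner ℝ (circlePoint e₁ e₂ t) x ^ k =
        ∑ m ∈ Finset.range (k + 1), (t ^ m * √(1 - t ^ 2) ^ (k - m) * k.choose m) *
          (q (inner ℝ e₁ x) * inner ℝ e₁ x ^ m * inner ℝ e₂ x ^ (k - m)) := by
      intro x
      simp only [circlePoint, inner_add_left, real_inner_smul_left]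
      rw [add_pow, Finset.mul_sum]
      refine Finset.sum_congr rfl fun m _ => ?_
      rw [mul_pow, mul_pow]
      ring
    simp only [hexp]
    rw [integral_finsetSum _ fun m _ => hσ.integrable (by fun_prop), eval_finsetSum]
    refine Finset.sum_congr rfl fun m _ => ?_
    rw [integral_const_mul]
    change _ * I m = _
    simp only [eval_mul, eval_C, eval_pow, eval_X, eval_sub, eval_one]
    rcases Nat.even_or_odd (k - m) with he | ho
    · have : √(1 - t ^ 2) ^ (k - m) = (1 - t ^ 2) ^ ((k - m) / 2) := by
        conv_lhs => rw [← Nat.two_mul_div_two_of_even he]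
        rw [pow_mul, Real.sq_sqrt (by nlinarith [ht.1, ht.2])]
      rw [this]
      ring
    · rw [hodd m ho]
      ring

theorem exists_poly_integral (hσ : IsSphereMeasure σ) {e₁ e₂ : E} (h₁ : ‖e₁‖ = 1)
    (h₂ : ‖e₂‖ = 1) (h₁₂ : inner ℝ e₁ e₂ = 0) {q : ℝ → ℝ} (hq : Continuous q) {k : ℕ} {p : ℝ[X]}
    (hp : p.natDegree ≤ k) :
    ∃ r : ℝ[X], r.natDegree ≤ k ∧ ∀ ξ ζ : E, ‖ξ‖ = 1 → ‖ζ‖ = 1 →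
      ∫ x, q (inner ℝ ξ x) * p.eval (inner ℝ ζ x) ∂σ = r.eval (inner ℝ ξ ζ) := by
  choose r hr hri using hσ.exists_poly_integral_pow h₁ h₂ h₁₂ hq
  refine ⟨∑ i ∈ Finset.range (p.natDegree + 1), C (p.coeff i) * r i, ?_, fun ξ ζ hξ hζ => ?_⟩
  · refine natDegree_sum_le_of_forall_le _ _ fun m hm => (natDegree_C_mul_le _ _).trans ?_
    have := hr m
    rw [Finset.mem_range] at hm
    omega
  · simp only [eval_eq_sum_range (p := p), Finset.mul_sum]
    rw [integral_finsetSum _ fun m _ => hσ.integrable (by fun_prop), eval_finsetSum]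
    refine Finset.sum_congr rfl fun m _ => ?_
    simp only [mul_left_comm (q _)]
    rw [integral_const_mul, hri m ξ ζ hξ hζ, eval_mul, eval_C]

theorem integrable_prod (hσ : IsSphereMeasure σ) {F : Type*} [NormedAddCommGroup F]
    {f : E × E → F} (hf : Continuous f) : Integrable f (σ.prod σ) := by
  have := hσ.prob
  refine integrable_of_continuousOn_of_ae_mem
    ((isCompact_sphere (0 : E) 1).prod (isCompact_sphere (0 : E) 1)) ?_ hf.continuousOn
  have h1 : ∀ᵐ z ∂(σ.prod σ), ‖z.1‖ = 1 := Measure.quasiMeasurePreserving_fst.ae hσ.ae_norm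
  have h2 : ∀ᵐ z ∂(σ.prod σ), ‖z.2‖ = 1 := Measure.quasiMeasurePreserving_snd.ae hσ.ae_norm
  filter_upwards [h1, h2] with z hz1 hz2
  simp [mem_prod, hz1, hz2]

/-- The integral is a polynomial `φ` of degree at most `n` in `⟨ξ, ζ⟩`. Being orthogonal to all `Q
m` with `m < n`, it is a multiple of `Q n`, and its value at `1` fixes the factor. -/
theorem integral_zonalPoly_mul (hσ : IsSphereMeasure σ) (hl : 0 ≤ lam)
    (hW : ∀ e : E, ‖e‖ = 1 → σ.map (fun x => inner ℝ e x) = weightMeasure lam)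
    {e₁ e₂ : E} (h₁ : ‖e₁‖ = 1) (h₂ : ‖e₂‖ = 1) (h₁₂ : inner ℝ e₁ e₂ = 0) (n : ℕ) {ξ ζ : E}
    (hξ : ‖ξ‖ = 1) (hζ : ‖ζ‖ = 1) :
    ∫ x, (zonalPoly lam n).eval (inner ℝ ξ x) * (zonalPoly lam n).eval (inner ℝ ζ x) ∂σ =
      (isGegenbauerMeasure_weightMeasure hl).normSq n * (zonalPoly lam n).eval (inner ℝ ξ ζ) := by
  have := hσ.prob
  set Q := zonalPoly lam
  set hν := isGegenbauerMeasure_weightMeasure hl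
  have hL := hν.isGegenbauerFunctional
  have hQc : ∀ n, Continuous fun t => (Q n).eval t := fun n => (Q n).continuous
  obtain ⟨φ, hφ, hφi⟩ := hσ.exists_poly_integral h₁ h₂ h₁₂ (hQc n)
    (natDegree_zonalPoly_le (lam := lam) n)
  rw [hφi ξ ζ hξ hζ]
  have hfun : ∀ p : ℝ[X], hν.functional p = ∫ x, p.eval (inner ℝ e₁ x) ∂σ := fun p =>
    (integral_map_eq_weightMeasure (by fun_prop) (hW e₁ h₁) hl p.continuousOn).symm
  -- By Fubini `Q m` can be convolved with `Q n` first; the result has degree at most `m < n`, hence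
  -- is orthogonal to the remaining `Q n`.
  have horth : ∀ m, m < n → hν.functional (φ * Q m) = 0 := by
    intro m hm
    obtain ⟨r, hr, hri⟩ := hσ.exists_poly_integral h₁ h₂ h₁₂ (hQc n)
      (natDegree_zonalPoly_le (lam := lam) m)
    rw [hfun]
    calc ∫ z, (φ * Q m).eval (inner ℝ e₁ z) ∂σ
        = ∫ z, ∫ x, (Q n).eval (inner ℝ e₁ x) * ((Q n).eval (inner ℝ x z) *
            (Q m).eval (inner ℝ e₁ z)) ∂σ ∂σ := by
          refine integral_congr_ae ?_
          filter_upwards [hσ.ae_norm] with z hz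
          rw [eval_mul, ← hφi e₁ z h₁ hz, ← integral_mul_const]
          refine integral_congr_ae (.of_forall fun x => ?_)
          simp only [real_inner_comm x z]
          ring
      _ = ∫ x, ∫ z, (Q n).eval (inner ℝ e₁ x) * ((Q n).eval (inner ℝ x z) *
            (Q m).eval (inner ℝ e₁ z)) ∂σ ∂σ := by
          refine integral_integral_swap (hσ.integrable_prod ?_)
          have := hQc n
          have := hQc m
          fun_prop
      _ = ∫ x, (r * Q n).eval (inner ℝ e₁ x) ∂σ := by
          refine integral_congr_ae ?_
          filter_upwards [hσ.ae_norm] with x hx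
          rw [integral_const_mul, hri x e₁ hx h₁, eval_mul, real_inner_comm, mul_comm]
      _ = 0 := by
          rw [← hfun]
          exact hL.mul_eq_zero_of_natDegree_lt hl (hr.trans_lt hm)
  have hsum := hL.eq_sum hl hφ
  rw [Finset.sum_eq_single_of_mem n (by simp)] at hsum
  · have h1 : φ.eval 1 = hν.normSq n := by
      have h := hφi e₁ e₁ h₁ h₁
      rw [real_inner_self_eq_norm_sq, h₁, one_pow] at h
      rw [← h, IsGegenbauerMeasure.normSq, hfun]
      simp [Q]
    have h2 : φ.eval 1 = _ := congrArg (eval 1) hsum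
    rw [eval_smul, eval_one_zonalPoly hl, smul_eq_mul, mul_one, h1] at h2
    rw [hsum, eval_smul, smul_eq_mul, ← h2]
  · intro m hm hmn
    rw [Finset.mem_range] at hm
    rw [horth m (by omega), zero_div, zero_smul]

/-- By the convolution identity `normSq n` times the kernel is the `L²` Gram kernel of the functions
`x ↦ Q n (⟨ξ, x⟩)`. -/
theorem isPosDefKernel_zonalPoly (hσ : IsSphereMeasure σ) (hl : 0 ≤ lam)
    (hW : ∀ e : E, ‖e‖ = 1 → σ.map (fun x => inner ℝ e x) = weightMeasure lam)
    {e₁ e₂ : E} (h₁ : ‖e₁‖ = 1) (h₂ : ‖e₂‖ = 1) (h₁₂ : inner ℝ e₁ e₂ = 0) (n : ℕ) :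
    IsPosDefKernel fun ξ η : {x : E // ‖x‖ = 1} =>
      (((zonalPoly lam n).eval (inner ℝ ξ.1 η.1) : ℝ) : ℂ) := by
  set Q := zonalPoly lam
  have hQc : Continuous fun t => (Q n).eval t := (Q n).continuous
  have hpos := (isGegenbauerMeasure_weightMeasure hl).normSq_pos hl n
  set h := (isGegenbauerMeasure_weightMeasure hl).normSq n
  have key : IsPosDefKernel fun ξ η : {x : E // ‖x‖ = 1} =>
      (h : ℂ) * (((Q n).eval (inner ℝ ξ.1 η.1) : ℝ) : ℂ) := by
    intro m x c
    have e : ∑ i, ∑ j, c i * conj (c j) *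
        ((h : ℂ) * (((Q n).eval (inner ℝ (x i).1 (x j).1) : ℝ) : ℂ)) =
        ∫ z, (∑ i, c i * (((Q n).eval (inner ℝ (x i).1 z) : ℝ) : ℂ)) *
          conj (∑ i, c i * (((Q n).eval (inner ℝ (x i).1 z) : ℝ) : ℂ)) ∂σ := by
      simp only [map_sum, Finset.sum_mul_sum]
      rw [integral_finsetSum _ fun i _ => hσ.integrable (by fun_prop)]
      refine Finset.sum_congr rfl fun i _ => ?_
      rw [integral_finsetSum _ fun j _ => hσ.integrable (by fun_prop)]
      refine Finset.sum_congr rfl fun j _ => ?_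
      rw [← Complex.ofReal_mul, ← hσ.integral_zonalPoly_mul hl hW h₁ h₂ h₁₂ n (x i).2 (x j).2,
        ← integral_complex_ofReal, ← integral_const_mul]
      refine integral_congr_ae (.of_forall fun z => ?_)
      simp only [map_mul, Complex.conj_ofReal, Complex.ofReal_mul]
      ring
    rw [e]
    simp only [Complex.mul_conj]
    rw [integral_complex_ofReal, Complex.zero_le_real]
    exact integral_nonneg fun z => Complex.normSq_nonneg _
  have hinv : (0 : ℂ) ≤ ((h⁻¹ : ℝ) : ℂ) := Complex.zero_le_real.2 (inv_nonneg.2 hpos.le)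
  have h2 := key.const_mul hinv
  have hne : (h : ℂ) ≠ 0 := Complex.ofReal_ne_zero.2 hpos.ne'
  simpa only [Complex.ofReal_inv, inv_mul_cancel_left₀ hne] using h2

theorem abs_zonalPoly_le_one (hσ : IsSphereMeasure σ) (hl : 0 ≤ lam)
    (hW : ∀ e : E, ‖e‖ = 1 → σ.map (fun x => inner ℝ e x) = weightMeasure lam)
    {e₁ e₂ : E} (h₁ : ‖e₁‖ = 1) (h₂ : ‖e₂‖ = 1) (h₁₂ : inner ℝ e₁ e₂ = 0) (n : ℕ) {t : ℝ}
    (ht : t ∈ Icc (-1 : ℝ) 1) : |(zonalPoly lam n).eval t| ≤ 1 := by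
  have hn := norm_circlePoint h₁ h₂ h₁₂ ht
  have h := (hσ.isPosDefKernel_zonalPoly hl hW h₁ h₂ h₁₂ n).norm_le
    (⟨e₁, h₁⟩ : {x : E // ‖x‖ = 1}) ⟨circlePoint e₁ e₂ t, hn⟩
  simp only [inner_circlePoint h₁ h₁₂, real_inner_self_eq_norm_sq, h₁, hn, one_pow,
    eval_one_zonalPoly hl, Complex.norm_real] at h
  simpa using h

/-- Approximate the identity by simple functions with values on the sphere. Each double integral
becomes a kernel sum whose coefficients are the masses of the fibres, and dominated convergence
passes to the limit. -/
theorem integral_integral_nonneg (hσ : IsSphereMeasure σ) {e : E} (he : ‖e‖ = 1) {G : E → E → ℂ}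
    (hG : Continuous fun p : E × E => G p.1 p.2)
    (hpd : IsPosDefKernel fun ξ η : {x : E // ‖x‖ = 1} => G ξ η) :
    0 ≤ ∫ x, ∫ y, G x y ∂σ ∂σ := by
  classical
  have := hσ.prob
  have hes : e ∈ Metric.sphere (0 : E) 1 := by simpa using he
  set f : ℕ → SimpleFunc E E := SimpleFunc.approxOn id measurable_id (Metric.sphere (0 : E) 1) e hes
  have hf : ∀ n x, ‖f n x‖ = 1 := fun n x => by
    simpa using SimpleFunc.approxOn_mem measurable_id hes n x
  have hlim : ∀ x : E, ‖x‖ = 1 → Tendsto (fun n => f n x) atTop (𝓝 x) := fun x hx =>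
    SimpleFunc.tendsto_approxOn measurable_id hes (subset_closure (by simpa using hx))
  obtain ⟨M, hM⟩ := ((isCompact_sphere (0 : E) 1).prod
    (isCompact_sphere (0 : E) 1)).exists_bound_of_continuousOn hG.continuousOn
  have hmeas : ∀ n, Measurable fun p : E × E => G (f n p.1) (f n p.2) := fun n =>
    hG.measurable.comp (((f n).measurable.comp measurable_fst).prodMk
      ((f n).measurable.comp measurable_snd))
  have hbd : ∀ n (p : E × E), ‖G (f n p.1) (f n p.2)‖ ≤ M := fun n p =>
    hM (f n p.1, f n p.2) (by simp [mem_prod, hf])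
  have hT : Tendsto (fun n => ∫ p, G (f n p.1) (f n p.2) ∂(σ.prod σ)) atTop
      (𝓝 (∫ p, G p.1 p.2 ∂(σ.prod σ))) := by
    refine tendsto_integral_of_dominated_convergence (fun _ => M)
      (fun n => (hmeas n).aestronglyMeasurable) (integrable_const _)
      (fun n => .of_forall (hbd n)) ?_
    have h1 : ∀ᵐ z ∂(σ.prod σ), ‖z.1‖ = 1 := Measure.quasiMeasurePreserving_fst.ae hσ.ae_norm
    have h2 : ∀ᵐ z ∂(σ.prod σ), ‖z.2‖ = 1 := Measure.quasiMeasurePreserving_snd.ae hσ.ae_norm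
    filter_upwards [h1, h2] with z hz1 hz2
    exact (hG.tendsto z).comp ((hlim _ hz1).prodMk_nhds (hlim _ hz2))
  rw [← integral_prod (fun p : E × E => G p.1 p.2) (hσ.integrable_prod hG)]
  refine ge_of_tendsto hT (.of_forall fun n => ?_)
  rw [integral_prod (fun p : E × E => G (f n p.1) (f n p.2))
    (Integrable.of_bound (hmeas n).aestronglyMeasurable M (.of_forall (hbd n)))]
  simp only
  have h1 : ∀ x, ∫ y, G (f n x) (f n y) ∂σ = _ := fun x => integral_simpleFunc (f n) (G (f n x))
  simp only [h1]
  rw [integral_simpleFunc (f n) fun a =>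
    ∑ b ∈ (f n).range, ((σ.real (f n ⁻¹' {b}) : ℝ) : ℂ) * G a b]
  have h2 := hpd.sum_nonneg (f n).range
    (fun a => if h : ‖a‖ = 1 then ⟨a, h⟩ else ⟨e, he⟩) fun a => ((σ.real (f n ⁻¹' {a}) : ℝ) : ℂ)
  refine h2.trans_eq (Finset.sum_congr rfl fun a ha => ?_)
  rw [Finset.mul_sum]
  refine Finset.sum_congr rfl fun b hb => ?_
  have hr : ∀ a ∈ (f n).range, ‖a‖ = 1 := by
    intro a ha
    obtain ⟨x, rfl⟩ := SimpleFunc.mem_range.1 ha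
    exact hf n x
  rw [dif_pos (hr a ha), dif_pos (hr b hb), Complex.conj_ofReal, mul_assoc]

end IsSphereMeasure

end ZonalPolynomials

/-! ### The expansion in finite dimension -/

section FiniteDimensional

open Polynomial MeasureTheory Set Filter Topology ComplexConjugate

theorem IsPosDefKernel.sum_comp {X Y : Type*} {K : X → X → ℂ} (hK : IsPosDefKernel K) {ι : Type*}
    [Fintype ι] (f : ι → Y → X) (c : ι → ℂ) :
    IsPosDefKernel fun x y => ∑ i, ∑ j, c i * conj (c j) * K (f i x) (f j y) := by
  intro k x a
  have h := hK.sum_univ_nonneg (ι := Fin k × ι) (fun p => f p.2 (x p.1))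
    fun p => a p.1 * c p.2
  refine h.trans_eq ?_
  simp only [Fintype.sum_prod_type, Finset.mul_sum, map_mul]
  refine Finset.sum_congr rfl fun i _ => ?_
  rw [Finset.sum_comm]
  refine Finset.sum_congr rfl fun j _ => Finset.sum_congr rfl fun p _ =>
    Finset.sum_congr rfl fun q _ => ?_
  ring

namespace IsSphereMeasure

variable {E : Type*} [NormedAddCommGroup E] [InnerProductSpace ℝ E] [MeasurableSpace E]
  [BorelSpace E] [FiniteDimensional ℝ E] {σ : Measure E} {lam : ℝ}

theorem isZonalSystem (hσ : IsSphereMeasure σ) (hl : 0 ≤ lam)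
    (hW : ∀ e : E, ‖e‖ = 1 → σ.map (fun x => inner ℝ e x) = weightMeasure lam)
    {e₁ e₂ : E} (h₁ : ‖e₁‖ = 1) (h₂ : ‖e₂‖ = 1) (h₁₂ : inner ℝ e₁ e₂ = 0) :
    IsZonalSystem E (normalizedGegenbauer lam) where
  zero t := by rw [normalizedGegenbauer_eq hl, zonalPoly_zero, eval_one]
  posDef n := by
    simpa only [normalizedGegenbauer_eq hl] using hσ.isPosDefKernel_zonalPoly hl hW h₁ h₂ h₁₂ n
  unique c hc h := by
    funext m
    simp only [normalizedGegenbauer_eq hl] at h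
    have hν := isGegenbauerMeasure_weightMeasure hl
    have := hν.integral_tsum_mul hl
      (fun n t ht => hσ.abs_zonalPoly_le_one hl hW h₁ h₂ h₁₂ n ht) hc (f := fun _ => 0) h m
    simp only [zero_mul, integral_zero] at this
    exact (mul_eq_zero.1 this.symm).resolve_right
      (Complex.ofReal_ne_zero.2 (hν.normSq_pos hl m).ne')

/-- The coefficients are spherical integrals of `K` against `Q n`. Writing them through `K` gives
continuity and positive definiteness in the radii; writing them through `κ` and the weight gives
convergence. -/
theorem exists_isSphericalExpansion (hσ : IsSphereMeasure σ) (hl : 0 ≤ lam)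
    (hW : ∀ e : E, ‖e‖ = 1 → σ.map (fun x => inner ℝ e x) = weightMeasure lam)
    {e₁ e₂ : E} (h₁ : ‖e₁‖ = 1) (h₂ : ‖e₂‖ = 1) (h₁₂ : inner ℝ e₁ e₂ = 0) {K : E → E → ℂ}
    (hK : Continuous fun p : E × E => K p.1 p.2) (hpd : IsPosDefKernel K)
    {κ : ℝ≥0 → ℝ≥0 → ℝ → ℂ} (hκ : IsInvariantRepresentation K κ) :
    ∃ α, IsSphericalExpansion (normalizedGegenbauer lam) K α := by
  have := hσ.prob
  set hν := isGegenbauerMeasure_weightMeasure hl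
  set Q := zonalPoly lam
  have hQc : ∀ n, Continuous fun t => (Q n).eval t := fun n => (Q n).continuous
  have hQ1 : ∀ n, ∀ t ∈ Icc (-1 : ℝ) 1, |(Q n).eval t| ≤ 1 := fun n t ht =>
    hσ.abs_zonalPoly_le_one hl hW h₁ h₂ h₁₂ n ht
  have hpos := hν.normSq_pos hl
  have hne : ∀ n, (hν.normSq n : ℂ) ≠ 0 := fun n => Complex.ofReal_ne_zero.2 (hpos n).ne'
  set I : ℕ → ℝ≥0 → ℝ≥0 → ℂ := fun n r s =>
    ∫ y, K ((r : ℝ) • e₁) ((s : ℝ) • y) * (((Q n).eval (inner ℝ e₁ y) : ℝ) : ℂ) ∂σ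
  have hI : ∀ n r s, I n r s = ∫ t, κ r s (r * s * t) * (((Q n).eval t : ℝ) : ℂ)
      ∂(weightMeasure lam) := by
    intro n r s
    have hc : ContinuousOn (fun t : ℝ => κ r s (r * s * t) * (((Q n).eval t : ℝ) : ℂ))
        (Icc (-1) 1) :=
      (hκ.continuousOn_section r s).mul (by have := hQc n; fun_prop)
    rw [← integral_map_eq_weightMeasure (by fun_prop) (hW e₁ h₁) hl hc]
    refine integral_congr_ae ?_
    filter_upwards [hσ.ae_norm] with y hy
    rw [hκ.apply_smul_unit h₁ hy]
  have hcont : ∀ n, Continuous fun p : ℝ≥0 × ℝ≥0 => I n p.1 p.2 := by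
    intro n
    have hs : ∀ᵐ y ∂σ, y ∈ Metric.sphere (0 : E) 1 := by
      filter_upwards [hσ.ae_norm] with y hy
      simpa using hy
    have h := continuous_parametric_integral_of_continuous (μ := σ)
      (f := fun (p : ℝ≥0 × ℝ≥0) y => K ((p.1 : ℝ) • e₁) ((p.2 : ℝ) • y) *
        (((Q n).eval (inner ℝ e₁ y) : ℝ) : ℂ)) ?_ (isCompact_sphere (0 : E) 1)
    · rwa [Measure.restrict_eq_self_of_ae_mem hs] at h
    · have h1 : Continuous fun z : (ℝ≥0 × ℝ≥0) × E => K ((z.1.1 : ℝ) • e₁) ((z.1.2 : ℝ) • z.2) :=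
        hK.comp (f := fun z : (ℝ≥0 × ℝ≥0) × E => ((z.1.1 : ℝ) • e₁, (z.1.2 : ℝ) • z.2))
          (by fun_prop)
      have := hQc n
      exact h1.mul (by fun_prop)
  have hIpd : ∀ n, IsPosDefKernel (I n) := by
    intro n m r c
    -- `G` is invariant and positive definite, a Schur product with `Q n`. Its double integral is
    -- nonnegative and collapses to a single one, which is the required sum for `I n`.
    set G : E → E → ℂ := fun x y => (∑ i, ∑ j, c i * conj (c j) *
      K ((r i : ℝ) • x) ((r j : ℝ) • y)) * (((Q n).eval (inner ℝ x y) : ℝ) : ℂ)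
    have hKc : ∀ i j, Continuous fun p : E × E => K ((r i : ℝ) • p.1) ((r j : ℝ) • p.2) :=
      fun i j => hK.comp (f := fun p : E × E => ((r i : ℝ) • p.1, (r j : ℝ) • p.2)) (by fun_prop)
    have hGc : Continuous fun p : E × E => G p.1 p.2 := by
      have := hQc n
      refine Continuous.mul ?_ (by fun_prop)
      exact continuous_finsetSum _ fun i _ => continuous_finsetSum _ fun j _ =>
        continuous_const.mul (hKc i j)
    have hGi : IsOrthogonallyInvariant G := by
      intro U x y
      simp only [G, ← map_smul, U.inner_map_map, hκ.isOrthogonallyInvariant U]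
    have hGpd : IsPosDefKernel fun ξ η : {x : E // ‖x‖ = 1} => G ξ η :=
      (hpd.sum_comp (fun i (ξ : {x : E // ‖x‖ = 1}) => (r i : ℝ) • ξ.1) c).mul
        (hσ.isPosDefKernel_zonalPoly hl hW h₁ h₂ h₁₂ n)
    have h := hσ.integral_integral_nonneg h₁ hGc hGpd
    rw [hσ.integral_integral_of_invariant h₁ hGi] at h
    refine h.trans_eq ?_
    simp only [G, Finset.sum_mul]
    have hKc' : ∀ i j, Continuous fun y : E => c i * conj (c j) *
        K ((r i : ℝ) • e₁) ((r j : ℝ) • y) * (((Q n).eval (inner ℝ e₁ y) : ℝ) : ℂ) := by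
      intro i j
      have h1 : Continuous fun y : E => K ((r i : ℝ) • e₁) ((r j : ℝ) • y) :=
        (hKc i j).comp (f := fun y => (e₁, y)) (by fun_prop)
      have := hQc n
      exact (continuous_const.mul h1).mul (by fun_prop)
    rw [integral_finsetSum _ fun i _ => hσ.integrable
      (continuous_finsetSum _ fun j _ => hKc' i j)]
    refine Finset.sum_congr rfl fun i _ => ?_
    rw [integral_finsetSum _ fun j _ => hσ.integrable (hKc' i j)]
    refine Finset.sum_congr rfl fun j _ => ?_
    simp only [mul_assoc (c i * conj (c j))]
    rw [integral_const_mul]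
  set α : ℕ → ℝ≥0 → ℝ≥0 → ℂ := fun n r s => ((hν.normSq n)⁻¹ : ℝ) * I n r s
  have hαpd : ∀ n, IsPosDefKernel (α n) := fun n =>
    (hIpd n).const_mul (Complex.zero_le_real.2 (inv_nonneg.2 (hpos n).le))
  have hαs : ∀ r, Summable fun n => (α n r r).re := by
    intro r
    have hc := hκ.continuousOn_section r r
    have hre : ∀ n, ∫ t, (κ r r (r * r * t)).re * (Q n).eval t ∂(weightMeasure lam) =
        (I n r r).re := by
      intro n
      have hint : Integrable (fun t : ℝ => κ r r (r * r * t) * (((Q n).eval t : ℝ) : ℂ))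
          (weightMeasure lam) := hν.integrable (hc.mul (by have := hQc n; fun_prop))
      have := Complex.reCLM.integral_comp_comm hint
      rw [hI]
      simpa using this
    -- On the diagonal the coefficients are nonnegative by positive definiteness, which is all that
    -- the Fejér-type bound requires.
    have h := hν.summable_coeff hl (Complex.continuous_re.comp_continuousOn hc) fun n => by
      change 0 ≤ ∫ t, (κ r r (r * r * t)).re * (Q n).eval t ∂(weightMeasure lam)
      rw [hre]
      exact (hIpd n).diag_re_nonneg r
    refine h.congr fun n => ?_
    simp only [Function.comp_def]
    rw [hre, Complex.re_ofReal_mul, div_eq_inv_mul]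
  refine ⟨α, hκ.isSphericalExpansion (hσ.isZonalSystem hl hW h₁ h₂ h₁₂)
    (fun n => continuous_const.mul (hcont n)) hαpd (fun r => ?_) fun r s t ht => ?_⟩
  · refine (Complex.ofRealCLM.summable (hαs r)).congr fun n => ?_
    exact ((hαpd n).diag_eq_re r).symm
  · simp only [normalizedGegenbauer_eq hl]
    refine hν.hasSum_zonalPoly hl (fun g hg h => eqOn_zero_of_ae_weightMeasure hl hg h) hQ1
      (hκ.continuousOn_section r s) (c := fun n => α n r s) ?_ (fun n => ?_) ht
    · exact Summable.of_nonneg_of_le (fun n => norm_nonneg _) (fun n => (hαpd n).norm_le r s)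
        (((hαs r).add (hαs s)).div_const 2)
    · rw [← hI]
      simp only [α, Complex.ofReal_inv]
      field_simp [hne n]

/-- Term-by-term integration of the expansion; the total mass of the weight cancels in the quotient.
-/
theorem coeff_eq_integral (hσ : IsSphereMeasure σ) (hl : 0 ≤ lam)
    (hW : ∀ e : E, ‖e‖ = 1 → σ.map (fun x => inner ℝ e x) = weightMeasure lam)
    {e₁ e₂ : E} (h₁ : ‖e₁‖ = 1) (h₂ : ‖e₂‖ = 1) (h₁₂ : inner ℝ e₁ e₂ = 0) {K : E → E → ℂ}
    {α : ℕ → ℝ≥0 → ℝ≥0 → ℂ} (hα : IsSphericalExpansion (normalizedGegenbauer lam) K α)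
    {κ : ℝ≥0 → ℝ≥0 → ℝ → ℂ} (hκ : IsInvariantRepresentation K κ) (n : ℕ) (r s : ℝ≥0) :
    IntervalIntegrable (fun ρ : ℝ => κ r s (r * s * ρ) * (normalizedGegenbauer lam n ρ : ℂ) *
      (gegenbauerWeight lam ρ : ℂ)) volume (-1) 1 ∧
    0 < (∫ ρ in (-1 : ℝ)..1, normalizedGegenbauer lam n ρ ^ 2 * gegenbauerWeight lam ρ) ∧
    α n r s = (∫ ρ in (-1 : ℝ)..1, κ r s (r * s * ρ) * (normalizedGegenbauer lam n ρ : ℂ) *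
      (gegenbauerWeight lam ρ : ℂ)) /
      ((∫ ρ in (-1 : ℝ)..1, normalizedGegenbauer lam n ρ ^ 2 * gegenbauerWeight lam ρ : ℝ) : ℂ) := by
  set hν := isGegenbauerMeasure_weightMeasure hl
  have hQc : ∀ n, Continuous fun t => (zonalPoly lam n).eval t := fun n =>
    (zonalPoly lam n).continuous
  have hmass := gegenbauerMass_pos hl
  have hnorm : hν.normSq n = (gegenbauerMass lam)⁻¹ *
      ∫ ρ in (-1 : ℝ)..1, normalizedGegenbauer lam n ρ ^ 2 * gegenbauerWeight lam ρ := by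
    rw [IsGegenbauerMeasure.normSq, IsGegenbauerMeasure.functional_apply, integral_weightMeasure hl,
      smul_eq_mul]
    congr 1
    refine intervalIntegral.integral_congr fun ρ _ => ?_
    simp only [eval_mul, normalizedGegenbauer_eq hl, smul_eq_mul]
    ring
  have hint : (∫ t, κ r s (r * s * t) * (((zonalPoly lam n).eval t : ℝ) : ℂ)
      ∂(weightMeasure lam)) = ((gegenbauerMass lam : ℂ))⁻¹ *
      ∫ ρ in (-1 : ℝ)..1, κ r s (r * s * ρ) * (normalizedGegenbauer lam n ρ : ℂ) *
        (gegenbauerWeight lam ρ : ℂ) := by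
    rw [integral_weightMeasure hl, Complex.real_smul, Complex.ofReal_inv]
    congr 1
    refine intervalIntegral.integral_congr fun ρ _ => ?_
    simp only [normalizedGegenbauer_eq hl, Complex.real_smul]
    ring
  have hcoef := hν.integral_tsum_mul hl
    (fun n t ht => hσ.abs_zonalPoly_le_one hl hW h₁ h₂ h₁₂ n ht) (hα.summable_norm r s)
    (f := fun t => κ r s (r * s * t)) (fun t ht => ?_) n
  · have hpos := hν.normSq_pos hl n
    rw [hint, hnorm] at hcoef
    rw [hnorm] at hpos
    have hJ := pos_of_mul_pos_right hpos (inv_nonneg.2 hmass.le)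
    refine ⟨?_, hJ, ?_⟩
    · have h1 : IntervalIntegrable (fun ρ => ((gegenbauerWeight lam ρ : ℝ) : ℂ)) volume (-1) 1 :=
        intervalIntegrable_iff.2
          (intervalIntegrable_iff.1 (intervalIntegrable_gegenbauerWeight hl)).ofReal
      refine h1.continuousOn_mul ?_
      rw [uIcc_of_le (by norm_num)]
      refine (hκ.continuousOn_section r s).mul ?_
      simp only [normalizedGegenbauer_eq hl]
      have := hQc n
      fun_prop
    · rw [eq_div_iff (Complex.ofReal_ne_zero.2 hJ.ne')]
      have hm : ((gegenbauerMass lam : ℂ))⁻¹ ≠ 0 :=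
        inv_ne_zero (Complex.ofReal_ne_zero.2 hmass.ne')
      refine mul_left_cancel₀ hm ?_
      rw [hcoef, Complex.ofReal_mul, Complex.ofReal_inv]
      ring
  · have hn := norm_circlePoint h₁ h₂ h₁₂ ht
    have h := hα.hasSum_smul (fun t => by rw [normalizedGegenbauer_eq hl, zonalPoly_zero, eval_one])
      h₁ hn r s
    rw [hκ.apply_smul_unit h₁ hn] at h
    simpa only [inner_circlePoint h₁ h₁₂, normalizedGegenbauer_eq hl] using h

end IsSphereMeasure

end FiniteDimensional

/-! ### Compactness and uniqueness for power series -/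

section PowerSeries

open Filter Topology Set

/-- By strong induction, divide the series by `t ^ n` for `t > 0` and let `t → 0`. -/
theorem eq_zero_of_hasSum_pow {c : ℕ → ℂ} (hc : Summable fun n => ‖c n‖)
    (h : ∀ t ∈ Ioo (-1 : ℝ) 1, HasSum (fun n => c n * ((t ^ n : ℝ) : ℂ)) 0) : c = 0 := by
  funext n
  induction n using Nat.strong_induction_on with
  | _ n ih =>
    set g : ℝ → ℂ := fun t => ∑' k, c (k + n) * ((t ^ k : ℝ) : ℂ)
    have hcn : Summable fun k => ‖c (k + n)‖ := (summable_nat_add_iff n).2 hc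
    have hb : ∀ k, ∀ t ∈ Icc (-1 : ℝ) 1, ‖c (k + n) * ((t ^ k : ℝ) : ℂ)‖ ≤ ‖c (k + n)‖ := by
      intro k t ht
      rw [norm_mul, Complex.norm_real, norm_pow]
      exact mul_le_of_le_one_right (norm_nonneg _) (pow_le_one₀ (norm_nonneg _) (abs_le.2 ht))
    have hg : ContinuousOn g (Icc (-1) 1) :=
      continuousOn_tsum (fun k => by fun_prop) hcn hb
    have hg0 : g 0 = c n := by
      have : g 0 = c (0 + n) * (((0 : ℝ) ^ 0 : ℝ) : ℂ) :=
        tsum_eq_single 0 fun k hk => by simp [hk]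
      simpa using this
    have hz : ∀ t ∈ Ioo (0 : ℝ) 1, g t = 0 := by
      intro t ht
      have h1 := h t ⟨by linarith [ht.1], ht.2⟩
      rw [← hasSum_nat_add_iff' n, Finset.sum_eq_zero fun i hi => by
        rw [ih i (Finset.mem_range.1 hi)]; simp, sub_zero] at h1
      have h2 : HasSum (fun k => c (k + n) * ((t ^ k : ℝ) : ℂ)) (g t) :=
        (Summable.of_norm_bounded hcn fun k => hb k t ⟨by linarith [ht.1], ht.2.le⟩).hasSum
      have h3 := (h2.mul_right ((t ^ n : ℝ) : ℂ)).unique (by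
        refine h1.congr_fun fun k => ?_
        rw [pow_add]; push_cast; ring)
      refine (mul_eq_zero.1 h3).resolve_right ?_
      exact Complex.ofReal_ne_zero.2 (pow_pos ht.1 n).ne'
    have hlim : Tendsto g (𝓝[>] 0) (𝓝 (c n)) := by
      rw [← hg0]
      exact (hg.continuousAt (Icc_mem_nhds (by norm_num) (by norm_num))).tendsto.mono_left
        nhdsWithin_le_nhds
    refine tendsto_nhds_unique hlim (tendsto_const_nhds.congr' ?_)
    filter_upwards [Ioo_mem_nhdsGT (zero_lt_one (α := ℝ))] with t ht using (hz t ht).symm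

variable {ι : Type*} {b : ι → ℕ → ℂ} {g : ι → ℝ → ℂ} {G : ℝ → ℂ} {B : ℝ}

/-- Bounded coefficients converge along an ultrafilter. For `|t| < 1` the geometric majorant `B |t|
^ k` lets the limit pass through the sum; at `|t| = 1` it is not summable, hence the open interval.
-/
theorem Ultrafilter.exists_tendsto_coeff (l : Ultrafilter ι)
    (hb : ∀ᶠ i in l, ∀ s : Finset ℕ, ∑ k ∈ s, ‖b i k‖ ≤ B)
    (hg : ∀ᶠ i in l, ∀ t ∈ Ioo (-1 : ℝ) 1, HasSum (fun k => b i k * ((t ^ k : ℝ) : ℂ)) (g i t))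
    (hG : ∀ t ∈ Ioo (-1 : ℝ) 1, Tendsto (fun i => g i t) l (𝓝 (G t))) :
    ∃ c : ℕ → ℂ, (∀ k, Tendsto (fun i => b i k) l (𝓝 (c k))) ∧ (Summable fun k => ‖c k‖) ∧
      ∀ t ∈ Ioo (-1 : ℝ) 1, HasSum (fun k => c k * ((t ^ k : ℝ) : ℂ)) (G t) := by
  have hb1 : ∀ k, ∀ᶠ i in l, ‖b i k‖ ≤ B := fun k =>
    hb.mono fun i hi => by simpa using hi {k}
  have hex : ∀ k, ∃ c, Tendsto (fun i => b i k) l (𝓝 c) := by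
    intro k
    obtain ⟨c, -, hc⟩ := (isCompact_closedBall (0 : ℂ) B).ultrafilter_le_nhds'
      (l.map fun i => b i k) (by
        rw [Ultrafilter.mem_map]
        filter_upwards [hb1 k] with i hi
        simpa using hi)
    exact ⟨c, hc⟩
  choose c hc using hex
  have hcs : Summable fun k => ‖c k‖ := by
    refine summable_of_sum_le (fun k => norm_nonneg _) (c := B) fun s => ?_
    refine le_of_tendsto (tendsto_finsetSum s fun k _ => (hc k).norm) ?_
    filter_upwards [hb] with i hi using hi s
  refine ⟨c, hc, hcs, fun t ht => ?_⟩
  have hcB : ∀ k, ‖c k‖ ≤ B := fun k => le_of_tendsto (hc k).norm (hb1 k)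
  have ht1 : |t| < 1 := abs_lt.2 ht
  have hlim : Tendsto (fun i => ∑' k, b i k * ((t ^ k : ℝ) : ℂ)) l
      (𝓝 (∑' k, c k * ((t ^ k : ℝ) : ℂ))) := by
    refine tendsto_tsum_of_dominated_convergence (bound := fun k => B * |t| ^ k)
      ((summable_geometric_of_lt_one (abs_nonneg t) ht1).mul_left B)
      (fun k => (hc k).mul_const _) ?_
    filter_upwards [hb] with i hi k
    rw [norm_mul, Complex.norm_real, norm_pow, Real.norm_eq_abs]
    exact mul_le_mul_of_nonneg_right (by simpa using hi {k}) (by positivity)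
  have heq : ∑' k, c k * ((t ^ k : ℝ) : ℂ) = G t := by
    refine tendsto_nhds_unique hlim ((hG t ht).congr' ?_)
    filter_upwards [hg] with i hi using (hi t ht).tsum_eq.symm
  rw [← heq]
  refine (Summable.of_norm_bounded hcs fun k => ?_).hasSum
  rw [norm_mul, Complex.norm_real, norm_pow]
  exact mul_le_of_le_one_right (norm_nonneg _) (pow_le_one₀ (norm_nonneg _) ht1.le)

/-- Along every finer ultrafilter the coefficients have some limit, and uniqueness of power series
identifies it with `c`; hence convergence along `l` itself. -/
theorem tendsto_coeff (l : Filter ι)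
    (hb : ∀ᶠ i in l, ∀ s : Finset ℕ, ∑ k ∈ s, ‖b i k‖ ≤ B)
    (hg : ∀ᶠ i in l, ∀ t ∈ Ioo (-1 : ℝ) 1, HasSum (fun k => b i k * ((t ^ k : ℝ) : ℂ)) (g i t))
    (hG : ∀ t ∈ Ioo (-1 : ℝ) 1, Tendsto (fun i => g i t) l (𝓝 (G t))) {c : ℕ → ℂ}
    (hc : Summable fun k => ‖c k‖)
    (hcG : ∀ t ∈ Ioo (-1 : ℝ) 1, HasSum (fun k => c k * ((t ^ k : ℝ) : ℂ)) (G t)) (k : ℕ) :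
    Tendsto (fun i => b i k) l (𝓝 (c k)) := by
  rw [tendsto_iff_ultrafilter]
  intro u hu
  obtain ⟨c', h1, h2, h3⟩ := Ultrafilter.exists_tendsto_coeff u (hb.filter_mono hu)
    (hg.filter_mono hu) fun t ht => (hG t ht).mono_left hu
  have : (fun k => c' k - c k) = 0 := by
    refine eq_zero_of_hasSum_pow
      ((h2.add hc).of_nonneg_of_le (fun _ => norm_nonneg _) fun n => norm_sub_le _ _) fun t ht => ?_
    simpa only [sub_mul, sub_self] using (h3 t ht).sub (hcG t ht)
  rw [← sub_eq_zero.1 (congrFun this k)]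
  exact h1 k

theorem isZonalSystem_pow (E : Type*) [NormedAddCommGroup E] [InnerProductSpace ℝ E] :
    IsZonalSystem E fun n t => t ^ n where
  zero t := pow_zero t
  posDef n := by
    have := (isPosDefKernel_inner (E := E)).comp fun ξ : {x : E // ‖x‖ = 1} => ξ.1
    simpa using this.pow n
  unique c hc h := eq_zero_of_hasSum_pow hc fun t ht => h t (Ioo_subset_Icc_self ht)

end PowerSeries

/-! ### Walsh analysis on inscribed cubes and Bernstein polynomials -/

section Hypercube

open Finset ComplexConjugate

variable {N : ℕ}

/-- The mean of a family of signs. -/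
noncomputable def signMean (σ : Fin N → ℤˣ) : ℝ := (∑ i, ((σ i : ℤ) : ℝ)) / N

/-- Walsh characters. -/
noncomputable def walsh (S : Finset (Fin N)) (σ : Fin N → ℤˣ) : ℝ := ∏ i ∈ S, ((σ i : ℤ) : ℝ)

/-- The coefficient of `t ^ k` in the Bernstein polynomial of order `N` of `f` on `[-1, 1]`. -/
noncomputable def walshCoeff (N k : ℕ) (f : ℝ → ℂ) : ℂ :=
  ∑ S ∈ powersetCard k (univ : Finset (Fin N)),
    (2 ^ N : ℂ)⁻¹ * ∑ σ : Fin N → ℤˣ, (walsh S σ : ℂ) * f (signMean σ)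

/-- Expanding `∏ (1 + t σ i)` over subsets produces each Walsh character with the factor `t ^ #S`.
-/
theorem sum_walshCoeff_mul_pow (N : ℕ) (f : ℝ → ℂ) (t : ℝ) :
    ∑ k ∈ range (N + 1), walshCoeff N k f * ((t ^ k : ℝ) : ℂ) =
      (2 ^ N : ℂ)⁻¹ * ∑ σ : Fin N → ℤˣ, ((∏ i, (1 + t * ((σ i : ℤ) : ℝ)) : ℝ) : ℂ) *
        f (signMean σ) := by
  have h1 : ∀ k ∈ range (N + 1), walshCoeff N k f * ((t ^ k : ℝ) : ℂ) =
      ∑ S ∈ powersetCard k (univ : Finset (Fin N)),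
        (2 ^ N : ℂ)⁻¹ * (∑ σ : Fin N → ℤˣ, (walsh S σ : ℂ) * f (signMean σ)) *
          ((t ^ #S : ℝ) : ℂ) := by
    intro k _
    rw [walshCoeff, sum_mul]
    refine sum_congr rfl fun S hS => ?_
    rw [(mem_powersetCard.1 hS).2]
  have h2 := sum_powerset (univ : Finset (Fin N)) fun S =>
    (2 ^ N : ℂ)⁻¹ * (∑ σ : Fin N → ℤˣ, (walsh S σ : ℂ) * f (signMean σ)) * ((t ^ #S : ℝ) : ℂ)
  rw [card_fin] at h2
  rw [sum_congr rfl h1, ← h2]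
  simp only [mul_assoc]
  rw [← mul_sum]
  simp only [sum_mul]
  rw [sum_comm]
  congr 1
  refine sum_congr rfl fun σ _ => ?_
  rw [prod_one_add]
  push_cast
  rw [sum_mul]
  refine sum_congr rfl fun S _ => ?_
  rw [prod_mul_distrib, prod_const, walsh]
  push_cast
  ring

/-- With `k` plus signs the product is `(1 + t) ^ k (1 - t) ^ (N - k)` and the mean is `2k/N - 1`.
Grouping by `k` gives the average of `f` under a binomial law with success probability `(1 + t) /
2`. -/
theorem sum_signs_eq_bernstein {N : ℕ} (hN : N ≠ 0) (f : ℝ → ℂ) (t : ℝ) :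
    (2 ^ N : ℂ)⁻¹ * ∑ σ : Fin N → ℤˣ, ((∏ i, (1 + t * ((σ i : ℤ) : ℝ)) : ℝ) : ℂ) *
        f (signMean σ) =
      ∑ k ∈ range (N + 1), ((N.choose k * ((1 + t) / 2) ^ k * (1 - (1 + t) / 2) ^ (N - k) : ℝ) : ℂ) *
        f (2 * (k / N) - 1) := by
  classical
  set s : Finset (Fin N) → Fin N → ℤˣ := fun T i => if i ∈ T then 1 else -1
  have hs : Function.Bijective s := by
    constructor
    · intro T T' h
      ext i
      have := congrFun h i
      simp only [s] at this
      by_cases h1 : i ∈ T <;> by_cases h2 : i ∈ T' <;> simp_all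
    · intro σ
      refine ⟨univ.filter fun i => σ i = 1, ?_⟩
      funext i
      rcases Int.units_eq_one_or (σ i) with h | h <;> simp [s, h]
  rw [← hs.sum_comp]
  have hNr : (N : ℝ) ≠ 0 := by exact_mod_cast hN
  have hcast : ∀ (T : Finset (Fin N)) i, ((s T i : ℤ) : ℝ) = if i ∈ T then 1 else -1 := by
    intro T i
    simp only [s]
    split_ifs <;> simp
  have hcard : ∀ T : Finset (Fin N), (univ.filter fun i => i ∉ T).card = N - #T := by
    intro T
    have : (univ.filter fun i => i ∉ T) = Tᶜ := by ext; simp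
    rw [this, card_compl, Fintype.card_fin]
  have hmean : ∀ T, signMean (s T) = 2 * (#T / N) - 1 := by
    intro T
    rw [signMean]
    simp only [hcast]
    rw [sum_ite, sum_const, sum_const, hcard, filter_mem_eq_inter, univ_inter, nsmul_eq_mul,
      nsmul_eq_mul, Nat.cast_sub (by simpa using card_le_univ T)]
    field_simp
    ring
  have hprod : ∀ T, ∏ i, (1 + t * ((s T i : ℤ) : ℝ)) = (1 + t) ^ #T * (1 - t) ^ (N - #T) := by
    intro T
    have : ∀ i, 1 + t * ((s T i : ℤ) : ℝ) = if i ∈ T then 1 + t else 1 - t := by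
      intro i
      rw [hcast]
      split_ifs <;> ring
    simp only [this]
    rw [prod_ite, prod_const, prod_const, hcard, filter_mem_eq_inter, univ_inter]
  simp only [hmean, hprod]
  have h := sum_powerset_apply_card (fun k => (((1 + t) ^ k * (1 - t) ^ (N - k) : ℝ) : ℂ) *
    f (2 * (k / N) - 1)) (x := (univ : Finset (Fin N)))
  rw [powerset_univ, card_fin] at h
  rw [h, mul_sum]
  refine sum_congr rfl fun k hk => ?_
  have hk' : k ≤ N := by rw [mem_range] at hk; omega
  have e : (N.choose k * ((1 + t) / 2) ^ k * (1 - (1 + t) / 2) ^ (N - k) : ℝ) =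
      (2 ^ N)⁻¹ * (N.choose k * ((1 + t) ^ k * (1 - t) ^ (N - k))) := by
    have e1 : 1 - (1 + t) / 2 = (1 - t) / 2 := by ring
    have e2 : (2 : ℝ) ^ N = 2 ^ k * 2 ^ (N - k) := by rw [← pow_add, Nat.add_sub_cancel' hk']
    rw [e1, div_pow, div_pow, e2]
    field_simp
  rw [e, nsmul_eq_mul]
  push_cast
  ring

variable {E : Type*} [NormedAddCommGroup E] [InnerProductSpace ℝ E]

/-- The vertices of the cube inscribed in the unit sphere. -/
noncomputable def cubePoint (u : ℕ → E) (σ : Fin N → ℤˣ) : E :=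
  (√N)⁻¹ • ∑ i, ((σ i : ℤ) : ℝ) • u i

theorem inner_cubePoint {u : ℕ → E} (hu : Orthonormal ℝ u) (σ τ : Fin N → ℤˣ) :
    inner ℝ (cubePoint u σ) (cubePoint u τ) = signMean (σ * τ) := by
  have hu' : Orthonormal ℝ fun i : Fin N => u i := hu.comp _ Fin.val_injective
  rw [cubePoint, cubePoint, real_inner_smul_left, real_inner_smul_right, hu'.inner_sum, signMean,
    ← mul_assoc, ← mul_inv, Real.mul_self_sqrt (Nat.cast_nonneg N), div_eq_inv_mul]
  simp

theorem norm_cubePoint {u : ℕ → E} (hu : Orthonormal ℝ u) (hN : N ≠ 0) (σ : Fin N → ℤˣ) :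
    ‖cubePoint u σ‖ = 1 := by
  have h : ‖cubePoint u σ‖ ^ 2 = 1 ^ 2 := by
    have hσ : σ * σ = 1 := by funext i; exact Int.units_mul_self (σ i)
    have hNr : (N : ℝ) ≠ 0 := by exact_mod_cast hN
    rw [← real_inner_self_eq_norm_sq, inner_cubePoint hu, hσ, signMean]
    simp [hNr]
  exact (sq_eq_sq₀ (norm_nonneg _) zero_le_one).1 h

/-- On the vertices `K` depends on `στ` only, so testing with a Walsh character, which is
multiplicative with values `±1`, extracts its Fourier coefficient. Such a test over all vertices
preserves positive definiteness in the radii. -/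
theorem isPosDefKernel_walshCoeff {u : ℕ → E} (hu : Orthonormal ℝ u) {K : E → E → ℂ}
    (hK : IsPosDefKernel K) {κ : ℝ≥0 → ℝ≥0 → ℝ → ℂ} (hκ : IsInvariantRepresentation K κ)
    (hN : N ≠ 0) (k : ℕ) :
    IsPosDefKernel fun r s : ℝ≥0 => walshCoeff N k fun t => κ r s (r * s * t) := by
  refine IsPosDefKernel.finset_sum _ fun S _ => ?_
  have hinv : (0 : ℂ) ≤ (((2 ^ N : ℝ)⁻¹ : ℝ) : ℂ) := Complex.zero_le_real.2 (by positivity)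
  -- One factor `2 ^ (-N)` is the normalization of `walshCoeff`; the other cancels the `2 ^ N` equal
  -- sums over `σ`.
  have h := ((hK.sum_comp (fun (σ : Fin N → ℤˣ) (r : ℝ≥0) => (r : ℝ) • cubePoint u σ)
    fun σ => (walsh S σ : ℂ)).const_mul hinv).const_mul hinv
  convert h using 3 with r s
  push_cast
  congr 1
  have hinner : ∀ σ : Fin N → ℤˣ, ∑ τ, (walsh S σ : ℂ) * conj (walsh S τ : ℂ) *
      K ((r : ℝ) • cubePoint u σ) ((s : ℝ) • cubePoint u τ) =
      ∑ τ, (walsh S τ : ℂ) * κ r s (r * s * signMean τ) := by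
    intro σ
    rw [← Equiv.sum_comp (Equiv.mulLeft σ)]
    refine sum_congr rfl fun τ _ => ?_
    rw [hκ.apply_smul_unit (norm_cubePoint hu hN _) (norm_cubePoint hu hN _),
      inner_cubePoint hu, Complex.conj_ofReal, ← Complex.ofReal_mul]
    have hσ : σ * σ = 1 := by funext i; exact Int.units_mul_self (σ i)
    have e1 : σ * (Equiv.mulLeft σ τ) = τ := by
      rw [Equiv.coe_mulLeft, ← mul_assoc, hσ, one_mul]
    have e2 : walsh S σ * walsh S (Equiv.mulLeft σ τ) = walsh S τ := by
      rw [walsh, walsh, ← prod_mul_distrib]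
      refine prod_congr rfl fun i _ => ?_
      have := congrFun e1 i
      rw [Pi.mul_apply] at this
      rw [← this]
      push_cast
      rfl
    rw [e1, e2]
  rw [sum_congr rfl fun σ _ => hinner σ, sum_const, card_univ]
  have hc : Fintype.card (Fin N → ℤˣ) = 2 ^ N := by simp
  rw [hc, nsmul_eq_mul]
  push_cast
  rw [inv_mul_cancel_left₀ (by positivity)]

end Hypercube

/-! ### The expansion in infinite dimension -/

section InfiniteDimensional

open Filter Topology Set

theorem tendsto_bernstein {f : ℝ → ℂ} (hf : ContinuousOn f (Icc (-1) 1)) {t : ℝ}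
    (ht : t ∈ Icc (-1 : ℝ) 1) :
    Tendsto (fun N : ℕ => ∑ k ∈ Finset.range (N + 1),
      ((N.choose k * ((1 + t) / 2) ^ k * (1 - (1 + t) / 2) ^ (N - k) : ℝ) : ℂ) *
        f (2 * (k / N) - 1)) atTop (𝓝 (f t)) := by
  set g : C(unitInterval, ℂ) := ⟨fun y => f (2 * y - 1), by
    refine hf.comp_continuous (by fun_prop) fun y => ⟨?_, ?_⟩
    · linarith [y.2.1]
    · linarith [y.2.2]⟩
  set x : unitInterval := ⟨(1 + t) / 2, by linarith [ht.1], by linarith [ht.2]⟩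
  have h := ((ContinuousEvalConst.continuous_eval_const x).tendsto g).comp
    (bernsteinApproximation_uniform g)
  have hx : g x = f t := by
    simp only [g, x, ContinuousMap.coe_mk]
    congr 1; ring
  rw [hx] at h
  refine h.congr fun N => ?_
  simp only [Function.comp_apply, bernsteinApproximation.apply, bernstein_apply]
  rw [Finset.sum_range]
  refine Finset.sum_congr rfl fun k _ => ?_
  rw [Complex.real_smul]
  rfl

theorem hasSum_walshCoeff {N : ℕ} (hN : N ≠ 0) (f : ℝ → ℂ) (t : ℝ) :
    HasSum (fun k => walshCoeff N k f * ((t ^ k : ℝ) : ℂ)) (∑ k ∈ Finset.range (N + 1),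
      ((N.choose k * ((1 + t) / 2) ^ k * (1 - (1 + t) / 2) ^ (N - k) : ℝ) : ℂ) *
        f (2 * (k / N) - 1)) := by
  rw [← sum_signs_eq_bernstein hN, ← sum_walshCoeff_mul_pow]
  refine hasSum_sum_of_ne_finset_zero fun k hk => ?_
  rw [walshCoeff, Finset.powersetCard_eq_empty.2, Finset.sum_empty, zero_mul]
  simpa using hk

/-- A Bernstein polynomial interpolates at the endpoint `1`. On the diagonal this bounds the sum of
the nonnegative coefficients uniformly in `N`. -/
theorem hasSum_walshCoeff_one {N : ℕ} (hN : N ≠ 0) (f : ℝ → ℂ) :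
    HasSum (fun k => walshCoeff N k f) (f 1) := by
  have h := hasSum_walshCoeff hN f 1
  simp only [one_pow, Complex.ofReal_one, mul_one] at h
  convert h using 1
  rw [Finset.sum_eq_single_of_mem N (by simp)]
  · have : (N : ℝ) ≠ 0 := by exact_mod_cast hN
    norm_num [this]
  · intro k hk hkN
    rw [Finset.mem_range] at hk
    have : N - k ≠ 0 := by omega
    norm_num [this]

variable {E : Type*} [NormedAddCommGroup E] [InnerProductSpace ℝ E]

/-- The coefficients are limits, along a free ultrafilter, of those of the Bernstein polynomials, so
they inherit positive definiteness and the bound by `D`. Their continuity is not inherited; it is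
deduced afterwards from that of `κ` by `tendsto_coeff`. -/
theorem exists_isSphericalExpansion_pow {u : ℕ → E} (hu : Orthonormal ℝ u) {K : E → E → ℂ}
    (hK : Continuous fun p : E × E => K p.1 p.2) (hpd : IsPosDefKernel K)
    {κ : ℝ≥0 → ℝ≥0 → ℝ → ℂ} (hκ : IsInvariantRepresentation K κ) :
    ∃ α, IsSphericalExpansion (fun n t => t ^ n) K α := by
  set D : ℝ≥0 → ℝ := fun r => (K ((r : ℝ) • u 0) ((r : ℝ) • u 0)).re
  have hDκ : ∀ r, (κ r r (r * r * 1)).re = D r := fun r => by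
    have := hκ.apply_smul_unit (hu.1 0) (hu.1 0) r r
    rw [real_inner_self_eq_norm_sq, hu.1 0, one_pow] at this
    rw [← this]
  have hDc : Continuous D := Complex.continuous_re.comp
    (hK.comp (f := fun r : ℝ≥0 => ((r : ℝ) • u 0, (r : ℝ) • u 0)) (by fun_prop))
  set A : ℕ → ℕ → ℝ≥0 → ℝ≥0 → ℂ := fun N k r s => walshCoeff N k fun t => κ r s (r * s * t)
  have hApd : ∀ {N}, N ≠ 0 → ∀ k, IsPosDefKernel (A N k) := fun hN k =>
    isPosDefKernel_walshCoeff hu hpd hκ hN k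
  have hAdiag : ∀ {N}, N ≠ 0 → ∀ r (S : Finset ℕ), ∑ k ∈ S, (A N k r r).re ≤ D r := by
    intro N hN r S
    have h := Complex.reCLM.hasSum (hasSum_walshCoeff_one hN fun t => κ r r (r * r * t))
    rw [← hDκ r]
    exact sum_le_hasSum S (fun k _ => (hApd hN k).diag_re_nonneg r) h
  have hbound : ∀ {a : ℕ → ℝ≥0 → ℝ≥0 → ℂ}, (∀ k, IsPosDefKernel (a k)) →
      (∀ r (S : Finset ℕ), ∑ k ∈ S, (a k r r).re ≤ D r) →
      ∀ r s (S : Finset ℕ), ∑ k ∈ S, ‖a k r s‖ ≤ (D r + D s) / 2 := by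
    intro a ha h r s S
    refine (Finset.sum_le_sum fun k _ => (ha k).norm_le r s).trans ?_
    rw [← Finset.sum_div, Finset.sum_add_distrib]
    linarith [h r S, h s S]
  have hne : ∀ᶠ N in (hyperfilter ℕ : Filter ℕ), N ≠ 0 :=
    (eventually_ne_atTop 0).filter_mono Nat.hyperfilter_le_atTop
  have hex : ∀ r s, ∃ c : ℕ → ℂ,
      (∀ k, Tendsto (fun N => A N k r s) (hyperfilter ℕ) (𝓝 (c k))) ∧ (Summable fun k => ‖c k‖) ∧
      ∀ t ∈ Ioo (-1 : ℝ) 1, HasSum (fun k => c k * ((t ^ k : ℝ) : ℂ)) (κ r s (r * s * t)) := by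
    intro r s
    refine Ultrafilter.exists_tendsto_coeff (b := fun N k => A N k r s) (B := (D r + D s) / 2)
      (hyperfilter ℕ) (hne.mono fun N hN => hbound (hApd hN) (hAdiag hN) r s)
      (hne.mono fun N hN t _ => hasSum_walshCoeff hN _ t) fun t ht => ?_
    exact (tendsto_bernstein (hκ.continuousOn_section r s) (Ioo_subset_Icc_self ht)).mono_left
      Nat.hyperfilter_le_atTop
  choose α₀ hlim hsum hser using hex
  set α : ℕ → ℝ≥0 → ℝ≥0 → ℂ := fun k r s => α₀ r s k
  have hαpd : ∀ k, IsPosDefKernel (α k) := fun k =>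
    IsPosDefKernel.of_tendsto (F := fun N => A N k) (l := (hyperfilter ℕ : Filter ℕ))
      (hne.mono fun N hN => hApd hN k) fun r s => hlim r s k
  have hαdiag : ∀ r (S : Finset ℕ), ∑ k ∈ S, (α k r r).re ≤ D r := by
    intro r S
    refine le_of_tendsto (f := fun N => ∑ k ∈ S, (A N k r r).re)
      (x := (hyperfilter ℕ : Filter ℕ)) ?_ (hne.mono fun N hN => hAdiag hN r S)
    exact tendsto_finsetSum S fun k _ =>
      (Complex.continuous_re.tendsto _).comp (hlim r r k)
  refine ⟨α, hκ.isSphericalExpansion (isZonalSystem_pow E) (fun k => ?_) hαpd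
    (fun r => (hsum r r).of_norm) fun r s t ht => ?_⟩
  · rw [continuous_iff_continuousAt]
    rintro ⟨r, s⟩
    -- The `+ 1` leaves room for the coefficient bound `(D p.1 + D p.2) / 2` to hold in a whole
    -- neighbourhood of `(r, s)`.
    refine tendsto_coeff (b := fun (p : ℝ≥0 × ℝ≥0) k => α k p.1 p.2)
      (g := fun p t => κ p.1 p.2 (p.1 * p.2 * t)) (B := D r + D s + 1) (𝓝 (r, s)) ?_
      (.of_forall fun p t ht => hser p.1 p.2 t ht) (fun t ht => ?_) (hsum r s) (hser r s) k
    · have h1 : Continuous fun p : ℝ≥0 × ℝ≥0 => (D p.1 + D p.2) / 2 := by fun_prop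
      have hD0 : ∀ r, 0 ≤ D r := fun r => hpd.diag_re_nonneg _
      have h2 : ∀ᶠ p : ℝ≥0 × ℝ≥0 in 𝓝 (r, s), (D p.1 + D p.2) / 2 < D r + D s + 1 :=
        h1.continuousAt.eventually_lt continuousAt_const (by
          simp only; linarith [hD0 r, hD0 s])
      filter_upwards [h2] with p hp S
      exact (hbound hαpd hαdiag p.1 p.2 S).trans hp.le
    · have : Continuous fun p : ℝ≥0 × ℝ≥0 => κ p.1 p.2 (p.1 * p.2 * t) := by
        refine hκ.1.comp_continuous
          (f := fun p : ℝ≥0 × ℝ≥0 => ((p.1, p.2, p.1 * p.2 * t) : ℝ≥0 × ℝ≥0 × ℝ)) (by fun_prop)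
          fun p => ?_
        simp only [invariantDomain, mem_ofPred_eq, abs_mul, NNReal.abs_eq]
        exact mul_le_of_le_one_right (by positivity) (abs_lt.2 ht).le
      exact this.tendsto (r, s)
  · have hb : ∀ k, ∀ t ∈ Icc (-1 : ℝ) 1, ‖α k r s * ((t ^ k : ℝ) : ℂ)‖ ≤ ‖α k r s‖ := by
      intro k t ht
      rw [norm_mul, Complex.norm_real, norm_pow]
      exact mul_le_of_le_one_right (norm_nonneg _) (pow_le_one₀ (norm_nonneg _) (abs_le.2 ht))
    have hc : ContinuousOn (fun t : ℝ => ∑' k, α k r s * ((t ^ k : ℝ) : ℂ)) (Icc (-1) 1) :=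
      continuousOn_tsum (fun k => by fun_prop) (hsum r s) hb
    -- The limit argument gives equality only for `|t| < 1`; both sides are continuous on `[-1, 1]`,
    -- which adds the endpoints.
    have heq : EqOn (fun t : ℝ => ∑' k, α k r s * ((t ^ k : ℝ) : ℂ))
        (fun t => κ r s (r * s * t)) (Ioo (-1) 1) := fun t ht => (hser r s t ht).tsum_eq
    have heq' := heq.of_subset_closure hc (hκ.continuousOn_section r s) Ioo_subset_Icc_self
      (by rw [closure_Ioo (by norm_num)]) ht
    simp only at heq'
    rw [← heq']
    exact (Summable.of_norm_bounded (hsum r s) fun k => hb k t ht).hasSum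

theorem tfae_of_exists {P : ℕ → ℝ → ℝ} (hP : IsZonalSystem E P) {e₁ e₂ : E} (h₁ : ‖e₁‖ = 1)
    (h₂ : ‖e₂‖ = 1) (h₁₂ : inner ℝ e₁ e₂ = 0) {K : E → E → ℂ}
    (hK : Continuous fun p : E × E => K p.1 p.2)
    (hex : IsPosDefKernel K → ∀ κ, IsInvariantRepresentation K κ →
      ∃ α, IsSphericalExpansion P K α) :
    List.TFAE [
      IsPosDefKernel K ∧ IsOrthogonallyInvariant K,
      IsPosDefKernel K ∧ ∃ κ, IsInvariantRepresentation K κ,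
      ∃ α, IsSphericalExpansion P K α] := by
  tfae_have 1 → 2 := fun h => ⟨h.1, h.2.exists_representation hK h₁ h₂ h₁₂⟩
  tfae_have 2 → 3 := fun ⟨h, κ, hκ⟩ => hex h κ hκ
  tfae_have 3 → 1 := fun ⟨_, hα⟩ => ⟨hα.isPosDefKernel hP h₁, hα.isOrthogonallyInvariant⟩
  tfae_finish

end InfiniteDimensional

/-! ### The main theorem -/

theorem theorem1 :
    -- finite dimension `d ≥ 2`, with index `(d - 2) / 2`
    (∀ (d : ℕ) (_ : 2 ≤ d) (K : EuclideanSpace ℝ (Fin d) → EuclideanSpace ℝ (Fin d) → ℂ)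
        (_ : Continuous fun p : EuclideanSpace ℝ (Fin d) × EuclideanSpace ℝ (Fin d) => K p.1 p.2),
      List.TFAE [
        IsPosDefKernel K ∧ IsOrthogonallyInvariant K,
        IsPosDefKernel K ∧ ∃ κ, IsInvariantRepresentation K κ,
        ∃ α, IsSphericalExpansion (normalizedGegenbauer (((d : ℝ) - 2) / 2)) K α] ∧
      -- uniqueness
      (∀ α β, IsSphericalExpansion (normalizedGegenbauer (((d : ℝ) - 2) / 2)) K α →
        IsSphericalExpansion (normalizedGegenbauer (((d : ℝ) - 2) / 2)) K β → α = β) ∧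
      -- real-valuedness
      (∀ α, IsSphericalExpansion (normalizedGegenbauer (((d : ℝ) - 2) / 2)) K α →
        ((∀ n r s, (α n r s).im = 0) ↔ ∀ x y, (K x y).im = 0)) ∧
      -- integral formula
      (∀ α κ, IsSphericalExpansion (normalizedGegenbauer (((d : ℝ) - 2) / 2)) K α →
        IsInvariantRepresentation K κ → ∀ (n : ℕ) (r s : ℝ≥0),
          IntervalIntegrable (fun ρ : ℝ => κ r s (r * s * ρ) *
            (normalizedGegenbauer (((d : ℝ) - 2) / 2) n ρ : ℂ) *
            (gegenbauerWeight (((d : ℝ) - 2) / 2) ρ : ℂ)) MeasureTheory.volume (-1) 1 ∧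
          0 < (∫ ρ in (-1 : ℝ)..1, normalizedGegenbauer (((d : ℝ) - 2) / 2) n ρ ^ 2 *
            gegenbauerWeight (((d : ℝ) - 2) / 2) ρ) ∧
          α n r s =
            (∫ ρ in (-1 : ℝ)..1, κ r s (r * s * ρ) *
              (normalizedGegenbauer (((d : ℝ) - 2) / 2) n ρ : ℂ) *
              (gegenbauerWeight (((d : ℝ) - 2) / 2) ρ : ℂ)) /
            ((∫ ρ in (-1 : ℝ)..1, normalizedGegenbauer (((d : ℝ) - 2) / 2) n ρ ^ 2 *
              gegenbauerWeight (((d : ℝ) - 2) / 2) ρ : ℝ) : ℂ))) ∧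
    -- infinite dimension: real square summable sequences, with the monomials `t ^ n`
    (∀ (K : lp (fun _ : ℕ => ℝ) 2 → lp (fun _ : ℕ => ℝ) 2 → ℂ)
        (_ : Continuous fun p : lp (fun _ : ℕ => ℝ) 2 × lp (fun _ : ℕ => ℝ) 2 => K p.1 p.2),
      List.TFAE [
        IsPosDefKernel K ∧ IsOrthogonallyInvariant K,
        IsPosDefKernel K ∧ ∃ κ, IsInvariantRepresentation K κ,
        ∃ α, IsSphericalExpansion (fun n t => t ^ n) K α] ∧
      (∀ α β, IsSphericalExpansion (fun n t => t ^ n) K α →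
        IsSphericalExpansion (fun n t => t ^ n) K β → α = β) ∧
      (∀ α, IsSphericalExpansion (fun n t => t ^ n) K α →
        ((∀ n r s, (α n r s).im = 0) ↔ ∀ x y, (K x y).im = 0))) := by
  constructor
  · intro d hd K hK
    set b := EuclideanSpace.basisFun (Fin d) ℝ
    have h₁ : ‖b ⟨0, by omega⟩‖ = 1 := b.orthonormal.1 _
    have h₂ : ‖b ⟨1, by omega⟩‖ = 1 := b.orthonormal.1 _
    have h₁₂ : inner ℝ (b ⟨0, by omega⟩) (b ⟨1, by omega⟩) = 0 := b.orthonormal.2 (by simp)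
    have : Nontrivial (EuclideanSpace ℝ (Fin d)) :=
      ⟨⟨b ⟨0, by omega⟩, 0, fun h => by rw [h, norm_zero] at h₁; exact zero_ne_one h₁⟩⟩
    obtain ⟨σ, hσ⟩ := exists_isSphereMeasure (EuclideanSpace ℝ (Fin d))
    have hl : 0 ≤ ((d : ℝ) - 2) / 2 := by
      have : (2 : ℝ) ≤ d := by exact_mod_cast hd
      linarith
    have hW : ∀ e : EuclideanSpace ℝ (Fin d), ‖e‖ = 1 →
        σ.map (fun x => inner ℝ e x) = weightMeasure (((d : ℝ) - 2) / 2) := by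
      intro e he
      have := hσ.map_inner_eq_weightMeasure b (by simpa using hd) he
      rwa [Fintype.card_fin] at this
    have hP := hσ.isZonalSystem hl hW h₁ h₂ h₁₂
    exact ⟨tfae_of_exists hP h₁ h₂ h₁₂ hK fun hpd κ hκ =>
        hσ.exists_isSphericalExpansion hl hW h₁ h₂ h₁₂ hK hpd hκ,
      fun α β hα hβ => hα.eq_of_expansion hβ hP h₁ h₂ h₁₂,
      fun α hα => hα.real_iff hP h₁ h₂ h₁₂,
      fun α κ hα hκ n r s => hσ.coeff_eq_integral hl hW h₁ h₂ h₁₂ hα hκ n r s⟩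
  · intro K hK
    have hP := isZonalSystem_pow (lp (fun _ : ℕ => ℝ) 2)
    -- The identity of `ℓ²` is the coordinate isometry of its standard Hilbert basis, which supplies
    -- the infinite orthonormal sequence spanning the cubes.
    let b : HilbertBasis ℕ ℝ (lp (fun _ : ℕ => ℝ) 2) := ⟨LinearIsometryEquiv.refl ℝ _⟩
    have hu := b.orthonormal
    have h₁ : ‖b 0‖ = 1 := hu.1 0
    have h₂ : ‖b 1‖ = 1 := hu.1 1
    have h₁₂ : inner ℝ (b 0) (b 1) = 0 := hu.2 (by simp)
    exact ⟨tfae_of_exists hP h₁ h₂ h₁₂ hK fun hpd κ hκ =>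
        exists_isSphericalExpansion_pow hu hK hpd hκ,
      fun α β hα hβ => hα.eq_of_expansion hβ hP h₁ h₂ h₁₂,
      fun α hα => hα.real_iff hP h₁ h₂ h₁₂⟩
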